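/- **Conventions.** For a group $G$ and a subgroup $H\subseteq G$ let $C_G(H)$ be the centralizer of $H$ in $G$. $H$ is a *Howe subgroup* of $G$ if $C_G(C_G(H))=H$; the Howe subgroup of $G$ generated by $H$ is the smallest Howe subgroup of $G$ containing $H$, namely $C_G(C_G(H))$. Let $H$ be a Howe subgroup of $\mathrm{O}(n)$. Then $\mathbb{R}^n$ is the orthogonal direct sum of the irreducible subspaces $V_1,\dots,V_r$ of the representation of $H\times C_{\mathrm{O}(n)}(H)$, and $H$ is the direct product of its restrictions $H|_{V_1},\dots,H|_{V_r}$, which are called the *factors* of $H$. A factor $H|_{V_i}$ is said to be a factor $\mathrm{O}(m)_k$ ($m,k\ge 1$) if some linear isometry $V_i\cong\mathbb{R}^m\otimes\mathbb{R}^k$ carries $H|_{V_i}$ onto $\{a\otimes \mathbb{1}_k : a\in \mathrm{O}(m)\}$. $H$ contains a double factor $\mathrm{O}(m)_k\times\mathrm{O}(m)_l$ if it has two different factors (that is, $H|_{V_i}$ and $H|_{V_j}$ with $i\ne j$), one of which is an $\mathrm{O}(m)_k$ and the other an $\mathrm{O}(m)_l$. Let $P\to M$ be a smooth principal $\mathrm{SO}(n)$-bundle.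 A *Howe subbundle* of $P$ is a (smooth) reduction $Q\subseteq P$ of $P$ to a Howe subgroup of $\mathrm{SO}(n)$. A Howe subbundle $Q$ is *holonomy-induced* if it is generated by the holonomy subbundle of some smooth connection in $P$, i.e. if there are a connection $A$ in $P$ and a point $u_0\in P$ such that $Q$ is the smallest Howe subbundle of $P$ that contains the set $P_A(u_0)$ of all points of $P$ which can be joined to $u_0$ by a piecewise $C^1$ $A$-horizontal curve. **Theorem.** Let $M$ be a smooth manifold without boundary (Hausdorff, $\sigma$-compact; for instance, a closed manifold) which is simply connected and of dimension $d\ge 2$. Let $P$ be a smooth principal $\mathrm{SO}(n)$-bundle over $M$, and let $Q$ be a Howe subbundle of $P$, with structure group the Howe subgroup $\tilde H$ of $\mathrm{SO}(n)$. Then $Q$ is holonomy-induced if and only if the Howe subgroup $C_{\mathrm{O}(n)}(C_{\mathrm{O}(n)}(\tilde H))$ of $\mathrm{O}(n)$ generated by $\tilde H$ contains neither a factor $\mathrm{O}(2)_k$ with $k\ge1$ nor a double factor $\mathrm{O}(1)_k\times\mathrm{O}(1)_l$ with $k,l\ge1$. -/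

import Mathlib

open Manifold
open scoped ContDiff Kronecker

noncomputable section

/-! ### Howe subgroups -/

/-- The double centralizer `C²_G(H)`. -/
def howeHull {G : Type*} [Group G] (H : Subgroup G) : Subgroup G :=
  Subgroup.centralizer ((Subgroup.centralizer (H : Set G) : Subgroup G) : Set G)

/-- A Howe subgroup is a subgroup which equals its own double centralizer. -/
def IsHowe {G : Type*} [Group G] (H : Subgroup G) : Prop :=
  howeHull H = H

theorem le_howeHull {G : Type*} [Group G] (H : Subgroup G) : H ≤ howeHull H := by
  intro h hh
  rw [howeHull, Subgroup.mem_centralizer_iff]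
  intro c hc
  exact (Subgroup.mem_centralizer_iff.mp hc h hh).symm

theorem howeHull_mono {G : Type*} [Group G] {H K : Subgroup G} (h : H ≤ K) :
    howeHull H ≤ howeHull K :=
  Subgroup.centralizer_le (Subgroup.centralizer_le h)

/-- `howeHull H` is the smallest Howe subgroup which contains `H`, that is, the Howe subgroup
generated by `H`. -/
theorem howeHull_isLeast {G : Type*} [Group G] (H : Subgroup G) :
    IsLeast {K : Subgroup G | IsHowe K ∧ H ≤ K} (howeHull H) := by
  refine ⟨⟨le_antisymm ?_ (le_howeHull _), le_howeHull H⟩, ?_⟩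
  · exact Subgroup.centralizer_le
      (le_howeHull (Subgroup.centralizer (H : Set G)))
  · rintro K ⟨hK, hHK⟩
    exact (howeHull_mono hHK).trans hK.le

/-! ### The groups `O(n)` and `SO(n)` -/

/-- The orthogonal group `O(n)`. -/
abbrev OGrp (n : ℕ) : Type := Matrix.orthogonalGroup (Fin n) ℝ

/-- The special orthogonal group `SO(n)`. -/
abbrev SOGrp (n : ℕ) : Type := Matrix.specialOrthogonalGroup (Fin n) ℝ

/-- The inclusion of `SO(n)` into `O(n)`. -/
def inclSO (n : ℕ) : SOGrp n →* OGrp n :=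
  Submonoid.inclusion Matrix.specialUnitaryGroup_le_unitaryGroup

/-! ### Factors of a Howe subgroup of `O(n)` -/

/-- The subspace `V` of `ℝⁿ` is mapped into itself by all elements of `H`. -/
def IsInvariantUnder {n : ℕ} (H : Subgroup (OGrp n))
    (V : Submodule ℝ (EuclideanSpace ℝ (Fin n))) : Prop :=
  ∀ h ∈ H, ∀ v ∈ V, Matrix.toEuclideanLin h.1 v ∈ V

/-- `V` is invariant under `H` and under its centralizer in `O(n)`. -/
def IsBiinvariant {n : ℕ} (H : Subgroup (OGrp n))
    (V : Submodule ℝ (EuclideanSpace ℝ (Fin n))) : Prop :=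
  IsInvariantUnder H V ∧ IsInvariantUnder (Subgroup.centralizer (H : Set (OGrp n))) V

/-- `V` is an irreducible subspace for the representation of `H × C(H)` on `ℝⁿ`. When `H` is a
Howe subgroup, `ℝⁿ` is the orthogonal direct sum of these subspaces, and `H` is the direct product
of its restrictions to them: these restrictions are the irreducible factors of `H`. -/
def IsFactorSpace {n : ℕ} (H : Subgroup (OGrp n))
    (V : Submodule ℝ (EuclideanSpace ℝ (Fin n))) : Prop :=
  V ≠ ⊥ ∧ IsBiinvariant H V ∧ ∀ W ≤ V, IsBiinvariant H W → W = ⊥ ∨ W = V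

/-- The restriction of `H` to its factor space `V` is the group `O(m)_k`, that is, some linear
isometry from `V` onto `ℝᵐ ⊗ ℝᵏ` carries the restrictions of the elements of `H` to `V` exactly to
the transformations `a ⊗ 1` with `a` in `O(m)`. -/
def IsOFactor {n : ℕ} (H : Subgroup (OGrp n))
    (V : Submodule ℝ (EuclideanSpace ℝ (Fin n))) (m k : ℕ) : Prop :=
  IsFactorSpace H V ∧
    ∃ e : EuclideanSpace ℝ (Fin m × Fin k) ≃ₗᵢ[ℝ] V,
      (∀ h ∈ H, ∃ a ∈ Matrix.orthogonalGroup (Fin m) ℝ, ∀ w,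
        Matrix.toEuclideanLin h.1 (e w : EuclideanSpace ℝ (Fin n)) =
          e (Matrix.toEuclideanLin (a ⊗ₖ (1 : Matrix (Fin k) (Fin k) ℝ)) w)) ∧
      (∀ a ∈ Matrix.orthogonalGroup (Fin m) ℝ, ∃ h ∈ H, ∀ w,
        Matrix.toEuclideanLin h.1 (e w : EuclideanSpace ℝ (Fin n)) =
          e (Matrix.toEuclideanLin (a ⊗ₖ (1 : Matrix (Fin k) (Fin k) ℝ)) w))

/-- `H` contains a factor `O(m)_k` for some positive integer `k`. -/
def HasOFactor {n : ℕ} (H : Subgroup (OGrp n)) (m : ℕ) : Prop :=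
  ∃ V k, 0 < k ∧ IsOFactor H V m k

/-- `H` contains a double factor `O(m)_k × O(m)_l` for some positive integers `k` and `l`. -/
def HasDoubleOFactor {n : ℕ} (H : Subgroup (OGrp n)) (m : ℕ) : Prop :=
  ∃ V W k l, 0 < k ∧ 0 < l ∧ V ≠ W ∧ IsOFactor H V m k ∧ IsOFactor H W m l

/-! ### Smooth principal bundles, reductions and connections -/

section Bundles

variable {n d : ℕ} {M : Type*} [TopologicalSpace M] [ChartedSpace (EuclideanSpace ℝ (Fin d)) M]

/-- The `SO(n)`-valued function `g` is smooth on `U`. -/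
def SmoothIntoSO (g : M → SOGrp n) (U : Set M) : Prop :=
  ∀ a b, ContMDiffOn (𝓡 d) 𝓘(ℝ, ℝ) ∞ (fun x => (g x).1 a b) U

variable (n d M) in
/-- A smooth principal `SO(n)`-bundle `P → M`: a right action of `SO(n)` on the total space `P`
which is free and whose orbits are the fibres of the projection, together with local sections
`sec i` over the sets `dom i` of an open cover of `M` which are related by smooth transition
functions. The topology and the smooth structure of `P` are those for which the local
trivializations `(x, g) ↦ sec i x · g` are diffeomorphisms. -/
structure PrincipalSOBundle (P : Type*) where
  proj : P → M
  act : P → SOGrp n → P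
  act_one : ∀ u, act u 1 = u
  act_mul : ∀ u g h, act u (g * h) = act (act u g) h
  act_free : ∀ u g, act u g = u → g = 1
  proj_act : ∀ u g, proj (act u g) = proj u
  act_transitive : ∀ u v, proj u = proj v → ∃ g, act u g = v
  ι : Type*
  dom : ι → Set M
  isOpen_dom : ∀ i, IsOpen (dom i)
  cover : ∀ x, ∃ i, x ∈ dom i
  sec : ι → M → P
  proj_sec : ∀ i, ∀ x ∈ dom i, proj (sec i x) = x
  transition : ι → ι → M → SOGrp n
  sec_transition : ∀ i j, ∀ x ∈ dom i ∩ dom j, act (sec i x) (transition i j x) = sec j x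
  smooth_transition : ∀ i j, SmoothIntoSO (d := d) (transition i j) (dom i ∩ dom j)

variable {P : Type*}

/-- `s` is a smooth section of `P` over the open set `U`. -/
def PrincipalSOBundle.IsSmoothSection (B : PrincipalSOBundle n d M P) (U : Set M) (s : M → P) :
    Prop :=
  IsOpen U ∧ (∀ x ∈ U, B.proj (s x) = x) ∧
    ∀ i, ∃ g : M → SOGrp n, (∀ x ∈ B.dom i ∩ U, B.act (B.sec i x) (g x) = s x) ∧
      SmoothIntoSO (d := d) g (B.dom i ∩ U)

/-- The subset `Q` of `P` is a reduction of `P` to the subgroup `H`: the group `H` acts on `Q`,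
transitively on the fibres of `Q`, and `P` has smooth sections with values in `Q` near every point
of `M`. -/
def PrincipalSOBundle.IsReduction (B : PrincipalSOBundle n d M P) (H : Subgroup (SOGrp n))
    (Q : Set P) : Prop :=
  (∀ u ∈ Q, ∀ h ∈ H, B.act u h ∈ Q) ∧
    (∀ u ∈ Q, ∀ v ∈ Q, B.proj u = B.proj v → ∃ h ∈ H, B.act u h = v) ∧
    ∀ x, ∃ U s, x ∈ U ∧ B.IsSmoothSection U s ∧ ∀ y ∈ U, s y ∈ Q

/-- A Howe subbundle of `P` with structure group `H`: a reduction of `P` to a Howe subgroup of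
`SO(n)`. -/
def PrincipalSOBundle.IsHoweSubbundle (B : PrincipalSOBundle n d M P) (H : Subgroup (SOGrp n))
    (Q : Set P) : Prop :=
  IsHowe H ∧ B.IsReduction H Q

/-- The subset `S` of `P` generates the Howe subbundle `Q`: among all Howe subbundles of `P`, `Q`
is the smallest one which contains `S`. -/
def PrincipalSOBundle.Generates (B : PrincipalSOBundle n d M P) (S Q : Set P) : Prop :=
  IsLeast {R : Set P | (∃ K, B.IsHoweSubbundle K R) ∧ S ⊆ R} Q

/-- A smooth connection in `P`, given by its local connection forms with respect to the sections
`sec i`: these are smooth 1-forms with values in the skew-symmetric matrices, subject to the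
transformation law `A_j = g⁻¹ A_i g + g⁻¹ dg` for `sec j = sec i · g`. A 1-form is smooth if it is
smooth as a function on the tangent bundle. -/
structure PrincipalSOBundle.Connection [IsManifold (𝓡 d) ∞ M] (B : PrincipalSOBundle n d M P) where
  form : B.ι → (x : M) → TangentSpace (𝓡 d) x →ₗ[ℝ] Matrix (Fin n) (Fin n) ℝ
  skew : ∀ i, ∀ x ∈ B.dom i, ∀ v, (form i x v).transpose = -form i x v
  smooth : ∀ i a b, ContMDiffOn (𝓡 d).tangent 𝓘(ℝ, ℝ) ∞
    (fun p : TangentBundle (𝓡 d) M => form i p.proj p.snd a b) {p | p.proj ∈ B.dom i}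
  transform : ∀ i j, ∀ x ∈ B.dom i ∩ B.dom j, ∀ v : TangentSpace (𝓡 d) x,
    form j x v =
      (B.transition i j x).1.transpose * form i x v * (B.transition i j x).1 +
        (B.transition i j x).1.transpose * Matrix.of fun a b =>
          (mfderiv (𝓡 d) 𝓘(ℝ, ℝ) (fun y => (B.transition i j y).1 a b) x v : ℝ)

/-- The restriction of `u` to `[0, 1]` is a horizontal `C¹` curve in `P`: the projected curve `γ`
is of class `C¹`, and wherever `γ` lies in `dom i` and `u = (sec i ∘ γ) · a`, the function `a`
satisfies `a' = -A_i(γ') a`. -/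
def PrincipalSOBundle.Connection.IsHorizontal [IsManifold (𝓡 d) ∞ M]
    {B : PrincipalSOBundle n d M P} (A : B.Connection) (u : ℝ → P) : Prop :=
  ContMDiffOn 𝓘(ℝ, ℝ) (𝓡 d) 1 (fun t => B.proj (u t)) (Set.Icc 0 1) ∧
    ∀ t ∈ Set.Icc (0 : ℝ) 1, ∀ i, B.proj (u t) ∈ B.dom i →
      ∃ a : ℝ → SOGrp n,
        (∀ τ ∈ Set.Icc (0 : ℝ) 1, B.proj (u τ) ∈ B.dom i →
          B.act (B.sec i (B.proj (u τ))) (a τ) = u τ) ∧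
        ∀ p q, HasDerivWithinAt (fun τ => (a τ).1 p q)
          ((-(A.form i (B.proj (u t))
            (mfderivWithin 𝓘(ℝ, ℝ) (𝓡 d) (fun τ => B.proj (u τ)) (Set.Icc 0 1) t (1 : ℝ)) *
              (a t).1)) p q) (Set.Icc 0 1) t

/-- The holonomy subbundle of `A` through `u₀`: the set of all points of `P` which can be joined
to `u₀` by a piecewise `C¹` horizontal curve. -/
def PrincipalSOBundle.Connection.holonomyBundle [IsManifold (𝓡 d) ∞ M]
    {B : PrincipalSOBundle n d M P} (A : B.Connection) (u₀ : P) : Set P :=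
  {v | Relation.ReflTransGen (fun p q => ∃ u, A.IsHorizontal u ∧ u 0 = p ∧ u 1 = q) u₀ v}

/-- The Howe subbundle `Q` is holonomy-induced: it is generated by the holonomy subbundle of some
connection in `P`. -/
def PrincipalSOBundle.IsHolonomyInduced [IsManifold (𝓡 d) ∞ M] (B : PrincipalSOBundle n d M P)
    (Q : Set P) : Prop :=
  ∃ (A : B.Connection) (u₀ : P), B.Generates (A.holonomyBundle u₀) Q

end Bundles

end

noncomputable section

open Matrix

/-! ### Commutants of subgroups of the orthogonal group -/

section Commutant

variable {n : ℕ}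

/-! Write $G=C_{\mathrm O(n)}(\tilde H)$ (`orthCentralizer`) and let $\mathcal A$ be the algebra of
matrices commuting with $G$ (`commutant`). It is closed under transposition. Its orthogonal elements
form the Howe subgroup of $\mathrm O(n)$ generated by $\tilde H$, those of determinant one form
$\tilde H$ itself (`IsHowe.mem_iff`), and its skew elements form the Lie algebra of both. `lieHull`
is the double centralizer in $\mathrm{SO}(n)$ of this Lie algebra. The proof shows that each side of
the theorem is equivalent to $\tilde H\le$ `lieHull` $\tilde H$.

The algebraic half is `le_lieHull_iff`: $\tilde H\le$ `lieHull` $\tilde H$ exactly when the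
forbidden factors are absent. If they are absent, $\mathcal A$ is generated by its skew elements as
far as commutation is concerned (`commute_of_no_factors`). For this, decompose $1$ into minimal
projections of $\mathcal A$. A corner $p\mathcal Ap$ that is larger than $\mathbb R p$ is reached by
its skew elements, and so are three or more equivalent projections. Two equivalent projections of
real type with no third would give an $\mathrm O(2)_k$, and an isolated one gives an $\mathrm
O(1)_k$. At most one isolated projection can occur, and it is $1$ minus the sum of the others.
Conversely, by the Cayley transform, the Lie algebra has the same centralizer as the orthogonal
elements of $\mathcal A$ without eigenvalue $-1$. On an $\mathrm O(2)_k$ these are rotations, and on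
factors $\mathrm O(1)_k$ they are trivial, so one can write down a rotation that commutes with all
of them but not with $\mathcal A$ (`not_hasOFactor_two`, `not_hasDoubleOFactor_one`).

Necessity of $\tilde H\le$ `lieHull` $\tilde H$ (`IsHolonomyInduced.le_lieHull`): `lieHull` $\tilde
H$ contains all elements of $\tilde H$ near $1$, so the cosets form a discrete set and
$Q/\mathrm{lieHull}$ is a covering of $M$. As $M$ is simply connected, the covering has a section
through the class of $u_0$. The points of $Q$ over this section form a reduction to a Howe subgroup,
and this reduction contains the holonomy bundle. Minimality of $Q$ then forces $\tilde H\le$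
`lieHull` $\tilde H$.

Sufficiency: `exists_connection_holonomy` glues a connection that is compatible with $Q$ and has the
local form $(\sum_k\eta^{k+1}X_k)\,d\xi$ near a point, where the $X_k$ are a basis of the Lie
algebra and $\xi,\eta$ are two coordinates; this is where $d\ge2$ enters. Transport around
coordinate rectangles yields $\exp(\tau\sum_k\eta^{k+1}X_k)$ in the holonomy, and whatever commutes
with all of these commutes with every $X_k$. A Howe subbundle containing the holonomy bundle thus
has a structure group containing `lieHull` $\tilde H\ge\tilde H$. Since the holonomy bundle meets
every fibre, the subbundle contains $Q$ (`Connection.generates_holonomyBundle`). -/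

theorem OGrp.mul_transpose (g : OGrp n) : g.1 * g.1ᵀ = 1 :=
  (Matrix.mem_orthogonalGroup_iff _ _).mp g.2

theorem OGrp.transpose_mul (g : OGrp n) : g.1ᵀ * g.1 = 1 :=
  (Matrix.mem_orthogonalGroup_iff' _ _).mp g.2

theorem OGrp.coe_inv (g : OGrp n) : (g⁻¹).1 = g.1ᵀ := rfl

theorem OGrp.coe_mul (g h : OGrp n) : (g * h).1 = g.1 * h.1 := rfl

/-- The algebra of all matrices which commute with the elements of `G`. -/
def commutant (G : Subgroup (OGrp n)) : Subalgebra ℝ (Matrix (Fin n) (Fin n) ℝ) :=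
  Subalgebra.centralizer ℝ ((fun g : OGrp n => g.1) '' (G : Set (OGrp n)))

theorem mem_commutant {G : Subgroup (OGrp n)} {x : Matrix (Fin n) (Fin n) ℝ} :
    x ∈ commutant G ↔ ∀ g ∈ G, g.1 * x = x * g.1 := by
  simp [commutant, Subalgebra.mem_centralizer_iff]

theorem transpose_mem_commutant {G : Subgroup (OGrp n)} {x : Matrix (Fin n) (Fin n) ℝ}
    (hx : x ∈ commutant G) : xᵀ ∈ commutant G := by
  rw [mem_commutant] at hx ⊢
  intro g hg
  have h := congrArg Matrix.transpose (hx g⁻¹ (G.inv_mem hg))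
  rw [OGrp.coe_inv, Matrix.transpose_mul, Matrix.transpose_mul, Matrix.transpose_transpose] at h
  exact h.symm

theorem coe_mem_commutant_iff {G : Subgroup (OGrp n)} {h : OGrp n} :
    h.1 ∈ commutant G ↔ h ∈ Subgroup.centralizer (G : Set (OGrp n)) := by
  rw [mem_commutant, Subgroup.mem_centralizer_iff]
  refine forall₂_congr fun g _ => ?_
  rw [Subtype.ext_iff]
  rfl

/-- The skew-symmetric matrices which commute with `G`: the Lie algebra of the centralizer
of `G`. -/
def skewCommutant (G : Subgroup (OGrp n)) : Submodule ℝ (Matrix (Fin n) (Fin n) ℝ) where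
  carrier := {X | X ∈ commutant G ∧ Xᵀ = -X}
  add_mem' := fun ha hb => ⟨add_mem ha.1 hb.1, by
    rw [Matrix.transpose_add, ha.2, hb.2, neg_add]⟩
  zero_mem' := ⟨zero_mem _, by simp⟩
  smul_mem' := fun c x hx => ⟨Subalgebra.smul_mem _ hx.1 c, by
    rw [Matrix.transpose_smul, hx.2, smul_neg]⟩

theorem sub_transpose_mem_skewCommutant {G : Subgroup (OGrp n)} {x : Matrix (Fin n) (Fin n) ℝ}
    (hx : x ∈ commutant G) : x - xᵀ ∈ skewCommutant G :=
  ⟨sub_mem hx (transpose_mem_commutant hx), by simp⟩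

theorem inv_mem_commutant {G : Subgroup (OGrp n)} {x : Matrix (Fin n) (Fin n) ℝ}
    (hx : x ∈ commutant G) (hdet : x.det ≠ 0) : x⁻¹ ∈ commutant G := by
  have hu : IsUnit x.det := isUnit_iff_ne_zero.mpr hdet
  rw [mem_commutant] at hx ⊢
  intro g hg
  calc g.1 * x⁻¹ = x⁻¹ * x * (g.1 * x⁻¹) := by rw [Matrix.nonsing_inv_mul _ hu, one_mul]
    _ = x⁻¹ * (x * g.1) * x⁻¹ := by simp only [mul_assoc]
    _ = x⁻¹ * g.1 * (x * x⁻¹) := by rw [← hx g hg]; simp only [mul_assoc]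
    _ = x⁻¹ * g.1 := by rw [Matrix.mul_nonsing_inv _ hu, mul_one]

/-! ### The Cayley transform -/

/-- The quadratic form $v^{\mathsf T}Xv$ of a skew matrix vanishes, so $(1+X)v=0$ gives $v^{\mathsf
T}v=0$. -/
theorem det_one_add_ne_zero_of_skew {X : Matrix (Fin n) (Fin n) ℝ} (hX : Xᵀ = -X) :
    (1 + X).det ≠ 0 := by
  intro h0
  obtain ⟨v, hv, hXv⟩ := Matrix.exists_mulVec_eq_zero_iff.mpr h0
  apply hv
  have h1 : v ⬝ᵥ ((1 + X) *ᵥ v) = v ⬝ᵥ v := by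
    have h2 : v ⬝ᵥ (X *ᵥ v) = 0 := by
      have : v ⬝ᵥ (X *ᵥ v) = -(v ⬝ᵥ (X *ᵥ v)) := by
        conv_lhs => rw [Matrix.dotProduct_mulVec, ← Matrix.mulVec_transpose, hX, dotProduct_comm]
        simp [Matrix.neg_mulVec]
      linarith
    rw [Matrix.add_mulVec, Matrix.one_mulVec, dotProduct_add, h2, add_zero]
  rw [hXv, dotProduct_zero] at h1
  exact dotProduct_self_eq_zero.mp h1.symm

/-- An orthogonal matrix `g` for which `1 + g` is invertible is determined by a skew matrix which
commutes with the same orthogonal matrices as `g`. -/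
theorem exists_skew_of_det_ne_zero {G : Subgroup (OGrp n)} {g : OGrp n} (hg : g.1 ∈ commutant G)
    (hdet : (1 + g.1).det ≠ 0) :
    ∃ Y ∈ skewCommutant G, ∀ z : Matrix (Fin n) (Fin n) ℝ, Commute z Y → Commute z g.1 := by
  have hu : IsUnit (1 + g.1).det := isUnit_iff_ne_zero.mpr hdet
  have hu' : IsUnit (1 + g.1ᵀ).det := by
    have : (1 + g.1ᵀ) = (1 + g.1)ᵀ := by simp
    rwa [this, Matrix.det_transpose]
  have hT : ((1 + g.1)⁻¹)ᵀ = 1 - (1 + g.1)⁻¹ := by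
    rw [Matrix.transpose_nonsing_inv]
    have e : (1 + g.1)ᵀ * (1 - (1 + g.1)⁻¹) = 1 := by
      have h1 : (1 + g.1)ᵀ = g.1ᵀ * (1 + g.1) := by
        rw [mul_add, OGrp.transpose_mul]; simp [add_comm]
      rw [mul_sub, mul_one, h1, mul_assoc, Matrix.mul_nonsing_inv _ hu, mul_add,
        OGrp.transpose_mul]
      simp
    exact Matrix.inv_eq_right_inv e
  -- This is half of the Cayley transform $(1-g)(1+g)^{-1}$. In this form it is skew by `hT`, and it
  -- visibly has the same centralizer as $(1+g)^{-1}$.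
  refine ⟨(1 + g.1)⁻¹ - (1 / 2 : ℝ) • 1, ⟨sub_mem (inv_mem_commutant (add_mem (one_mem _) hg) hdet)
    (Subalgebra.smul_mem _ (one_mem _) _), ?_⟩, ?_⟩
  · rw [Matrix.transpose_sub, hT, Matrix.transpose_smul, Matrix.transpose_one]
    have : (1 : Matrix (Fin n) (Fin n) ℝ) = (1 / 2 : ℝ) • 1 + (1 / 2 : ℝ) • 1 := by
      rw [← add_smul]; norm_num
    nth_rewrite 1 [this]
    abel
  · intro z hz
    have h1 : Commute z (1 + g.1)⁻¹ := by
      have h2 : Commute z ((1 / 2 : ℝ) • (1 : Matrix (Fin n) (Fin n) ℝ)) :=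
        (Commute.one_right z).smul_right _
      simpa using hz.add_right h2
    have h3 : Commute z (1 + g.1) := by
      show z * (1 + g.1) = (1 + g.1) * z
      calc z * (1 + g.1) = ((1 + g.1) * (1 + g.1)⁻¹) * z * (1 + g.1) := by
            rw [Matrix.mul_nonsing_inv _ hu, one_mul]
        _ = (1 + g.1) * (z * (1 + g.1)⁻¹) * (1 + g.1) := by rw [h1.eq]; simp only [mul_assoc]
        _ = (1 + g.1) * z * ((1 + g.1)⁻¹ * (1 + g.1)) := by simp only [mul_assoc]
        _ = (1 + g.1) * z := by rw [Matrix.nonsing_inv_mul _ hu, mul_one]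
    have := h3.sub_right (Commute.one_right z)
    simpa using this

/-- The Cayley transform of a skew matrix is orthogonal, and the two determine each other. -/
theorem exists_orthogonal_of_skew {G : Subgroup (OGrp n)} {X : Matrix (Fin n) (Fin n) ℝ}
    (hX : X ∈ skewCommutant G) :
    ∃ g : OGrp n, g.1 ∈ commutant G ∧ (1 + g.1).det ≠ 0 ∧
      ∀ z : Matrix (Fin n) (Fin n) ℝ, Commute z g.1 → Commute z X := by
  have hd : (1 + X).det ≠ 0 := det_one_add_ne_zero_of_skew hX.2
  have hu : IsUnit (1 + X).det := isUnit_iff_ne_zero.mpr hd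
  have hu' : IsUnit (1 - X).det := by
    have : (1 - X) = (1 + X)ᵀ := by simp [hX.2, sub_eq_add_neg]
    rwa [this, Matrix.det_transpose]
  have hc : (1 - X) * (1 + X) = (1 + X) * (1 - X) := by noncomm_ring
  set g : Matrix (Fin n) (Fin n) ℝ := (1 - X) * (1 + X)⁻¹ with hg
  have hgt : gᵀ = (1 - X)⁻¹ * (1 + X) := by
    rw [hg, Matrix.transpose_mul, Matrix.transpose_nonsing_inv]
    simp [hX.2, sub_eq_add_neg]
  have hort : g * gᵀ = 1 := by
    have hc' : (1 + X)⁻¹ * (1 - X)⁻¹ = (1 - X)⁻¹ * (1 + X)⁻¹ := by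
      rw [← Matrix.mul_inv_rev, hc, Matrix.mul_inv_rev]
    rw [hgt, hg]
    calc (1 - X) * (1 + X)⁻¹ * ((1 - X)⁻¹ * (1 + X))
        = (1 - X) * ((1 + X)⁻¹ * (1 - X)⁻¹) * (1 + X) := by simp only [mul_assoc]
      _ = ((1 - X) * (1 - X)⁻¹) * ((1 + X)⁻¹ * (1 + X)) := by rw [hc']; simp only [mul_assoc]
      _ = 1 := by rw [Matrix.mul_nonsing_inv _ hu', Matrix.nonsing_inv_mul _ hu, one_mul]
  -- This identity gives the invertibility of $1+g$ and also recovers $X$ from $g$.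
  have h1g : (1 + g) * (1 + X) = (2 : ℝ) • 1 := by
    rw [add_mul, hg, mul_assoc, Matrix.nonsing_inv_mul _ hu, mul_one, one_mul, two_smul]
    abel
  have hdg : (1 + g).det ≠ 0 := by
    intro h0
    have := congrArg Matrix.det h1g
    rw [Matrix.det_mul, h0, zero_mul, Matrix.det_smul, Matrix.det_one, mul_one] at this
    exact pow_ne_zero _ two_ne_zero this.symm
  refine ⟨⟨g, (Matrix.mem_orthogonalGroup_iff _ _).mpr hort⟩,
    mul_mem (sub_mem (one_mem _) hX.1) (inv_mem_commutant (add_mem (one_mem _) hX.1) hd),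
    hdg, fun z hz => ?_⟩
  have hug : IsUnit (1 + g).det := isUnit_iff_ne_zero.mpr hdg
  have hz1 : Commute z (1 + g) := (Commute.one_right z).add_right hz
  have key : (1 + g) * (z * (1 + X)) = (1 + g) * ((1 + X) * z) := by
    rw [← mul_assoc, ← hz1.eq, mul_assoc, h1g, ← mul_assoc, h1g]
    simp
  have h2 : z * (1 + X) = (1 + X) * z := by
    have := congrArg (fun y => (1 + g)⁻¹ * y) key
    simpa [← mul_assoc, Matrix.nonsing_inv_mul _ hug] using this
  have : Commute z (1 + X - 1) := Commute.sub_right h2 (Commute.one_right z)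
  simpa using this

/-! ### Orthogonal projections in the commutant -/

/-- `p` is an orthogonal projection which commutes with `G`. -/
structure IsProjIn (G : Subgroup (OGrp n)) (p : Matrix (Fin n) (Fin n) ℝ) : Prop where
  mem : p ∈ commutant G
  mul_self : p * p = p
  symm : pᵀ = p

/-- The orthogonal projection onto a subspace, as a matrix. -/
def projMatrix (W : Submodule ℝ (EuclideanSpace ℝ (Fin n))) : Matrix (Fin n) (Fin n) ℝ :=
  (Matrix.toEuclideanCLM (n := Fin n) (𝕜 := ℝ)).symm W.starProjection

theorem toEuclideanLin_projMatrix (W : Submodule ℝ (EuclideanSpace ℝ (Fin n)))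
    (v : EuclideanSpace ℝ (Fin n)) :
    Matrix.toEuclideanLin (projMatrix W) v = W.starProjection v := by
  rw [← Matrix.coe_toEuclideanCLM_eq_toEuclideanLin]
  simp [projMatrix]

theorem toEuclideanLin_mul (x y : Matrix (Fin n) (Fin n) ℝ) (v : EuclideanSpace ℝ (Fin n)) :
    Matrix.toEuclideanLin (x * y) v = Matrix.toEuclideanLin x (Matrix.toEuclideanLin y v) := by
  simp [← Matrix.coe_toEuclideanCLM_eq_toEuclideanLin]

theorem toEuclideanLin_one (v : EuclideanSpace ℝ (Fin n)) :
    Matrix.toEuclideanLin (1 : Matrix (Fin n) (Fin n) ℝ) v = v := by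
  simp

theorem toEuclideanLin_ext {x y : Matrix (Fin n) (Fin n) ℝ}
    (h : ∀ v, Matrix.toEuclideanLin x v = Matrix.toEuclideanLin y v) : x = y :=
  Matrix.toEuclideanLin.injective (LinearMap.ext h)

theorem inner_toEuclideanLin (x : Matrix (Fin n) (Fin n) ℝ) (v w : EuclideanSpace ℝ (Fin n)) :
    inner ℝ (Matrix.toEuclideanLin x v) w = inner ℝ v (Matrix.toEuclideanLin xᵀ w) := by
  have := LinearMap.adjoint_inner_right (Matrix.toEuclideanLin x) v w
  rw [← Matrix.toEuclideanLin_conjTranspose_eq_adjoint] at this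
  simpa using this.symm

theorem projMatrix_mul_self (W : Submodule ℝ (EuclideanSpace ℝ (Fin n))) :
    projMatrix W * projMatrix W = projMatrix W := by
  refine toEuclideanLin_ext fun v => ?_
  simp only [toEuclideanLin_mul, toEuclideanLin_projMatrix]
  exact Submodule.starProjection_eq_self_iff.mpr (Submodule.starProjection_apply_mem _ _)

theorem projMatrix_transpose (W : Submodule ℝ (EuclideanSpace ℝ (Fin n))) :
    (projMatrix W)ᵀ = projMatrix W := by
  refine toEuclideanLin_ext fun v => ext_inner_left ℝ fun w => ?_
  rw [← inner_toEuclideanLin, toEuclideanLin_projMatrix, toEuclideanLin_projMatrix]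
  exact Submodule.inner_starProjection_left_eq_right W w v

/-- Inverses in $G$ are transposes, so the orthogonal complement of an invariant subspace is
invariant too. Hence $gPv$ is the projection of $gv$. -/
theorem projMatrix_isProjIn {G : Subgroup (OGrp n)} {W : Submodule ℝ (EuclideanSpace ℝ (Fin n))}
    (hW : IsInvariantUnder G W) : IsProjIn G (projMatrix W) := by
  refine ⟨mem_commutant.mpr fun g hg => toEuclideanLin_ext fun v => ?_, projMatrix_mul_self W,
    projMatrix_transpose W⟩
  rw [toEuclideanLin_mul, toEuclideanLin_mul, toEuclideanLin_projMatrix, toEuclideanLin_projMatrix]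
  symm
  refine (Submodule.eq_starProjection_of_mem_orthogonal
    (hW g hg _ (Submodule.starProjection_apply_mem _ _)) ?_)
  rw [← map_sub, Submodule.mem_orthogonal]
  intro w hw
  rw [real_inner_comm, inner_toEuclideanLin]
  exact Submodule.inner_left_of_mem_orthogonal (hW g⁻¹ (G.inv_mem hg) w hw)
    (Submodule.sub_starProjection_mem_orthogonal v)

theorem projMatrix_apply_eq_self_iff {W : Submodule ℝ (EuclideanSpace ℝ (Fin n))}
    {v : EuclideanSpace ℝ (Fin n)} : Matrix.toEuclideanLin (projMatrix W) v = v ↔ v ∈ W := by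
  rw [toEuclideanLin_projMatrix]
  exact Submodule.starProjection_eq_self_iff

/-- The image of a projection matrix, as the space of its fixed vectors. -/
def fixedSpace (p : Matrix (Fin n) (Fin n) ℝ) : Submodule ℝ (EuclideanSpace ℝ (Fin n)) :=
  LinearMap.ker (Matrix.toEuclideanLin p - LinearMap.id)

theorem mem_fixedSpace {p : Matrix (Fin n) (Fin n) ℝ} {v : EuclideanSpace ℝ (Fin n)} :
    v ∈ fixedSpace p ↔ Matrix.toEuclideanLin p v = v := by
  simp [fixedSpace, sub_eq_zero]

theorem fixedSpace_ne_bot {p : Matrix (Fin n) (Fin n) ℝ} (hp : p * p = p) (h0 : p ≠ 0) :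
    fixedSpace p ≠ ⊥ := by
  intro h
  apply h0
  refine toEuclideanLin_ext fun v => ?_
  have : Matrix.toEuclideanLin p v ∈ fixedSpace p := by
    rw [mem_fixedSpace, ← toEuclideanLin_mul, hp]
  rw [h, Submodule.mem_bot] at this
  simp [this]

theorem fixedSpace_projMatrix (W : Submodule ℝ (EuclideanSpace ℝ (Fin n))) :
    fixedSpace (projMatrix W) = W := by
  ext v
  rw [mem_fixedSpace, projMatrix_apply_eq_self_iff]

theorem projMatrix_fixedSpace {p : Matrix (Fin n) (Fin n) ℝ} (hp : p * p = p) (ht : pᵀ = p) :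
    projMatrix (fixedSpace p) = p := by
  refine toEuclideanLin_ext fun v => ?_
  rw [toEuclideanLin_projMatrix]
  refine (Submodule.eq_starProjection_of_mem_orthogonal (K := fixedSpace p) ?_ ?_)
  · rw [mem_fixedSpace, ← toEuclideanLin_mul, hp]
  · rw [Submodule.mem_orthogonal]
    intro w hw
    rw [mem_fixedSpace] at hw
    rw [← hw, inner_toEuclideanLin, ht, map_sub, ← toEuclideanLin_mul, hp, sub_self, inner_zero_right]

theorem mul_eq_of_fixedSpace_le {p q : Matrix (Fin n) (Fin n) ℝ} (hq : q * q = q)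
    (h : fixedSpace q ≤ fixedSpace p) : p * q = q := by
  refine toEuclideanLin_ext fun v => ?_
  rw [toEuclideanLin_mul]
  exact mem_fixedSpace.mp (h (mem_fixedSpace.mpr (by rw [← toEuclideanLin_mul, hq])))

end Commutant

/-! ### Minimal projections in the commutant -/

section MinimalProjections

variable {n : ℕ} {G : Subgroup (OGrp n)}

/-- A minimal nonzero projection in the commutant of `G`. -/
structure IsMinProjIn (G : Subgroup (OGrp n)) (p : Matrix (Fin n) (Fin n) ℝ) : Prop
    extends IsProjIn G p where
  ne_zero : p ≠ 0
  eq_or_eq : ∀ q, IsProjIn G q → p * q = q → q = 0 ∨ q = p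

theorem IsProjIn.mul_eq_comm {p q : Matrix (Fin n) (Fin n) ℝ} (hp : IsProjIn G p)
    (hq : IsProjIn G q) (h : p * q = q) : q * p = q := by
  have := congrArg Matrix.transpose h
  rwa [Matrix.transpose_mul, hp.symm, hq.symm] at this

theorem IsProjIn.sub {p q : Matrix (Fin n) (Fin n) ℝ} (hp : IsProjIn G p)
    (hq : IsProjIn G q) (h : p * q = q) : IsProjIn G (p - q) := by
  refine ⟨sub_mem hp.mem hq.mem, ?_, by rw [Matrix.transpose_sub, hp.symm, hq.symm]⟩
  rw [sub_mul, mul_sub, mul_sub, hp.mul_self, hq.mul_self, h, hp.mul_eq_comm hq h]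
  abel

theorem isProjIn_one : IsProjIn G 1 := ⟨one_mem _, one_mul _, Matrix.transpose_one⟩

theorem eq_zero_of_mul_transpose_self {x : Matrix (Fin n) (Fin n) ℝ} (h : x * xᵀ = 0) : x = 0 := by
  rwa [← Matrix.conjTranspose_eq_transpose_of_trivial, Matrix.self_mul_conjTranspose_eq_zero] at h

theorem eq_zero_of_transpose_self_mul {x : Matrix (Fin n) (Fin n) ℝ} (h : xᵀ * x = 0) : x = 0 := by
  rwa [← Matrix.conjTranspose_eq_transpose_of_trivial, Matrix.conjTranspose_mul_self_eq_zero] at h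

theorem trace_eq_finrank_of_isProj {p : Matrix (Fin n) (Fin n) ℝ} (hp : p * p = p) :
    p.trace = p.rank := by
  have h := (LinearMap.isProj_range_iff_isIdempotentElem (Matrix.toLin' p)).mpr
    (by rw [IsIdempotentElem, Module.End.mul_eq_comp, ← Matrix.toLin'_mul, hp])
  have := h.trace
  rw [Matrix.trace_toLin'_eq] at this
  rw [this, Matrix.rank, Matrix.toLin'_apply']

theorem trace_pos_of_isProjIn {p : Matrix (Fin n) (Fin n) ℝ} (hp : IsProjIn G p) (h0 : p ≠ 0) :
    0 < p.trace := by
  have h1 : 0 ≤ p.trace := by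
    rw [trace_eq_finrank_of_isProj hp.mul_self]; positivity
  refine lt_of_le_of_ne h1 fun h => h0 ?_
  have : (pᴴ * p).trace = 0 := by
    rw [Matrix.conjTranspose_eq_transpose_of_trivial, hp.symm, hp.mul_self, ← h]
  exact Matrix.trace_conjTranspose_mul_self_eq_zero_iff.mp this

/-- Rank equals trace for projections and the trace is additive. This provides the induction measure
for finding and splitting off minimal projections. -/
theorem rank_lt_of_isProjIn_sub {p q : Matrix (Fin n) (Fin n) ℝ} (hp : IsProjIn G p)
    (hq : IsProjIn G q) (h : p * q = q) (h0 : q ≠ 0) : (p - q).rank < p.rank := by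
  have h1 := trace_pos_of_isProjIn hq h0
  have h2 := trace_eq_finrank_of_isProj (hp.sub hq h).mul_self
  have h3 := trace_eq_finrank_of_isProj hp.mul_self
  rw [Matrix.trace_sub] at h2
  have : ((p - q).rank : ℝ) < p.rank := by linarith
  exact_mod_cast this

/-- Every nonzero projection in the commutant dominates a minimal one. -/
theorem IsProjIn.exists_min {p : Matrix (Fin n) (Fin n) ℝ} (hp : IsProjIn G p) (h0 : p ≠ 0) :
    ∃ q, IsMinProjIn G q ∧ p * q = q := by
  induction h : p.rank using Nat.strong_induction_on generalizing p with
  | _ N ih =>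
    by_cases hm : ∀ q, IsProjIn G q → p * q = q → q = 0 ∨ q = p
    · exact ⟨p, ⟨hp, h0, hm⟩, hp.mul_self⟩
    · push Not at hm
      obtain ⟨q, hq, hpq, hq0, hqp⟩ := hm
      have hr : q.rank < N := by
        have := rank_lt_of_isProjIn_sub hp (hp.sub hq hpq)
          (by rw [mul_sub, hp.mul_self, hpq]) (sub_ne_zero.mpr (Ne.symm hqp))
        rwa [sub_sub_cancel, h] at this
      obtain ⟨r, hr1, hr2⟩ := ih _ hr hq hq0 rfl
      exact ⟨r, hr1, by rw [← hr2, ← mul_assoc, hpq]⟩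

/-- Every projection in the commutant is the sum of finitely many minimal projections which are
orthogonal to each other. -/
theorem IsProjIn.exists_decomposition {p : Matrix (Fin n) (Fin n) ℝ} (hp : IsProjIn G p) :
    ∃ s : Finset (Matrix (Fin n) (Fin n) ℝ), (∀ q ∈ s, IsMinProjIn G q ∧ p * q = q) ∧
      (∀ q ∈ s, ∀ r ∈ s, q ≠ r → q * r = 0) ∧ ∑ q ∈ s, q = p := by
  classical
  induction h : p.rank using Nat.strong_induction_on generalizing p with
  | _ N ih =>
    by_cases h0 : p = 0
    · exact ⟨∅, by simp, by simp, by simp [h0]⟩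
    · obtain ⟨q, hq, hpq⟩ := hp.exists_min h0
      obtain ⟨s, hs1, hs2, hs3⟩ := ih _ (h ▸ rank_lt_of_isProjIn_sub hp hq.1 hpq hq.ne_zero)
        (hp.sub hq.1 hpq) rfl
      have hqr : ∀ r ∈ s, q * r = 0 := by
        intro r hr
        rw [← (hs1 r hr).2, ← mul_assoc, mul_sub, hp.mul_eq_comm hq.1 hpq, hq.mul_self, sub_self,
          zero_mul]
      have hrq : ∀ r ∈ s, r * q = 0 := by
        intro r hr
        have := congrArg Matrix.transpose (hqr r hr)
        rwa [Matrix.transpose_mul, (hs1 r hr).1.symm, hq.symm, Matrix.transpose_zero] at this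
      have hns : q ∉ s := fun hqs => hq.ne_zero (by rw [← hq.mul_self]; exact hqr q hqs)
      refine ⟨insert q s, ?_, ?_, ?_⟩
      · intro r hr
        rcases Finset.mem_insert.mp hr with rfl | hr
        · exact ⟨hq, hpq⟩
        · refine ⟨(hs1 r hr).1, ?_⟩
          have := (hs1 r hr).2
          rwa [sub_mul, hqr r hr, sub_zero] at this
      · intro a ha b hb hab
        rcases Finset.mem_insert.mp ha with ha | ha <;> rcases Finset.mem_insert.mp hb with hb | hb
        · exact absurd (ha.trans hb.symm) hab
        · exact ha ▸ hqr b hb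
        · exact hb ▸ hrq a ha
        · exact hs2 a ha b hb hab
      · rw [Finset.sum_insert hns, hs3]; abel

/-- A symmetric element of the corner algebra of a minimal projection is a scalar. -/
theorem IsMinProjIn.exists_eq_smul_of_symm {p x : Matrix (Fin n) (Fin n) ℝ}
    (hp : IsMinProjIn G p) (hx : x ∈ commutant G) (hsymm : xᵀ = x) (hpx : p * x = x) :
    ∃ c : ℝ, x = c • p := by
  have hxp : x * p = x := by
    have := congrArg Matrix.transpose hpx
    rwa [Matrix.transpose_mul, hp.symm, hsymm] at this
  have hmaps : ∀ v ∈ fixedSpace p, Matrix.toEuclideanLin x v ∈ fixedSpace p := by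
    intro v _
    rw [mem_fixedSpace, ← toEuclideanLin_mul, hpx]
  have hS : (Matrix.toEuclideanLin x).IsSymmetric := fun v w => by
    rw [inner_toEuclideanLin, hsymm]
  have hS' := hS.restrict_invariant hmaps
  have : Nontrivial (fixedSpace p) :=
    Submodule.nontrivial_iff_ne_bot.mpr (fixedSpace_ne_bot hp.mul_self hp.ne_zero)
  -- A symmetric operator on the nonzero image of $p$ has an eigenvalue, the supremum of its
  -- Rayleigh quotients.
  obtain ⟨v, hv⟩ := hS'.hasEigenvalue_iSup_of_finiteDimensional.exists_hasEigenvector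
  set c : ℝ := ⨆ y : { y : fixedSpace p // y ≠ 0 },
    RCLike.re (inner ℝ ((Matrix.toEuclideanLin x).restrict hmaps y) (y : fixedSpace p)) /
      ‖(y : fixedSpace p)‖ ^ 2 with hc
  have hv1 : Matrix.toEuclideanLin x (v : EuclideanSpace ℝ (Fin n)) = c • (v : EuclideanSpace ℝ (Fin n)) := by
    have := congrArg Subtype.val hv.apply_eq_smul
    simpa using this
  refine ⟨c, ?_⟩
  -- The eigenspace is nonzero and $G$-invariant, so by minimality its projection is all of $p$.
  set W : Submodule ℝ (EuclideanSpace ℝ (Fin n)) :=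
    fixedSpace p ⊓ LinearMap.ker (Matrix.toEuclideanLin (x - c • p)) with hW
  have hcom : x - c • p ∈ commutant G := sub_mem hx (Subalgebra.smul_mem _ hp.mem _)
  have hinv : IsInvariantUnder G W := by
    intro g hg w hw
    refine ⟨?_, ?_⟩
    · rw [SetLike.mem_coe, mem_fixedSpace, ← toEuclideanLin_mul, ← mem_commutant.mp hp.mem g hg, toEuclideanLin_mul,
        mem_fixedSpace.mp hw.1]
    · rw [SetLike.mem_coe, LinearMap.mem_ker, ← toEuclideanLin_mul, ← mem_commutant.mp hcom g hg,
        toEuclideanLin_mul, LinearMap.mem_ker.mp hw.2, map_zero]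
  have hq := projMatrix_isProjIn hinv
  have hle : p * projMatrix W = projMatrix W :=
    mul_eq_of_fixedSpace_le hq.mul_self (by rw [fixedSpace_projMatrix]; exact inf_le_left)
  have hvW : (v : EuclideanSpace ℝ (Fin n)) ∈ W := by
    refine ⟨v.2, ?_⟩
    rw [SetLike.mem_coe, LinearMap.mem_ker, map_sub, map_smul, LinearMap.sub_apply, LinearMap.smul_apply,
      mem_fixedSpace.mp v.2, hv1, sub_self]
  rcases hp.eq_or_eq _ hq hle with h | h
  · exfalso
    have h1 := projMatrix_apply_eq_self_iff.mpr hvW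
    rw [h] at h1
    apply hv.2
    apply Subtype.ext
    rw [← h1]; simp
  · have hpW : (x - c • p) * p = 0 := by
      refine toEuclideanLin_ext fun w => ?_
      have : Matrix.toEuclideanLin p w ∈ W := by
        rw [← projMatrix_apply_eq_self_iff, ← toEuclideanLin_mul, h, hp.mul_self]
      rw [toEuclideanLin_mul, LinearMap.mem_ker.mp this.2]; simp
    rw [sub_mul, hxp, smul_mul_assoc, hp.mul_self] at hpW
    exact sub_eq_zero.mp hpW

/-- A nonzero intertwiner between minimal projections can be scaled to a partial isometry. -/
theorem IsMinProjIn.exists_partialIsometry {p q x : Matrix (Fin n) (Fin n) ℝ}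
    (hp : IsMinProjIn G p) (hq : IsMinProjIn G q) (hx : x ∈ commutant G) (hpx : p * x = x)
    (hxq : x * q = x) (h0 : x ≠ 0) :
    ∃ u ∈ commutant G, p * u = u ∧ u * q = u ∧ u * uᵀ = p ∧ uᵀ * u = q := by
  have hxT := transpose_mem_commutant hx
  obtain ⟨c, hc⟩ := hp.exists_eq_smul_of_symm (mul_mem hx hxT) (by simp) (by rw [← mul_assoc, hpx])
  have hqx : q * xᵀ = xᵀ := by
    have := congrArg Matrix.transpose hxq
    rwa [Matrix.transpose_mul, hq.symm] at this
  obtain ⟨d, hd⟩ := hq.exists_eq_smul_of_symm (mul_mem hxT hx) (by simp) (by rw [← mul_assoc, hqx])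
  have hc0 : 0 < c := by
    have h1 : 0 ≤ (x * xᵀ).trace := by
      have := (Matrix.posSemidef_self_mul_conjTranspose x).trace_nonneg
      rwa [Matrix.conjTranspose_eq_transpose_of_trivial] at this
    have h2 := trace_pos_of_isProjIn hp.1 hp.ne_zero
    rw [hc, Matrix.trace_smul, smul_eq_mul] at h1
    refine lt_of_le_of_ne (nonneg_of_mul_nonneg_left h1 h2) fun h => h0 ?_
    exact eq_zero_of_mul_transpose_self (by rw [hc, ← h, zero_smul])
  -- Compute $xx^{\mathsf T}x$ in two ways.
  have hcd : c = d := by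
    have : c • x = d • x := by
      calc c • x = (c • p) * x := by rw [smul_mul_assoc, hpx]
        _ = x * (xᵀ * x) := by rw [← hc, mul_assoc]
        _ = d • x := by rw [hd, mul_smul_comm, hxq]
    exact smul_left_injective ℝ h0 this
  have hs : (√c)⁻¹ * (√c)⁻¹ * c = 1 := by
    have : √c ≠ 0 := (Real.sqrt_pos.mpr hc0).ne'
    nth_rewrite 3 [← Real.mul_self_sqrt hc0.le]
    field_simp
  refine ⟨(√c)⁻¹ • x, Subalgebra.smul_mem _ hx _, ?_, ?_, ?_, ?_⟩
  · rw [mul_smul_comm, hpx]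
  · rw [smul_mul_assoc, hxq]
  · rw [Matrix.transpose_smul, smul_mul_assoc, mul_smul_comm, smul_smul, hc, smul_smul, hs, one_smul]
  · rw [Matrix.transpose_smul, smul_mul_assoc, mul_smul_comm, smul_smul, hd, ← hcd, smul_smul, hs,
      one_smul]

end MinimalProjections

/-! ### Isotypic components of real type are the factors $\mathrm O(m)_k$ -/

section OFactors

variable {n : ℕ} {G : Subgroup (OGrp n)}

/-- A system of `m` pairwise orthogonal equivalent minimal projections `u i * (u i)ᵀ` in the
commutant of `G` of real type, whose sum is central in the commutant. -/
structure RealIsotypic (G : Subgroup (OGrp n)) (m : ℕ) (p : Matrix (Fin n) (Fin n) ℝ)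
    (u : Fin m → Matrix (Fin n) (Fin n) ℝ) : Prop where
  min : IsMinProjIn G p
  mem : ∀ i, u i ∈ commutant G
  transpose_mul : ∀ i j, (u i)ᵀ * u j = if i = j then p else 0
  mul_proj : ∀ i, u i * p = u i
  real : ∀ x ∈ commutant G, p * x = x → x * p = x → ∃ c : ℝ, x = c • p
  central : ∀ x ∈ commutant G, (∑ i, u i * (u i)ᵀ) * x = x * ∑ i, u i * (u i)ᵀ

variable {m : ℕ} {p : Matrix (Fin n) (Fin n) ℝ} {u : Fin m → Matrix (Fin n) (Fin n) ℝ}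

namespace RealIsotypic

theorem proj_mul_transpose (R : RealIsotypic G m p u) (i : Fin m) : p * (u i)ᵀ = (u i)ᵀ := by
  have := congrArg Matrix.transpose (R.mul_proj i)
  rwa [Matrix.transpose_mul, R.min.symm] at this

theorem sum_mul (R : RealIsotypic G m p u) (j : Fin m) : (∑ i, u i * (u i)ᵀ) * u j = u j := by
  simp [Finset.sum_mul, mul_assoc, R.transpose_mul, R.mul_proj]

theorem transpose_mul_sum (R : RealIsotypic G m p u) (j : Fin m) :
    (u j)ᵀ * (∑ i, u i * (u i)ᵀ) = (u j)ᵀ := by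
  have := congrArg Matrix.transpose (R.sum_mul j)
  rw [Matrix.transpose_mul, Matrix.transpose_sum] at this
  simpa using this

theorem sum_isProjIn (R : RealIsotypic G m p u) : IsProjIn G (∑ i, u i * (u i)ᵀ) := by
  refine ⟨sum_mem fun i _ => mul_mem (R.mem i) (transpose_mem_commutant (R.mem i)), ?_, ?_⟩
  · conv_lhs => rw [Finset.mul_sum]
    simp only [← mul_assoc, R.sum_mul]
  · simp [Matrix.transpose_sum]

theorem ne_zero (R : RealIsotypic G m p u) (j : Fin m) : u j ≠ 0 := by
  intro h
  have := R.transpose_mul j j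
  rw [h, mul_zero, if_pos rfl] at this
  exact R.min.ne_zero this.symm

/-- The orthogonal matrix which acts on the isotypic component as `a ⊗ 1`. -/
theorem exists_orthogonal (R : RealIsotypic G m p u) {a : Matrix (Fin m) (Fin m) ℝ}
    (ha : a ∈ Matrix.orthogonalGroup (Fin m) ℝ) :
    ∃ h : OGrp n, h.1 ∈ commutant G ∧ ∀ j, h.1 * u j = ∑ i, a i j • u i := by
  set P := ∑ i, u i * (u i)ᵀ with hP
  have hPP := R.sum_isProjIn
  rw [← hP] at hPP
  set x : Matrix (Fin n) (Fin n) ℝ := ∑ i, ∑ j, a i j • (u i * (u j)ᵀ) with hx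
  have hxT : xᵀ = ∑ i, ∑ j, a j i • (u i * (u j)ᵀ) := by
    rw [hx, Matrix.transpose_sum, Finset.sum_comm]
    simp [Matrix.transpose_sum]
  have hxu : ∀ j, x * u j = ∑ i, a i j • u i := by
    intro j
    simp [hx, Finset.sum_mul, mul_assoc, R.transpose_mul, R.mul_proj]
  have hxTu : ∀ j, xᵀ * u j = ∑ i, a j i • u i := by
    intro j
    rw [hxT]
    simp [Finset.sum_mul, mul_assoc, R.transpose_mul, R.mul_proj]
  have hPx : P * x = x := by
    simp only [hx, Finset.mul_sum, mul_smul_comm, ← mul_assoc, R.sum_mul, hP]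
  have hxP : x * P = x := by
    simp only [hx, Finset.sum_mul, smul_mul_assoc, mul_assoc, R.transpose_mul_sum, hP]
  have hxx : x * xᵀ = P := by
    have haa : ∀ i k, ∑ j, a i j * a k j = if i = k then 1 else 0 := by
      intro i k
      have := congrFun (congrFun ((Matrix.mem_orthogonalGroup_iff _ _).mp ha) i) k
      simpa [Matrix.mul_apply, Matrix.one_apply] using this
    rw [hxT]
    simp only [Finset.mul_sum, mul_smul_comm, ← mul_assoc, hxu]
    rw [Finset.sum_comm]
    simp only [Finset.sum_mul, Finset.smul_sum, smul_mul_assoc, smul_smul]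
    rw [hP]
    calc ∑ j, ∑ i, ∑ k, (a j i * a k i) • (u k * (u j)ᵀ)
        = ∑ j, ∑ k, (∑ i, a j i * a k i) • (u k * (u j)ᵀ) := by
          refine Finset.sum_congr rfl fun j _ => ?_
          rw [Finset.sum_comm]
          simp only [Finset.sum_smul]
      _ = _ := by simp [haa]
  have hmem : x ∈ commutant G := sum_mem fun i _ => sum_mem fun j _ =>
    Subalgebra.smul_mem _ (mul_mem (R.mem i) (transpose_mem_commutant (R.mem j))) _
  -- The matrix acts as $a\otimes1$ on the isotypic component and as the identity on its complement.
  refine ⟨⟨x + (1 - P), (Matrix.mem_orthogonalGroup_iff _ _).mpr ?_⟩,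
    add_mem hmem (sub_mem (one_mem _) hPP.mem), fun j => ?_⟩
  · have h1 : P * xᵀ = xᵀ := by
      have := congrArg Matrix.transpose hxP
      rwa [Matrix.transpose_mul, hPP.symm] at this
    rw [Matrix.transpose_add, Matrix.transpose_sub, Matrix.transpose_one, hPP.symm]
    simp only [add_mul, mul_add, sub_mul, mul_sub, one_mul, mul_one, hxx, hxP, h1, hPP.mul_self]
    abel
  · show (x + (1 - P)) * u j = _
    rw [add_mul, hxu, sub_mul, one_mul, R.sum_mul, sub_self, add_zero]

/-- An orthogonal matrix in the commutant acts on the isotypic component as some `a ⊗ 1`. -/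
theorem exists_matrix (R : RealIsotypic G m p u) {h : OGrp n} (hh : h.1 ∈ commutant G) :
    ∃ a ∈ Matrix.orthogonalGroup (Fin m) ℝ, ∀ j, h.1 * u j = ∑ i, a i j • u i := by
  -- The blocks of $h$ lie in the corner of $p$, which is real, so they are numbers. Centrality of
  -- the sum keeps $h$ from leaving the component, so these blocks are all there is.
  have hc : ∀ i j, ∃ c : ℝ, (u i)ᵀ * h.1 * u j = c • p := fun i j =>
    R.real _ (mul_mem (mul_mem (transpose_mem_commutant (R.mem i)) hh) (R.mem j))
      (by rw [← mul_assoc, ← mul_assoc, R.proj_mul_transpose]) (by rw [mul_assoc, R.mul_proj])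
  choose a ha using hc
  have hau : ∀ j, h.1 * u j = ∑ i, a i j • u i := by
    intro j
    calc h.1 * u j = h.1 * (∑ i, u i * (u i)ᵀ) * u j := by rw [mul_assoc, R.sum_mul]
      _ = (∑ i, u i * (u i)ᵀ) * h.1 * u j := by rw [R.central _ hh]
      _ = ∑ i, u i * ((u i)ᵀ * h.1 * u j) := by simp only [Finset.sum_mul, mul_assoc]
      _ = _ := by simp only [ha, mul_smul_comm, R.mul_proj]
  refine ⟨Matrix.of a, (Matrix.mem_orthogonalGroup_iff' _ _).mpr ?_, by simpa using hau⟩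
  ext i j
  have h1 : (h.1 * u i)ᵀ * (h.1 * u j) = (u i)ᵀ * u j := by
    rw [Matrix.transpose_mul, mul_assoc, ← mul_assoc h.1ᵀ, OGrp.transpose_mul, one_mul]
  have h2 : (h.1 * u i)ᵀ * (h.1 * u j) = (∑ k, a k i * a k j) • p := by
    rw [hau, hau, Matrix.transpose_sum, Finset.sum_smul]
    simp [Finset.sum_mul, Finset.mul_sum, R.transpose_mul, smul_smul, mul_comm]
  rw [h2, R.transpose_mul] at h1
  rw [Matrix.mul_apply, Matrix.one_apply]
  simp only [Matrix.transpose_apply, Matrix.of_apply]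
  refine smul_left_injective ℝ R.min.ne_zero ?_
  simp only [h1, ite_smul, one_smul, zero_smul]

end RealIsotypic

/-- A matrix which commutes with the orthogonal matrices in the commutant of `G` commutes with
its skew elements. -/
theorem commute_of_mem_skewCommutant {z X : Matrix (Fin n) (Fin n) ℝ}
    (hz : ∀ g : OGrp n, g.1 ∈ commutant G → Commute z g.1) (hX : X ∈ skewCommutant G) :
    Commute z X := by
  obtain ⟨g, hg, _, h⟩ := exists_orthogonal_of_skew hX
  exact h z (hz g hg)

/-- The reflection `1 - 2 p` for a projection `p`. -/
theorem IsProjIn.exists_reflection {p : Matrix (Fin n) (Fin n) ℝ} (hp : IsProjIn G p) :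
    ∃ g : OGrp n, g.1 ∈ commutant G ∧ g.1 = 1 - (2 : ℝ) • p := by
  refine ⟨⟨1 - (2 : ℝ) • p, (Matrix.mem_orthogonalGroup_iff _ _).mpr ?_⟩,
    sub_mem (one_mem _) (Subalgebra.smul_mem _ hp.mem _), rfl⟩
  rw [Matrix.transpose_sub, Matrix.transpose_smul, hp.symm, Matrix.transpose_one]
  simp only [sub_mul, mul_sub, one_mul, mul_one, smul_mul_assoc, mul_smul_comm, hp.mul_self]
  simp only [two_smul]
  abel

theorem commute_of_isProjIn {z p : Matrix (Fin n) (Fin n) ℝ}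
    (hz : ∀ g : OGrp n, g.1 ∈ commutant G → Commute z g.1) (hp : IsProjIn G p) :
    Commute z p := by
  obtain ⟨g, hg, hgp⟩ := hp.exists_reflection
  have h1 := hz g hg
  rw [hgp] at h1
  have h2 := (Commute.one_right z).sub_right h1
  rw [sub_sub_cancel] at h2
  simpa using h2.smul_right (2 : ℝ)⁻¹

namespace RealIsotypic

/-- The projection $q$ onto a biinvariant subspace of the component commutes with $H$, hence with
all the matrix units $u_iu_j^{\mathsf T}$. It is therefore $\sum_i u_i r u_i^{\mathsf T}$ with
$r=u_0^{\mathsf T}qu_0$, a projection below $p$, and minimality leaves only $r=0$ and $r=p$. -/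
theorem isFactorSpace (R : RealIsotypic G m p u) (hm : 0 < m) {H : Subgroup (OGrp n)}
    (hH : ∀ h, h ∈ H ↔ h.1 ∈ commutant G) (hG : Subgroup.centralizer (H : Set (OGrp n)) = G) :
    IsFactorSpace H (fixedSpace (∑ i, u i * (u i)ᵀ)) := by
  set P := ∑ i, u i * (u i)ᵀ with hP
  have hPP : IsProjIn G P := R.sum_isProjIn
  have hPu : ∀ j, P * u j = u j := R.sum_mul
  refine ⟨fixedSpace_ne_bot hPP.mul_self fun h => ?_, ⟨?_, ?_⟩, ?_⟩
  · exact R.ne_zero ⟨0, hm⟩ (by rw [← hPu, h, zero_mul])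
  · intro h hh v hv
    rw [mem_fixedSpace] at hv ⊢
    rw [← toEuclideanLin_mul, R.central _ ((hH h).mp hh), toEuclideanLin_mul, hv]
  · rw [hG]
    intro g hg v hv
    rw [mem_fixedSpace] at hv ⊢
    rw [← toEuclideanLin_mul, ← mem_commutant.mp hPP.mem g hg, toEuclideanLin_mul, hv]
  · intro W hW hbi
    rw [IsBiinvariant, hG] at hbi
    have hq := projMatrix_isProjIn hbi.2
    have hqH : ∀ g : OGrp n, g.1 ∈ commutant G → Commute (projMatrix W) g.1 := fun g hg =>
      (mem_commutant.mp (projMatrix_isProjIn hbi.1).mem g ((hH g).mpr hg)).symm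
    set q := projMatrix W with hqdef
    have hPq : P * q = q := mul_eq_of_fixedSpace_le hq.mul_self (by rwa [fixedSpace_projMatrix])
    have hproj : ∀ i, Commute q (u i * (u i)ᵀ) := fun i =>
      commute_of_isProjIn hqH ⟨mul_mem (R.mem i) (transpose_mem_commutant (R.mem i)), by
        rw [mul_assoc, ← mul_assoc (u i)ᵀ, R.transpose_mul, if_pos rfl, R.proj_mul_transpose],
        by simp⟩
    have hunit : ∀ i j, Commute q (u i * (u j)ᵀ) := by
      intro i j
      by_cases hij : i = j
      · exact hij ▸ hproj i
      -- Only the skew part of an off-diagonal matrix unit is directly accessible. Multiplying it by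
      -- $u_iu_i^{\mathsf T}$ on the left removes the transposed term.
      · have h1 : Commute q (u i * (u j)ᵀ - (u i * (u j)ᵀ)ᵀ) := commute_of_mem_skewCommutant hqH
          (sub_transpose_mem_skewCommutant (mul_mem (R.mem i) (transpose_mem_commutant (R.mem j))))
        have h2 := (hproj i).mul_right h1
        rw [Matrix.transpose_mul, Matrix.transpose_transpose, mul_sub, mul_assoc, mul_assoc,
          ← mul_assoc (u i)ᵀ, R.transpose_mul, if_pos rfl, ← mul_assoc (u i)ᵀ, R.transpose_mul,
          if_neg hij, zero_mul, mul_zero, sub_zero, R.proj_mul_transpose] at h2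
        exact h2
    set i₀ : Fin m := ⟨0, hm⟩
    have hr : IsProjIn G ((u i₀)ᵀ * q * u i₀) := by
      refine ⟨mul_mem (mul_mem (transpose_mem_commutant (R.mem _)) hq.mem) (R.mem _), ?_, ?_⟩
      · calc (u i₀)ᵀ * q * u i₀ * ((u i₀)ᵀ * q * u i₀)
            = (u i₀)ᵀ * (q * (u i₀ * (u i₀)ᵀ)) * q * u i₀ := by simp only [mul_assoc]
          _ = ((u i₀)ᵀ * u i₀) * (u i₀)ᵀ * (q * q) * u i₀ := by
            rw [(hproj i₀).eq]; simp only [mul_assoc]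
          _ = _ := by
            rw [R.transpose_mul, if_pos rfl, R.proj_mul_transpose, hq.mul_self]
      · rw [Matrix.transpose_mul, Matrix.transpose_mul, hq.symm, Matrix.transpose_transpose,
          mul_assoc]
    have hqsum : q = ∑ i, u i * ((u i₀)ᵀ * q * u i₀) * (u i)ᵀ := by
      conv_lhs => rw [← hPq, hP, Finset.sum_mul]
      refine Finset.sum_congr rfl fun i _ => ?_
      calc u i * (u i)ᵀ * q = u i * ((u i₀)ᵀ * u i₀) * (u i)ᵀ * q := by
            rw [R.transpose_mul, if_pos rfl, R.mul_proj]
        _ = (u i * (u i₀)ᵀ) * ((u i₀ * (u i)ᵀ) * q) := by simp only [mul_assoc]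
        _ = _ := by rw [← (hunit i₀ i).eq]; simp only [mul_assoc]
    rcases R.min.eq_or_eq _ hr (by rw [← mul_assoc, ← mul_assoc, R.proj_mul_transpose]) with h | h
    · left
      rw [h] at hqsum
      simp only [mul_zero, zero_mul, Finset.sum_const_zero] at hqsum
      have : fixedSpace q = W := fixedSpace_projMatrix W
      rw [← this, hqsum, eq_bot_iff]
      intro v hv
      rw [mem_fixedSpace] at hv
      rw [Submodule.mem_bot, ← hv]; simp
    · right
      rw [h] at hqsum
      simp only [R.mul_proj] at hqsum
      rw [← fixedSpace_projMatrix W, ← hqdef, hqsum]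

/-- The partial isometries $u_i$ spread an orthonormal basis $b_l$ of the image of $p$ to an
orthonormal basis $u_ib_l$ of the component. This identifies the component with $\mathbb
R^m\otimes\mathbb R^k$, where $k$ is the dimension of the image of $p$; `exists_matrix` and
`exists_orthogonal` then describe the action of $H$. -/
theorem isOFactor (R : RealIsotypic G m p u) (hm : 0 < m) {H : Subgroup (OGrp n)}
    (hH : ∀ h, h ∈ H ↔ h.1 ∈ commutant G) (hG : Subgroup.centralizer (H : Set (OGrp n)) = G) :
    ∃ k, 0 < k ∧ IsOFactor H (fixedSpace (∑ i, u i * (u i)ᵀ)) m k := by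
  have hfac := R.isFactorSpace hm hH hG
  set P := ∑ i, u i * (u i)ᵀ with hP
  have hPP : IsProjIn G P := R.sum_isProjIn
  have hPu : ∀ j, P * u j = u j := R.sum_mul
  set k := Module.finrank ℝ (fixedSpace p) with hk
  have : Nontrivial (fixedSpace p) :=
    Submodule.nontrivial_iff_ne_bot.mpr (fixedSpace_ne_bot R.min.mul_self R.min.ne_zero)
  set b := stdOrthonormalBasis ℝ (fixedSpace p) with hb
  set T : Matrix (Fin n) (Fin n) ℝ → EuclideanSpace ℝ (Fin n) → EuclideanSpace ℝ (Fin n) :=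
    fun x => Matrix.toEuclideanLin x with hT
  have hpb : ∀ l, T p (b l) = b l := fun l => mem_fixedSpace.mp (b l).2
  have hTmul : ∀ x y v, T x (T y v) = T (x * y) v := fun x y v => (toEuclideanLin_mul x y v).symm
  let f : Fin m × Fin k → fixedSpace P := fun il =>
    ⟨T (u il.1) (b il.2), by rw [mem_fixedSpace]; exact (hTmul _ _ _).trans (by rw [hPu])⟩
  have hinner : ∀ (i j : Fin m) (v w : EuclideanSpace ℝ (Fin n)), T p w = w →
      inner ℝ (T (u i) v) (T (u j) w) = if i = j then inner ℝ v w else 0 := by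
    intro i j v w hw
    rw [hT]
    simp only
    rw [inner_toEuclideanLin, ← toEuclideanLin_mul, R.transpose_mul]
    split_ifs
    · rw [show Matrix.toEuclideanLin p w = w from hw]
    · simp
  have hon : Orthonormal ℝ f := by
    rw [orthonormal_iff_ite]
    rintro ⟨i, l⟩ ⟨j, l'⟩
    have h1 := orthonormal_iff_ite.mp b.orthonormal l l'
    rw [Submodule.coe_inner] at h1 ⊢
    show inner ℝ (T (u i) (b l)) (T (u j) (b l')) = _
    rw [hinner _ _ _ _ (hpb l'), h1]
    simp only [Prod.mk.injEq, ite_and]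
  have hspan : ⊤ ≤ Submodule.span ℝ (Set.range f) := by
    rintro ⟨v, hv⟩ -
    have hvi : ∀ i, T (u i)ᵀ v ∈ fixedSpace p := fun i => by
      rw [mem_fixedSpace]; exact (hTmul _ _ _).trans (by rw [R.proj_mul_transpose])
    have h2 : (⟨v, hv⟩ : fixedSpace P) = ∑ i, ∑ l, b.repr ⟨_, hvi i⟩ l • f (i, l) := by
      apply Subtype.ext
      simp only [Submodule.coe_sum, Submodule.coe_smul]
      have h3 : ∀ i, ∑ l, b.repr ⟨_, hvi i⟩ l • T (u i) (b l) = T (u i) (T (u i)ᵀ v) := by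
        intro i
        have := congrArg Subtype.val (b.sum_repr ⟨_, hvi i⟩)
        simp only [Submodule.coe_sum, Submodule.coe_smul] at this
        conv_rhs => rw [← this]
        simp [hT]
      show v = ∑ i, ∑ l, b.repr ⟨_, hvi i⟩ l • T (u i) (b l)
      simp only [h3, hTmul]
      conv_lhs => rw [← mem_fixedSpace.mp hv, hP]
      simp [hT]
    rw [h2]
    exact sum_mem fun i _ => sum_mem fun l _ => Submodule.smul_mem _ _
      (Submodule.subset_span ⟨(i, l), rfl⟩)
  set e := (OrthonormalBasis.mk hon hspan).repr.symm with he
  have hew : ∀ w, (e w : EuclideanSpace ℝ (Fin n)) = ∑ i, ∑ l, w (i, l) • T (u i) (b l) := by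
    intro w
    rw [he, ← OrthonormalBasis.sum_repr_symm]
    simp only [OrthonormalBasis.coe_mk, Submodule.coe_sum, Submodule.coe_smul,
      Fintype.sum_prod_type]
    rfl
  have hact : ∀ (h : OGrp n) (a : Matrix (Fin m) (Fin m) ℝ),
      (∀ j, h.1 * u j = ∑ i, a i j • u i) → ∀ w,
        Matrix.toEuclideanLin h.1 (e w : EuclideanSpace ℝ (Fin n)) =
          e (Matrix.toEuclideanLin (a ⊗ₖ (1 : Matrix (Fin k) (Fin k) ℝ)) w) := by
    intro h a ha w
    have h1 : ∀ i l, (Matrix.toEuclideanLin (a ⊗ₖ (1 : Matrix (Fin k) (Fin k) ℝ)) w) (i, l) =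
        ∑ j, a i j * w (j, l) := by
      intro i l
      rw [Matrix.toLpLin_apply]
      simp [Matrix.mulVec, dotProduct, Fintype.sum_prod_type, Matrix.one_apply]
    have h2 : ∀ j l, T h.1 (T (u j) (b l)) = ∑ i, a i j • T (u i) (b l) := by
      intro j l
      rw [hTmul, ha]
      simp [hT]
    rw [hew, hew]
    simp only [h1, map_sum, map_smul, Finset.sum_smul]
    have h3 : ∀ j l, Matrix.toEuclideanLin h.1 (T (u j) (b l)) = ∑ i, a i j • T (u i) (b l) := h2
    simp only [h3, Finset.smul_sum, smul_smul]
    calc ∑ j, ∑ l, ∑ i, (w (j, l) * a i j) • T (u i) (b l)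
        = ∑ j, ∑ i, ∑ l, (w (j, l) * a i j) • T (u i) (b l) :=
          Finset.sum_congr rfl fun j _ => Finset.sum_comm
      _ = ∑ i, ∑ j, ∑ l, (w (j, l) * a i j) • T (u i) (b l) := Finset.sum_comm
      _ = _ := by
        refine Finset.sum_congr rfl fun i _ => ?_
        rw [Finset.sum_comm]
        simp only [mul_comm]
  refine ⟨k, Module.finrank_pos, hfac, e, ?_, ?_⟩
  · intro h hh
    obtain ⟨a, ha, hau⟩ := R.exists_matrix ((hH h).mp hh)
    exact ⟨a, ha, hact h a hau⟩
  · intro a ha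
    obtain ⟨h, hh, hau⟩ := R.exists_orthogonal ha
    exact ⟨h, (hH h).mpr hh, hact h a hau⟩

end RealIsotypic

end OFactors

/-! ### Generation of the commutant by its skew elements -/

section SkewGeneration

variable {n : ℕ} {G : Subgroup (OGrp n)} {z : Matrix (Fin n) (Fin n) ℝ}

/-- All elements of the corner algebra of `p` are scalar. -/
def IsRealProj (G : Subgroup (OGrp n)) (p : Matrix (Fin n) (Fin n) ℝ) : Prop :=
  ∀ x ∈ commutant G, p * x = x → x * p = x → ∃ c : ℝ, x = c • p

theorem transpose_mul_of_mul {p x : Matrix (Fin n) (Fin n) ℝ} (hp : pᵀ = p) (h : x * p = x) :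
    p * xᵀ = xᵀ := by
  have := congrArg Matrix.transpose h
  rwa [Matrix.transpose_mul, hp] at this

theorem mul_transpose_of_mul {p x : Matrix (Fin n) (Fin n) ℝ} (hp : pᵀ = p) (h : p * x = x) :
    xᵀ * p = xᵀ := by
  have := congrArg Matrix.transpose h
  rwa [Matrix.transpose_mul, hp] at this

/-- If the corner algebra of a minimal projection is not real, then it is generated by its
skew elements. -/
theorem IsMinProjIn.commute_of_not_isRealProj {p : Matrix (Fin n) (Fin n) ℝ}
    (hp : IsMinProjIn G p) (hz : ∀ X ∈ skewCommutant G, Commute z X) (hr : ¬ IsRealProj G p)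
    {y : Matrix (Fin n) (Fin n) ℝ} (hy : y ∈ commutant G) (hpy : p * y = y) (hyp : y * p = y) :
    Commute z y := by
  have half : ∀ x : Matrix (Fin n) (Fin n) ℝ, x = (1 / 2 : ℝ) • (x + xᵀ) + (1 / 2 : ℝ) • (x - xᵀ) := by
    intro x
    rw [← smul_add, add_add_sub_cancel, ← two_smul ℝ, smul_smul]
    norm_num
  have hsymm : ∀ x ∈ commutant G, p * x = x → x * p = x → ∃ c : ℝ, x + xᵀ = c • p := by
    intro x hx hpx hxp
    refine hp.exists_eq_smul_of_symm (add_mem hx (transpose_mem_commutant hx)) ?_ ?_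
    · rw [Matrix.transpose_add, Matrix.transpose_transpose, add_comm]
    · rw [mul_add, hpx, transpose_mul_of_mul hp.symm hxp]
  have hpz : Commute z p := by
    rw [IsRealProj] at hr
    push Not at hr
    obtain ⟨x, hx, hpx, hxp, hne⟩ := hr
    -- The symmetric part of $x$ is scalar, so $w\neq0$ for a nonscalar $x$. Being symmetric, $w^2$
    -- is a multiple of $p$, and it is nonzero since $w^2=-w^{\mathsf T}w$. Thus $p$ itself is a
    -- multiple of the square of a skew element.
    set w := x - xᵀ with hw
    have hwmem : w ∈ skewCommutant G := sub_transpose_mem_skewCommutant hx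
    have hpw : p * w = w := by rw [hw, mul_sub, hpx, transpose_mul_of_mul hp.symm hxp]
    have hw0 : w ≠ 0 := by
      intro h0
      obtain ⟨c, hc⟩ := hsymm x hx hpx hxp
      apply hne ((1 / 2 : ℝ) * c)
      conv_lhs => rw [half x, ← hw, h0, hc, smul_zero, add_zero, smul_smul]
    obtain ⟨c, hc⟩ := hp.exists_eq_smul_of_symm (mul_mem hwmem.1 hwmem.1)
      (by rw [Matrix.transpose_mul, hwmem.2, neg_mul_neg]) (by rw [← mul_assoc, hpw])
    have hc0 : c ≠ 0 := by
      intro h0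
      apply hw0
      apply eq_zero_of_transpose_self_mul
      rw [hwmem.2, neg_mul, hc, h0, zero_smul, neg_zero]
    have h1 : Commute z (w * w) := (hz w hwmem).mul_right (hz w hwmem)
    rw [hc] at h1
    have h2 := h1.smul_right c⁻¹
    rwa [smul_smul, inv_mul_cancel₀ hc0, one_smul] at h2
  obtain ⟨c, hc⟩ := hsymm y hy hpy hyp
  rw [half y, hc]
  exact ((hpz.smul_right _).smul_right _).add_right
    ((hz _ (sub_transpose_mem_skewCommutant hy)).smul_right _)

/-- Since $pq=0$, multiplication by $p$ kills the transposed term of $x-x^{\mathsf T}$, so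
$x=p(x-x^{\mathsf T})$ is a product of elements commuting with $z$. -/
theorem commute_intertwiner {p q x : Matrix (Fin n) (Fin n) ℝ} (hq : IsProjIn G q)
    (hpq : p * q = 0) (hz : ∀ X ∈ skewCommutant G, Commute z X) (hpz : Commute z p)
    (hx : x ∈ commutant G) (hpx : p * x = x) (hxq : x * q = x) : Commute z x ∧ Commute z xᵀ := by
  have hs := hz _ (sub_transpose_mem_skewCommutant hx)
  have h1 : p * (x - xᵀ) = x := by
    rw [mul_sub, hpx, ← transpose_mul_of_mul hq.symm hxq, ← mul_assoc, hpq, zero_mul, sub_zero]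
  have h2 : Commute z x := h1 ▸ hpz.mul_right hs
  refine ⟨h2, ?_⟩
  have := h2.sub_right hs
  rwa [sub_sub_cancel] at this

/-- Three pairwise orthogonal equivalent projections are generated by skew elements. -/
theorem commute_of_three {p q r u v : Matrix (Fin n) (Fin n) ℝ} (hp : IsProjIn G p)
    (hq : IsProjIn G q) (hr : IsProjIn G r) (hpq : p * q = 0) (hqr : q * r = 0) (hpr : p * r = 0)
    (hz : ∀ X ∈ skewCommutant G, Commute z X) (hu : u ∈ commutant G) (hv : v ∈ commutant G)
    (hpu : p * u = u) (huq : u * q = u) (hqv : q * v = v) (hvr : v * r = v)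
    (huu : u * uᵀ = p) (hvv : v * vᵀ = q) : Commute z p := by
  have tr : ∀ {a b : Matrix (Fin n) (Fin n) ℝ}, IsProjIn G a → IsProjIn G b → a * b = 0 →
      b * a = 0 := by
    intro a b ha hb h
    have := congrArg Matrix.transpose h
    rwa [Matrix.transpose_mul, ha.symm, hb.symm, Matrix.transpose_zero] at this
  have hqp := tr hp hq hpq
  have hrq := tr hq hr hqr
  have hrp := tr hp hr hpr
  have hqu : q * uᵀ = uᵀ := transpose_mul_of_mul hq.symm huq
  have hup : uᵀ * p = uᵀ := mul_transpose_of_mul hp.symm hpu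
  have hrv : r * vᵀ = vᵀ := transpose_mul_of_mul hr.symm hvr
  have hvq : vᵀ * q = vᵀ := mul_transpose_of_mul hq.symm hqv
  have z1 : u * vᵀ = 0 := by rw [← huq, ← hrv, mul_assoc, ← mul_assoc q, hqr]; simp
  have z2 : uᵀ * v = 0 := by rw [← hup, ← hqv, mul_assoc, ← mul_assoc p, hpq]; simp
  have z3 : uᵀ * vᵀ = 0 := by rw [← hup, ← hrv, mul_assoc, ← mul_assoc p, hpr]; simp
  have hsu := hz _ (sub_transpose_mem_skewCommutant hu)
  have hsv := hz _ (sub_transpose_mem_skewCommutant hv)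
  -- With three orthogonal projections the mixed terms all vanish, so $uv$ is a product of skew
  -- elements. Then $p=(uv)(uv)^{\mathsf T}$ is such a product as well.
  have e1 : (u - uᵀ) * (v - vᵀ) = u * v := by
    rw [sub_mul, mul_sub, mul_sub, z1, z2, z3]; abel
  have e2 : (v - vᵀ) * (u - uᵀ) = (u * v)ᵀ := by
    rw [← e1, Matrix.transpose_mul]; simp only [Matrix.transpose_sub, Matrix.transpose_transpose]
    rw [← neg_sub u, ← neg_sub v, neg_mul_neg]
  have h1 : Commute z (u * v) := e1 ▸ hsu.mul_right hsv
  have h2 : Commute z (u * v)ᵀ := e2 ▸ hsv.mul_right hsu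
  have h3 := h1.mul_right h2
  rwa [Matrix.transpose_mul, mul_assoc, ← mul_assoc v, hvv, hqu, huu] at h3

/-- If the centralizer `H` of `G` has neither a factor `O(2)_k` nor a double factor
`O(1)_k × O(1)_l`, then everything that commutes with the skew elements of the commutant of `G`
commutes with the whole commutant. -/
theorem commute_of_no_factors {H : Subgroup (OGrp n)} (hH : ∀ h, h ∈ H ↔ h.1 ∈ commutant G)
    (hG : Subgroup.centralizer (H : Set (OGrp n)) = G) (h2 : ¬ HasOFactor H 2)
    (h1 : ¬ HasDoubleOFactor H 1) (hz : ∀ X ∈ skewCommutant G, Commute z X)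
    {x : Matrix (Fin n) (Fin n) ℝ} (hx : x ∈ commutant G) : Commute z x := by
  classical
  obtain ⟨s, hs, horth, hsum⟩ := (isProjIn_one (G := G)).exists_decomposition
  have hmin : ∀ p ∈ s, IsMinProjIn G p := fun p hp => (hs p hp).1
  -- intertwiners between different members vanish off the central isotypic components
  have central_of : ∀ t ⊆ s, (∀ p ∈ t, ∀ q ∈ s, q ∉ t → ∀ y ∈ commutant G, p * y * q = 0) →
      ∀ y ∈ commutant G, (∑ p ∈ t, p) * y = y * ∑ p ∈ t, p := by
    intro t hts ht y hy
    have h3 : ∀ y ∈ commutant G, (∑ p ∈ t, p) * y = (∑ p ∈ t, p) * y * ∑ p ∈ t, p := by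
      intro y hy
      have h4 : (∑ p ∈ t, p) * y * ∑ q ∈ s \ t, q = 0 := by
        simp only [Finset.sum_mul, Finset.mul_sum]
        refine Finset.sum_eq_zero fun q hq => Finset.sum_eq_zero fun p hp => ?_
        rw [Finset.mem_sdiff] at hq
        exact ht p hp q hq.1 hq.2 y hy
      conv_lhs => rw [← mul_one ((∑ p ∈ t, p) * y), ← hsum, ← Finset.sum_sdiff hts, mul_add, h4,
        zero_add]
    have hT : (∑ p ∈ t, p)ᵀ = ∑ p ∈ t, p := by
      rw [Matrix.transpose_sum]
      exact Finset.sum_congr rfl fun p hp => (hmin p (hts hp)).symm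
    have h5 := congrArg Matrix.transpose (h3 yᵀ (transpose_mem_commutant hy))
    simp only [Matrix.transpose_mul, hT, Matrix.transpose_transpose] at h5
    rw [h3 y hy, h5, mul_assoc]
  -- members of the decomposition which do not belong to a factor `O(1)_k`
  have good : ∀ p ∈ s, ¬ (IsRealProj G p ∧ ∀ q ∈ s, q ≠ p → ∀ y ∈ commutant G, p * y * q = 0) →
      Commute z p := by
    intro p hp hne
    by_cases hreal : IsRealProj G p
    swap
    · exact (hmin p hp).commute_of_not_isRealProj hz hreal (hmin p hp).mem (hmin p hp).mul_self
        (hmin p hp).mul_self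
    push Not at hne
    obtain ⟨q, hq, hqp, y, hy, hy0⟩ := hne hreal
    have hpq : p * q = 0 := horth p hp q hq hqp.symm
    have hqp0 : q * p = 0 := horth q hq p hp hqp
    have corner : ∀ {a b y : Matrix (Fin n) (Fin n) ℝ}, a ∈ s → b ∈ s → y ∈ commutant G →
        a * y * b ≠ 0 → ∃ u ∈ commutant G, a * u = u ∧ u * b = u ∧ u * uᵀ = a ∧ uᵀ * u = b := by
      intro a b y ha hb hy h0
      exact (hmin a ha).exists_partialIsometry (hmin b hb)
        (mul_mem (mul_mem (hmin a ha).mem hy) (hmin b hb).mem)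
        (by rw [← mul_assoc, ← mul_assoc, (hmin a ha).mul_self])
        (by rw [mul_assoc, (hmin b hb).mul_self]) h0
    obtain ⟨u, hu, hpu, huq, huu, huu'⟩ := corner hp hq hy hy0
    by_cases hthree : ∃ r ∈ s, r ≠ p ∧ r ≠ q ∧ ∃ y ∈ commutant G, q * y * r ≠ 0
    · obtain ⟨r, hr, hrp, hrq, y, hy, hy0⟩ := hthree
      obtain ⟨v, hv, hqv, hvr, hvv, -⟩ := corner hq hr hy hy0
      exact commute_of_three (hmin p hp).1 (hmin q hq).1 (hmin r hr).1 hpq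
        (horth q hq r hr hrq.symm) (horth p hp r hr hrp.symm) hz hu hv hpu huq hqv hvr huu hvv
    -- Now $p$ and $q$ make up a whole isotypic component of real type, which is a factor $\mathrm
    -- O(2)_k$.
    · exfalso
      push Not at hthree
      apply h2
      have hqu : q * uᵀ = uᵀ := transpose_mul_of_mul (hmin q hq).symm huq
      have hup : uᵀ * p = uᵀ := mul_transpose_of_mul (hmin p hp).symm hpu
      have hcent := central_of {p, q} (by
        intro a ha
        rcases Finset.mem_insert.mp ha with rfl | ha
        · exact hp
        · rw [Finset.mem_singleton.mp ha]; exact hq) (by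
        intro a ha b hb hbt y hy
        rw [Finset.mem_insert, Finset.mem_singleton, not_or] at hbt
        rcases Finset.mem_insert.mp ha with rfl | ha
        -- A nonzero block between $p$ and $b$ would give one between $q$ and $b$ after
        -- multiplication by $u^{\mathsf T}$.
        · have := hthree b hb hbt.1 hbt.2 _ (mul_mem (transpose_mem_commutant hu) hy)
          rw [← mul_assoc, hqu] at this
          rw [← huu, mul_assoc u, mul_assoc u, this, mul_zero]
        · rw [Finset.mem_singleton.mp ha]
          exact hthree b hb hbt.1 hbt.2 y hy)
      rw [Finset.sum_pair hqp.symm] at hcent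
      have hR : RealIsotypic G 2 p ![p, uᵀ] := by
        refine ⟨hmin p hp, ?_, ?_, ?_, hreal, ?_⟩
        · intro i
          fin_cases i
          · exact (hmin p hp).mem
          · exact transpose_mem_commutant hu
        · intro i j
          fin_cases i <;> fin_cases j
          · simpa using by rw [(hmin p hp).symm, (hmin p hp).mul_self]
          · simpa using by rw [(hmin p hp).symm, ← hqu, ← mul_assoc, hpq, zero_mul]
          · simpa using by rw [← huq, mul_assoc, hqp0, mul_zero]
          · simpa using huu
        · intro i
          fin_cases i
          · exact (hmin p hp).mul_self
          · exact hup
        · intro y hy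
          rw [Fin.sum_univ_two]
          simpa [(hmin p hp).symm, (hmin p hp).mul_self, huu'] using hcent y hy
      obtain ⟨k, hk, hf⟩ := hR.isOFactor two_pos hH hG
      exact ⟨_, k, hk, hf⟩
  have all : ∀ p ∈ s, Commute z p := by
    intro p hp
    by_cases hbad : IsRealProj G p ∧ ∀ q ∈ s, q ≠ p → ∀ y ∈ commutant G, p * y * q = 0
    swap
    · exact good p hp hbad
    have factor : ∀ q ∈ s, (IsRealProj G q ∧ ∀ r ∈ s, r ≠ q → ∀ y ∈ commutant G, q * y * r = 0) →
        ∃ k, 0 < k ∧ IsOFactor H (fixedSpace q) 1 k := by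
      intro q hq hbad
      have hcent := central_of {q} (by simpa using hq) (by
        intro a ha b hb hbt y hy
        rw [Finset.mem_singleton] at ha hbt
        subst ha
        exact hbad.2 b hb hbt y hy)
      rw [Finset.sum_singleton] at hcent
      have hR : RealIsotypic G 1 q ![q] := by
        refine ⟨hmin q hq, ?_, ?_, ?_, hbad.1, ?_⟩
        · intro i
          fin_cases i
          exact (hmin q hq).mem
        · intro i j
          fin_cases i
          fin_cases j
          simpa using by rw [(hmin q hq).symm, (hmin q hq).mul_self]
        · intro i
          fin_cases i
          exact (hmin q hq).mul_self
        · intro y hy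
          simpa [(hmin q hq).symm, (hmin q hq).mul_self] using hcent y hy
      obtain ⟨k, hk, hf⟩ := hR.isOFactor one_pos hH hG
      refine ⟨k, hk, ?_⟩
      simpa [(hmin q hq).symm, (hmin q hq).mul_self] using hf
    -- A second isolated projection of real type would produce a double factor $\mathrm
    -- O(1)_k\times\mathrm O(1)_l$. So $p$ is the only one and can be reached as the complement of
    -- the others.
    have hrest : ∀ q ∈ s.erase p, Commute z q := by
      intro q hq
      rw [Finset.mem_erase] at hq
      refine good q hq.2 fun hbad' => h1 ?_
      obtain ⟨k, hk, hf⟩ := factor p hp hbad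
      obtain ⟨l, hl, hf'⟩ := factor q hq.2 hbad'
      refine ⟨_, _, k, l, hk, hl, fun heq => hq.1 ?_, hf, hf'⟩
      rw [← projMatrix_fixedSpace (hmin p hp).mul_self (hmin p hp).symm, heq,
        projMatrix_fixedSpace (hmin q hq.2).mul_self (hmin q hq.2).symm]
    have h3 : p = 1 - ∑ q ∈ s.erase p, q := by
      rw [← hsum, ← Finset.add_sum_erase s (fun q => q) hp, add_sub_cancel_right]
    rw [h3]
    refine (Commute.one_right z).sub_right ?_
    exact Commute.sum_right _ _ _ hrest
  -- In this block decomposition the diagonal blocks are scalar or belong to a corner that is not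
  -- real, and the off-diagonal blocks are intertwiners.
  have hxsum : x = ∑ p ∈ s, ∑ q ∈ s, p * x * q := by
    calc x = (∑ p ∈ s, p) * x * ∑ q ∈ s, q := by rw [hsum, one_mul, mul_one]
      _ = _ := by rw [Finset.sum_mul, Finset.sum_mul]; simp only [Finset.mul_sum]
  rw [hxsum]
  refine Commute.sum_right _ _ _ fun p hp => Commute.sum_right _ _ _ fun q hq => ?_
  have hm : p * x * q ∈ commutant G := mul_mem (mul_mem (hmin p hp).mem hx) (hmin q hq).mem
  have hl : p * (p * x * q) = p * x * q := by rw [← mul_assoc, ← mul_assoc, (hmin p hp).mul_self]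
  have hr : p * x * q * q = p * x * q := by rw [mul_assoc, (hmin q hq).mul_self]
  by_cases hpq : p = q
  · subst hpq
    by_cases hreal : IsRealProj G p
    · obtain ⟨c, hc⟩ := hreal _ hm hl hr
      rw [hc]
      exact (all p hp).smul_right c
    · exact (hmin p hp).commute_of_not_isRealProj hz hreal hm hl hr
  · exact (commute_intertwiner (hmin q hq).1 (horth p hp q hq hpq) hz (all p hp) hm hl hr).1

end SkewGeneration

/-! ### The forbidden factors obstruct generation -/

section FactorObstruction

variable {n : ℕ} {G H : Subgroup (OGrp n)}

theorem toEuclideanLin_kronecker_one_apply {m k : ℕ} (a : Matrix (Fin m) (Fin m) ℝ)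
    (w : EuclideanSpace ℝ (Fin m × Fin k)) (i : Fin m) (l : Fin k) :
    (Matrix.toEuclideanLin (a ⊗ₖ (1 : Matrix (Fin k) (Fin k) ℝ)) w) (i, l) =
      ∑ j, a i j * w (j, l) := by
  rw [Matrix.toLpLin_apply]
  simp [Matrix.mulVec, dotProduct, Fintype.sum_prod_type, Matrix.one_apply]

theorem toEuclideanLin_kronecker_one_mul {m k : ℕ} (a b : Matrix (Fin m) (Fin m) ℝ)
    (w : EuclideanSpace ℝ (Fin m × Fin k)) :
    Matrix.toEuclideanLin (a ⊗ₖ (1 : Matrix (Fin k) (Fin k) ℝ))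
        (Matrix.toEuclideanLin (b ⊗ₖ (1 : Matrix (Fin k) (Fin k) ℝ)) w) =
      Matrix.toEuclideanLin ((a * b) ⊗ₖ (1 : Matrix (Fin k) (Fin k) ℝ)) w := by
  ext ⟨i, l⟩
  simp only [toEuclideanLin_kronecker_one_apply, Matrix.mul_apply, Finset.mul_sum, Finset.sum_mul]
  rw [Finset.sum_comm]
  simp only [mul_assoc]

/-- An eigenvector $v$ of $a$ for $-1$ would yield the eigenvector $v\otimes(1,\dots,1)$ of $g$ for
$-1$, which is nonzero because $k>0$. -/
theorem det_one_add_ne_zero_of_kronecker {V : Submodule ℝ (EuclideanSpace ℝ (Fin n))} {m k : ℕ}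
    (hk : 0 < k) (e : EuclideanSpace ℝ (Fin m × Fin k) ≃ₗᵢ[ℝ] V) {g : Matrix (Fin n) (Fin n) ℝ}
    {a : Matrix (Fin m) (Fin m) ℝ}
    (ha : ∀ w, Matrix.toEuclideanLin g (e w : EuclideanSpace ℝ (Fin n)) =
      e (Matrix.toEuclideanLin (a ⊗ₖ (1 : Matrix (Fin k) (Fin k) ℝ)) w))
    (hg : (1 + g).det ≠ 0) : (1 + a).det ≠ 0 := by
  intro h0
  obtain ⟨v, hv, hav⟩ := Matrix.exists_mulVec_eq_zero_iff.mpr h0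
  apply hg
  set w : EuclideanSpace ℝ (Fin m × Fin k) := WithLp.toLp 2 fun il => v il.1 with hw
  have hw0 : w ≠ 0 := by
    intro h
    apply hv
    funext i
    have := congrArg (fun y : EuclideanSpace ℝ (Fin m × Fin k) => y (i, ⟨0, hk⟩)) h
    simpa [hw] using this
  have haw : Matrix.toEuclideanLin (a ⊗ₖ (1 : Matrix (Fin k) (Fin k) ℝ)) w = -w := by
    ext ⟨i, l⟩
    rw [toEuclideanLin_kronecker_one_apply]
    rw [Matrix.add_mulVec, Matrix.one_mulVec] at hav
    have := congrFun hav i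
    simp only [Pi.add_apply, Pi.zero_apply, Matrix.mulVec, dotProduct] at this
    simp only [hw, PiLp.neg_apply]
    linarith
  have h1 := ha w
  rw [haw] at h1
  have h2 : Matrix.toEuclideanLin (1 + g) (e w : EuclideanSpace ℝ (Fin n)) = 0 := by
    rw [map_add, LinearMap.add_apply, toEuclideanLin_one, h1]
    simp
  refine Matrix.exists_mulVec_eq_zero_iff.mp ⟨(e w : EuclideanSpace ℝ (Fin n)).ofLp, ?_, ?_⟩
  · intro h
    apply hw0
    have h3 : (e w : EuclideanSpace ℝ (Fin n)) = 0 := by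
      ext i; exact congrFun h i
    have h4 : e w = 0 := Subtype.ext h3
    simpa using h4
  · rw [Matrix.toLpLin_apply] at h2
    exact congrArg WithLp.ofLp h2

/-- An orthogonal $2\times2$ matrix of determinant $-1$ is a reflection and has the eigenvalue $-1$.
Only rotations remain, and they commute with each other. -/
theorem orthogonal_fin_two_of_det_ne_zero {a : Matrix (Fin 2) (Fin 2) ℝ}
    (ha : a ∈ Matrix.orthogonalGroup (Fin 2) ℝ) (hd : (1 + a).det ≠ 0) :
    a 0 0 = a 1 1 ∧ a 0 1 = -a 1 0 := by
  have h := (Matrix.mem_orthogonalGroup_iff _ _).mp ha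
  have h00 := congrFun (congrFun h 0) 0
  have h01 := congrFun (congrFun h 0) 1
  have h11 := congrFun (congrFun h 1) 1
  simp [Matrix.mul_apply, Fin.sum_univ_two] at h00 h01 h11
  rw [Matrix.det_fin_two] at hd
  simp at hd
  have hdet : (a 0 0 * a 1 1 - a 0 1 * a 1 0) ^ 2 = 1 := by
    linear_combination (a 1 0 ^ 2 + a 1 1 ^ 2) * h00 + h11 -
      (a 0 0 * a 1 0 + a 0 1 * a 1 1) * h01
  have h1 : a 0 0 * a 1 1 - a 0 1 * a 1 0 = 1 ∨ a 0 0 * a 1 1 - a 0 1 * a 1 0 = -1 :=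
    mul_self_eq_one_iff.mp (by rw [← sq]; exact hdet)
  rcases h1 with h1 | h1
  · constructor
    · linear_combination a 1 1 * h00 - a 0 1 * h01 - a 0 0 * h1
    · linear_combination -a 1 0 * h00 + a 0 0 * h01 - a 0 1 * h1
  · exfalso
    apply hd
    have e1 : a 1 1 = -a 0 0 := by linear_combination -a 1 1 * h00 + a 0 1 * h01 + a 0 0 * h1
    rw [e1] at h1 ⊢
    linear_combination h1

/-- If every rotation which commutes with the elements `g` of `H` without eigenvalue `-1` commutes
with `H`, then `H` contains no factor `O(2)_k`. -/
theorem not_hasOFactor_two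
    (hz : ∀ z : SOGrp n, (∀ g ∈ H, (1 + g.1).det ≠ 0 → Commute z.1 g.1) →
      ∀ g ∈ H, Commute z.1 g.1) : ¬ HasOFactor H 2 := by
  rintro ⟨V, k, hk, hfac, e, h1, h2⟩
  -- Any rotation with $R^2\neq\pm1$ would do; this one has rational entries.
  set R : Matrix (Fin 2) (Fin 2) ℝ := !![3 / 5, -(4 / 5); 4 / 5, 3 / 5] with hR
  have hRO : R ∈ Matrix.orthogonalGroup (Fin 2) ℝ := by
    rw [Matrix.mem_orthogonalGroup_iff]
    ext i j
    fin_cases i <;> fin_cases j <;> simp [hR, Matrix.mul_apply, Fin.sum_univ_two] <;> norm_num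
  set F : Matrix (Fin 2) (Fin 2) ℝ := !![1, 0; 0, -1] with hF
  have hFO : F ∈ Matrix.orthogonalGroup (Fin 2) ℝ := by
    rw [Matrix.mem_orthogonalGroup_iff]
    ext i j
    fin_cases i <;> fin_cases j <;> simp [hF, Matrix.mul_apply, Fin.sum_univ_two]
  obtain ⟨r, hr, hre⟩ := h2 R hRO
  obtain ⟨f, hf, hfe⟩ := h2 F hFO
  have hP := projMatrix_isProjIn hfac.2.1.1
  set P := projMatrix V with hPdef
  have hPH : ∀ g ∈ H, g.1 * P = P * g.1 := mem_commutant.mp hP.mem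
  have hPe : ∀ w, Matrix.toEuclideanLin P (e w : EuclideanSpace ℝ (Fin n)) = e w := fun w =>
    projMatrix_apply_eq_self_iff.mpr (e w).2
  have hPV : ∀ v, ∃ w, Matrix.toEuclideanLin P v = e w := fun v =>
    ⟨e.symm ⟨Matrix.toEuclideanLin P v, by
      rw [hPdef, toEuclideanLin_projMatrix]; exact Submodule.starProjection_apply_mem _ _⟩, by simp⟩
  set y := P * r.1 + (1 - P) with hy
  have hyO : y * yᵀ = 1 := by
    have e1 : r.1ᵀ * P = P * r.1ᵀ := by
      have := congrArg Matrix.transpose (hPH r hr)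
      rw [Matrix.transpose_mul, Matrix.transpose_mul, hP.symm] at this
      exact this.symm
    rw [hy, Matrix.transpose_add, Matrix.transpose_mul, Matrix.transpose_sub, Matrix.transpose_one,
      hP.symm, e1, add_mul, mul_add, mul_add]
    have e2 : P * r.1 * (P * r.1ᵀ) = P := by
      rw [mul_assoc, ← mul_assoc r.1, hPH r hr, mul_assoc P, OGrp.mul_transpose, mul_one,
        hP.mul_self]
    have e3 : P * r.1 * (1 - P) = 0 := by
      rw [mul_sub, mul_one, mul_assoc, hPH r hr, ← mul_assoc, hP.mul_self, sub_self]
    have e4 : (1 - P) * (P * r.1ᵀ) = 0 := by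
      rw [← mul_assoc, sub_mul, one_mul, hP.mul_self, sub_self, zero_mul]
    have e5 : (1 - P) * (1 - P) = 1 - P := by
      rw [mul_sub, mul_one, sub_mul, one_mul, hP.mul_self, sub_self, sub_zero]
    rw [e2, e3, e4, e5]
    abel
  have hydet : (y * y).det = 1 := by
    have := congrArg Matrix.det hyO
    rw [Matrix.det_mul, Matrix.det_transpose, Matrix.det_one] at this
    rw [Matrix.det_mul, this]
  have hye : ∀ w, Matrix.toEuclideanLin y (e w : EuclideanSpace ℝ (Fin n)) =
      e (Matrix.toEuclideanLin (R ⊗ₖ (1 : Matrix (Fin k) (Fin k) ℝ)) w) := by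
    intro w
    rw [hy, map_add, LinearMap.add_apply, map_sub, LinearMap.sub_apply, toEuclideanLin_one, hPe,
      sub_self, add_zero, toEuclideanLin_mul, hre, hPe]
  have hyy : (y * y) * (y * y)ᵀ = 1 := by
    rw [Matrix.transpose_mul, mul_assoc, ← mul_assoc y yᵀ, hyO, one_mul, hyO]
  -- Here $y$ is $R\otimes1$ on $V$ and the identity on $V^\perp$. Squaring it makes the determinant
  -- one without a computation, and $R^2$ still does not commute with the reflection $F$.
  let z : SOGrp n := ⟨y * y, Matrix.mem_specialOrthogonalGroup_iff.mpr
    ⟨(Matrix.mem_orthogonalGroup_iff _ _).mpr hyy, hydet⟩⟩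
  have hcomm := hz z (by
    intro g hg hd
    obtain ⟨a, ha, hae⟩ := h1 g hg
    obtain ⟨a1, a2⟩ := orthogonal_fin_two_of_det_ne_zero ha
      (det_one_add_ne_zero_of_kronecker hk e hae hd)
    have hRa : R * a = a * R := by
      ext i j
      fin_cases i <;> fin_cases j <;> simp [hR, Matrix.mul_apply, Fin.sum_univ_two, a1, a2] <;> ring
    have hyg : Commute y g.1 := by
      have h3 : P * r.1 * g.1 = g.1 * (P * r.1) := by
        refine toEuclideanLin_ext fun v => ?_
        obtain ⟨w, hw⟩ := hPV v
        have e1 : P * r.1 * g.1 = r.1 * g.1 * P := by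
          rw [← hPH r hr, mul_assoc, mul_assoc, hPH g hg]
        have e2 : g.1 * (P * r.1) = g.1 * r.1 * P := by
          rw [← hPH r hr, mul_assoc]
        rw [e1, e2, toEuclideanLin_mul, toEuclideanLin_mul _ P, hw, toEuclideanLin_mul,
          toEuclideanLin_mul, hae, hre, hre, hae, toEuclideanLin_kronecker_one_mul,
          toEuclideanLin_kronecker_one_mul, hRa]
      show y * g.1 = g.1 * y
      rw [hy, add_mul, mul_add, h3, sub_mul, mul_sub, hPH g hg, one_mul, mul_one]
    exact hyg.mul_left hyg) f hf
  -- On the vector $e_0\otimes(1,\dots,1)$ the two products differ in the sign of the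
  -- $e_1$-components.
  have h4 := congrArg (fun x => Matrix.toEuclideanLin x (e (WithLp.toLp 2 fun il =>
    if il.1 = 0 then 1 else 0) : EuclideanSpace ℝ (Fin n))) hcomm.eq
  simp only [toEuclideanLin_mul, z, hfe, hye, toEuclideanLin_kronecker_one_mul] at h4
  have h5 := congrArg (fun w : EuclideanSpace ℝ (Fin 2 × Fin k) => w (1, ⟨0, hk⟩))
    (e.injective (Subtype.ext h4))
  simp only [toEuclideanLin_kronecker_one_apply] at h5
  simp [hR, hF, Matrix.mul_apply, Fin.sum_univ_two] at h5
  norm_num at h5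

/-- The subgroup of the orthogonal group which fixes a vector. -/
def vectorStabilizer (x : EuclideanSpace ℝ (Fin n)) : Subgroup (OGrp n) where
  carrier := {g | Matrix.toEuclideanLin g.1 x = x}
  mul_mem' {g h} hg hh := by
    rw [Set.mem_ofPred_eq] at *
    rw [OGrp.coe_mul, toEuclideanLin_mul, hh, hg]
  one_mem' := toEuclideanLin_one x
  inv_mem' {g} hg := by
    rw [Set.mem_ofPred_eq] at *
    conv_lhs => rw [← hg]
    rw [← toEuclideanLin_mul, OGrp.coe_inv, OGrp.transpose_mul, toEuclideanLin_one]

theorem projMatrix_span_isProjIn (x : EuclideanSpace ℝ (Fin n)) :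
    IsProjIn (vectorStabilizer x) (projMatrix (Submodule.span ℝ {x})) := by
  refine projMatrix_isProjIn fun g hg v hv => ?_
  obtain ⟨c, rfl⟩ := Submodule.mem_span_singleton.mp hv
  rw [map_smul, show Matrix.toEuclideanLin g.1 x = x from hg]
  exact hv

theorem det_two_projMatrix_sub_one (W : Submodule ℝ (EuclideanSpace ℝ (Fin n))) :
    ((2 : ℝ) • projMatrix W - 1).det = (-1) ^ Module.finrank ℝ Wᗮ := by
  rw [← Submodule.det_reflection]
  have : Matrix.toEuclideanLin ((2 : ℝ) • projMatrix W - 1) = W.reflection.toLinearMap := by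
    ext1 v
    rw [map_sub, map_smul, LinearMap.sub_apply, LinearMap.smul_apply, toEuclideanLin_projMatrix,
      toEuclideanLin_one]
    simp [Submodule.reflection_apply, two_smul]
  rw [← this]
  exact (LinearMap.det_toLin (PiLp.basisFun 2 ℝ (Fin n)) _).symm

/-- The only elements of $\mathrm O(1)$ are $\pm1$, and $-1$ is excluded by
`det_one_add_ne_zero_of_kronecker`. -/
theorem isOFactor_one_apply {V : Submodule ℝ (EuclideanSpace ℝ (Fin n))} {k : ℕ} (hk : 0 < k)
    (hV : IsOFactor H V 1 k) {g : OGrp n} (hg : g ∈ H) (hd : (1 + g.1).det ≠ 0)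
    {v : EuclideanSpace ℝ (Fin n)} (hv : v ∈ V) : Matrix.toEuclideanLin g.1 v = v := by
  obtain ⟨-, e, h1, -⟩ := hV
  obtain ⟨a, ha, hae⟩ := h1 g hg
  have hd' := det_one_add_ne_zero_of_kronecker hk e hae hd
  have ha1 : a 0 0 = 1 := by
    have h := congrFun (congrFun ((Matrix.mem_orthogonalGroup_iff _ _).mp ha) 0) 0
    simp [Matrix.mul_apply] at h
    simp [Matrix.det_unique] at hd'
    rcases mul_self_eq_one_iff.mp h with h | h
    · exact h
    · exact absurd (by rw [h]; ring) hd'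
  have h3 := hae (e.symm ⟨v, hv⟩)
  have h4 : Matrix.toEuclideanLin (a ⊗ₖ (1 : Matrix (Fin k) (Fin k) ℝ)) (e.symm ⟨v, hv⟩) =
      e.symm ⟨v, hv⟩ := by
    ext ⟨i, l⟩
    rw [toEuclideanLin_kronecker_one_apply]
    fin_cases i
    simp [ha1]
  rw [h4] at h3
  simpa using h3

/-- Different factor spaces are orthogonal. -/
theorem IsFactorSpace.projMatrix_apply_eq_zero (hH : ∀ h, h ∈ H ↔ h.1 ∈ commutant G)
    (hG : Subgroup.centralizer (H : Set (OGrp n)) = G)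
    {V W : Submodule ℝ (EuclideanSpace ℝ (Fin n))} (hV : IsFactorSpace H V)
    (hW : IsFactorSpace H W) (hne : V ≠ W) {w : EuclideanSpace ℝ (Fin n)} (hw : w ∈ W) :
    Matrix.toEuclideanLin (projMatrix V) w = 0 := by
  have hP := projMatrix_isProjIn hV.2.1.1
  have hPG := projMatrix_isProjIn hV.2.1.2
  rw [hG] at hPG
  set P := projMatrix V with hPdef
  -- The reflection $1-2P$ is itself an element of $H$, so it preserves $W$.
  have hPW : ∀ w ∈ W, Matrix.toEuclideanLin P w ∈ W := by
    intro w hw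
    obtain ⟨g, hg, hgP⟩ := hPG.exists_reflection
    have h1 := hW.2.1.1 g ((hH g).mpr hg) w hw
    rw [hgP, map_sub, map_smul, LinearMap.sub_apply, LinearMap.smul_apply, toEuclideanLin_one] at h1
    have h2 := W.smul_mem (2 : ℝ)⁻¹ (W.sub_mem hw h1)
    rwa [sub_sub_cancel, smul_smul, inv_mul_cancel₀ two_ne_zero, one_smul] at h2
  -- This subspace is biinvariant, hence $0$ or $W$. If it were $0$, then $W\le V$, which
  -- contradicts the irreducibility of $V$.
  set W' : Submodule ℝ (EuclideanSpace ℝ (Fin n)) := W ⊓ LinearMap.ker (Matrix.toEuclideanLin P)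
    with hW'
  have hbi : IsBiinvariant H W' := by
    refine ⟨fun h hh v hv => ⟨hW.2.1.1 h hh v hv.1, ?_⟩, fun h hh v hv =>
      ⟨hW.2.1.2 h hh v hv.1, ?_⟩⟩
    · rw [SetLike.mem_coe, LinearMap.mem_ker, ← toEuclideanLin_mul, ← mem_commutant.mp hP.mem h hh,
        toEuclideanLin_mul, LinearMap.mem_ker.mp hv.2, map_zero]
    · rw [hG] at hh
      rw [SetLike.mem_coe, LinearMap.mem_ker, ← toEuclideanLin_mul,
        ← mem_commutant.mp hPG.mem h hh, toEuclideanLin_mul, LinearMap.mem_ker.mp hv.2, map_zero]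
  rcases hW.2.2 W' inf_le_left hbi with h | h
  · exfalso
    have hle : W ≤ V := by
      intro v hv
      have h1 : v - Matrix.toEuclideanLin P v ∈ W' := by
        refine ⟨W.sub_mem hv (hPW v hv), ?_⟩
        rw [SetLike.mem_coe, LinearMap.mem_ker, map_sub, ← toEuclideanLin_mul, hP.mul_self,
          sub_self]
      rw [h, Submodule.mem_bot, sub_eq_zero] at h1
      exact projMatrix_apply_eq_self_iff.mp h1.symm
    rcases hV.2.2 W hle hW.2.1 with h' | h'
    · exact hW.1 h'
    · exact hne h'.symm
  · have := hw
    rw [← h] at this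
    exact LinearMap.mem_ker.mp this.2

/-- If every rotation which commutes with the elements `g` of `H` without eigenvalue `-1` commutes
with `H`, then `H` contains no double factor `O(1)_k × O(1)_l`. -/
theorem not_hasDoubleOFactor_one (hH : ∀ h, h ∈ H ↔ h.1 ∈ commutant G)
    (hG : Subgroup.centralizer (H : Set (OGrp n)) = G)
    (hz : ∀ z : SOGrp n, (∀ g ∈ H, (1 + g.1).det ≠ 0 → Commute z.1 g.1) →
      ∀ g ∈ H, Commute z.1 g.1) : ¬ HasDoubleOFactor H 1 := by
  rintro ⟨V, W, k, l, hk, hl, hne, hV, hW⟩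
  obtain ⟨v, hv, hv0⟩ := Submodule.exists_mem_ne_zero_of_ne_bot hV.1.1
  obtain ⟨w, hw, hw0⟩ := Submodule.exists_mem_ne_zero_of_ne_bot hW.1.1
  have hPw := hV.1.projMatrix_apply_eq_zero hH hG hW.1 hne hw
  have hPG := projMatrix_isProjIn hV.1.2.1.2
  rw [hG] at hPG
  obtain ⟨g, hg, hgP⟩ := hPG.exists_reflection
  have hPv : Matrix.toEuclideanLin (projMatrix V) v = v := projMatrix_apply_eq_self_iff.mpr hv
  set P := projMatrix V with hPdef
  have hvw : v + w ≠ 0 := by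
    intro h
    have h1 := congrArg (Matrix.toEuclideanLin P) h
    rw [map_add, hPv, hPw, add_zero, map_zero] at h1
    exact hv0 h1
  have hA := projMatrix_span_isProjIn v
  have hB := projMatrix_span_isProjIn (v + w)
  have hfr : ∀ x : EuclideanSpace ℝ (Fin n), x ≠ 0 →
      Module.finrank ℝ (Submodule.span ℝ {x})ᗮ + 1 = n := by
    intro x hx
    have := (Submodule.span ℝ {x}).finrank_add_finrank_orthogonal
    rw [finrank_span_singleton hx, finrank_euclideanSpace, Fintype.card_fin] at this
    omega
  have hdA := det_two_projMatrix_sub_one (Submodule.span ℝ {v})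
  have hdB := det_two_projMatrix_sub_one (Submodule.span ℝ {v + w})
  have hinv : ∀ {x : EuclideanSpace ℝ (Fin n)} {p : Matrix (Fin n) (Fin n) ℝ},
      IsProjIn (vectorStabilizer x) p → ((2 : ℝ) • p - 1) * ((2 : ℝ) • p - 1) = 1 ∧
        ((2 : ℝ) • p - 1)ᵀ = (2 : ℝ) • p - 1 := by
    intro x p hp
    refine ⟨?_, by rw [Matrix.transpose_sub, Matrix.transpose_smul, hp.symm, Matrix.transpose_one]⟩
    simp only [sub_mul, mul_sub, one_mul, mul_one, smul_mul_assoc, mul_smul_comm, hp.mul_self]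
    simp only [two_smul]
    abel
  set A := projMatrix (Submodule.span ℝ {v}) with hAdef
  set B := projMatrix (Submodule.span ℝ {v + w}) with hBdef
  obtain ⟨hA1, hA2⟩ := hinv hA
  obtain ⟨hB1, hB2⟩ := hinv hB
  -- This is the product of the reflections that fix the lines through $v$ and $v+w$, a rotation
  -- mixing $V$ and $W$. Elements without eigenvalue $-1$ fix $v$ and $w$, hence commute with it.
  let z : SOGrp n := ⟨((2 : ℝ) • B - 1) * ((2 : ℝ) • A - 1),
    Matrix.mem_specialOrthogonalGroup_iff.mpr ⟨(Matrix.mem_orthogonalGroup_iff _ _).mpr (by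
      rw [Matrix.transpose_mul, hA2, hB2, mul_assoc, ← mul_assoc ((2 : ℝ) • A - 1), hA1, one_mul,
        hB1]), by
      rw [Matrix.det_mul, hdA, hdB, ← pow_add,
        show Module.finrank ℝ (Submodule.span ℝ {v + w})ᗮ = Module.finrank ℝ (Submodule.span ℝ {v})ᗮ
          by have := hfr v hv0; have := hfr _ hvw; omega]
      exact Even.neg_one_pow ⟨_, rfl⟩⟩⟩
  have hcomm := hz z (by
    intro h hh hd
    have h1 := isOFactor_one_apply hk hV hh hd hv
    have h2 := isOFactor_one_apply hl hW hh hd hw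
    have c1 : Commute A h.1 := (mem_commutant.mp hA.mem h h1).symm
    have c2 : Commute B h.1 := (mem_commutant.mp hB.mem h (by
      show Matrix.toEuclideanLin h.1 (v + w) = v + w
      rw [map_add, h1, h2])).symm
    exact ((c2.smul_left _).sub_left (Commute.one_left _)).mul_left
      ((c1.smul_left _).sub_left (Commute.one_left _))) g ((hH g).mpr hg)
  rw [hgP] at hcomm
  have c3 : Commute z.1 P := by
    have h2 := (Commute.one_right z.1).sub_right hcomm
    rw [sub_sub_cancel] at h2
    simpa using h2.smul_right (2 : ℝ)⁻¹
  have hPA : P * A = A := mul_eq_of_fixedSpace_le hA.mul_self (by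
    rw [hAdef, hPdef, fixedSpace_projMatrix, fixedSpace_projMatrix, Submodule.span_singleton_le_iff_mem]
    exact hv)
  have hAP : A * P = A := by
    have := congrArg Matrix.transpose hPA
    rwa [Matrix.transpose_mul, hA.symm, hPG.symm] at this
  have c4 : Commute ((2 : ℝ) • A - 1) P :=
    (Commute.smul_left (hAP.trans hPA.symm) _).sub_left (Commute.one_left _)
  -- The factor $2A-1$ commutes with $P$ and can be cancelled from $z$. Commutation of $B$ with $P$
  -- then puts $v$ on the line of $v+w$, and this forces $w=0$.
  have c5 : Commute B P := by
    have h1 : Commute ((2 : ℝ) • B - 1) P := by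
      have := c3.mul_left c4
      simp only [z] at this
      rwa [mul_assoc, hA1, mul_one] at this
    have h2 := h1.add_left (Commute.one_left P)
    rw [sub_add_cancel] at h2
    simpa using h2.smul_left (2 : ℝ)⁻¹
  have hBvw : Matrix.toEuclideanLin B (v + w) = v + w :=
    projMatrix_apply_eq_self_iff.mpr (Submodule.mem_span_singleton_self _)
  have h6 := congrArg (fun x => Matrix.toEuclideanLin x (v + w)) c5.eq
  simp only [toEuclideanLin_mul] at h6
  rw [hBvw, map_add, hPv, hPw, add_zero] at h6
  obtain ⟨c, hc⟩ := Submodule.mem_span_singleton.mp (projMatrix_apply_eq_self_iff.mp h6)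
  have h7 := congrArg (Matrix.toEuclideanLin P) hc
  rw [map_smul, map_add, hPv, hPw, add_zero] at h7
  have hc1 : c = 1 := smul_left_injective ℝ hv0 (by simpa using h7)
  rw [hc1, one_smul] at hc
  exact hw0 (by simpa using hc)

end FactorObstruction

/-! ### The Howe subgroup generated by the Lie algebra -/

section LieCentralizer

variable {n : ℕ}

theorem SOGrp.coe_mul (g h : SOGrp n) : (g * h).1 = g.1 * h.1 := rfl

theorem SOGrp.mul_transpose (g : SOGrp n) : g.1 * g.1ᵀ = 1 := (inclSO n g).mul_transpose

theorem SOGrp.transpose_mul (g : SOGrp n) : g.1ᵀ * g.1 = 1 := (inclSO n g).transpose_mul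

/-- The centralizer in `O(n)` of a subgroup of `SO(n)`. -/
def orthCentralizer (H : Subgroup (SOGrp n)) : Subgroup (OGrp n) :=
  Subgroup.centralizer (H.map (inclSO n) : Set (OGrp n))

theorem mem_howeHull_iff (H : Subgroup (SOGrp n)) (h : OGrp n) :
    h ∈ howeHull (H.map (inclSO n)) ↔ h.1 ∈ commutant (orthCentralizer H) :=
  coe_mem_commutant_iff.symm

theorem centralizer_howeHull (H : Subgroup (SOGrp n)) :
    Subgroup.centralizer (howeHull (H.map (inclSO n)) : Set (OGrp n)) = orthCentralizer H :=
  le_antisymm (Subgroup.centralizer_le (le_howeHull _)) (le_howeHull (orthCentralizer H))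

theorem inclSO_mem_orthCentralizer {H : Subgroup (SOGrp n)} {z : SOGrp n} :
    inclSO n z ∈ orthCentralizer H ↔ ∀ h ∈ H, Commute z.1 h.1 := by
  rw [orthCentralizer, Subgroup.mem_centralizer_iff]
  constructor
  · intro h g hg
    exact (congrArg Subtype.val (h _ (Subgroup.mem_map_of_mem _ hg))).symm
  · rintro h _ ⟨g, hg, rfl⟩
    exact Subtype.ext (h g hg).symm.eq

theorem SOGrp.mem_centralizer_iff {S : Subgroup (SOGrp n)} {z : SOGrp n} :
    z ∈ Subgroup.centralizer (S : Set (SOGrp n)) ↔ ∀ h ∈ S, Commute z.1 h.1 := by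
  rw [Subgroup.mem_centralizer_iff]
  exact forall₂_congr fun h _ => ⟨fun e => (congrArg Subtype.val e).symm,
    fun e => Subtype.ext e.symm.eq⟩

/-- The centralizer of $H$ in $\mathrm{SO}(n)$ is part of the one in $\mathrm O(n)$. A rotation
commuting with the latter thus lies in the double centralizer inside $\mathrm{SO}(n)$, which is $H$.
So membership in $H$ becomes a linear condition. -/
theorem IsHowe.mem_iff {H : Subgroup (SOGrp n)} (hH : IsHowe H) {h : SOGrp n} :
    h ∈ H ↔ h.1 ∈ commutant (orthCentralizer H) := by
  constructor
  · intro hh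
    exact (mem_howeHull_iff H (inclSO n h)).mp (le_howeHull _ (Subgroup.mem_map_of_mem _ hh))
  · intro hh
    rw [← hH, howeHull, SOGrp.mem_centralizer_iff]
    intro c hc
    rw [SOGrp.mem_centralizer_iff] at hc
    exact (mem_commutant.mp hh (inclSO n c) (inclSO_mem_orthCentralizer.mpr hc)).symm

/-- The elements of `SO(n)` which commute with the Lie algebra of the Howe subgroup `H`. -/
def lieCentralizer (H : Subgroup (SOGrp n)) : Subgroup (SOGrp n) where
  carrier := {z | ∀ X ∈ skewCommutant (orthCentralizer H), Commute z.1 X}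
  mul_mem' hy hz X hX := (hy X hX).mul_left (hz X hX)
  one_mem' X _ := Commute.one_left X
  inv_mem' {z} hz X hX := by
    have h := hz X hX
    show z.1ᵀ * X = X * z.1ᵀ
    calc z.1ᵀ * X = z.1ᵀ * (X * z.1) * z.1ᵀ := by
          rw [mul_assoc, mul_assoc, SOGrp.mul_transpose, mul_one]
      _ = (z.1ᵀ * z.1) * X * z.1ᵀ := by rw [← h.eq]; simp only [mul_assoc]
      _ = X * z.1ᵀ := by rw [SOGrp.transpose_mul, one_mul]

/-- The Howe subgroup generated by the identity component of the Howe subgroup `H`. -/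
def lieHull (H : Subgroup (SOGrp n)) : Subgroup (SOGrp n) :=
  Subgroup.centralizer (lieCentralizer H : Set (SOGrp n))

theorem isHowe_lieHull (H : Subgroup (SOGrp n)) : IsHowe (lieHull H) :=
  le_antisymm (Subgroup.centralizer_le (le_howeHull (lieCentralizer H))) (le_howeHull _)

theorem centralizer_le_lieCentralizer (H : Subgroup (SOGrp n)) :
    Subgroup.centralizer (H : Set (SOGrp n)) ≤ lieCentralizer H := by
  intro c hc X hX
  rw [SOGrp.mem_centralizer_iff] at hc
  exact mem_commutant.mp hX.1 (inclSO n c) (inclSO_mem_orthCentralizer.mpr hc)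

theorem lieHull_le {H : Subgroup (SOGrp n)} (hH : IsHowe H) : lieHull H ≤ H :=
  (Subgroup.centralizer_le (centralizer_le_lieCentralizer H)).trans hH.le

/-- Such an $h$ is recovered from a skew element of the commutant by the Cayley transform. The
determinant condition is open and holds at $1$, so `lieHull H` is open in $H$; this makes the coset
space discrete. -/
theorem mem_lieHull_of_det_ne_zero {H : Subgroup (SOGrp n)} (hH : IsHowe H) {h : SOGrp n}
    (hh : h ∈ H) (hd : (1 + h.1).det ≠ 0) : h ∈ lieHull H := by
  rw [lieHull, SOGrp.mem_centralizer_iff]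
  obtain ⟨Y, hY, hc⟩ := exists_skew_of_det_ne_zero (g := inclSO n h) (hH.mem_iff.mp hh) hd
  intro z hz
  exact (hc z.1 (hz Y hY)).symm

/-- The Howe subgroup `H` is generated by its identity component if and only if the corresponding
Howe subgroup of `O(n)` contains neither a factor `O(2)_k` nor a double factor
`O(1)_k × O(1)_l`. -/
theorem le_lieHull_iff {H : Subgroup (SOGrp n)} (hH : IsHowe H) :
    H ≤ lieHull H ↔ ¬ HasOFactor (howeHull (H.map (inclSO n))) 2 ∧
      ¬ HasDoubleOFactor (howeHull (H.map (inclSO n))) 1 := by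
  constructor
  · intro hle
    -- Through the Cayley transform, commuting with the Lie algebra is tested on the elements of the
    -- hull without eigenvalue $-1$.
    have key : ∀ z : SOGrp n, (∀ g ∈ howeHull (H.map (inclSO n)), (1 + g.1).det ≠ 0 →
        Commute z.1 g.1) → ∀ g ∈ howeHull (H.map (inclSO n)), Commute z.1 g.1 := by
      intro z hz g hg
      have hzZ : z ∈ lieCentralizer H := by
        intro X hX
        obtain ⟨g, hg, hd, hc⟩ := exists_orthogonal_of_skew hX
        exact hc z.1 (hz g ((mem_howeHull_iff H g).mpr hg) hd)
      have hzG : inclSO n z ∈ orthCentralizer H := by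
        rw [inclSO_mem_orthCentralizer]
        intro h hh
        exact (SOGrp.mem_centralizer_iff.mp (hle hh) z hzZ).symm
      exact mem_commutant.mp ((mem_howeHull_iff H g).mp hg) _ hzG
    exact ⟨not_hasOFactor_two key,
      not_hasDoubleOFactor_one (mem_howeHull_iff H) (centralizer_howeHull H) key⟩
  · rintro ⟨h2, h1⟩ h hh
    rw [lieHull, SOGrp.mem_centralizer_iff]
    intro z hz
    exact (commute_of_no_factors (mem_howeHull_iff H) (centralizer_howeHull H) h2 h1 hz
      (hH.mem_iff.mp hh)).symm

end LieCentralizer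

/-! ### Calculus of matrix-valued functions and curves -/

section MatrixCalculus

variable {n d : ℕ} {M : Type*} [TopologicalSpace M] [ChartedSpace (EuclideanSpace ℝ (Fin d)) M]

variable (d) in
/-- The matrix-valued function `f` is differentiable at `x`. -/
def MatDiffAt (f : M → Matrix (Fin n) (Fin n) ℝ) (x : M) : Prop :=
  ∀ a b, MDifferentiableAt (𝓡 d) 𝓘(ℝ, ℝ) (fun y => f y a b) x

/-- The derivative of a matrix-valued function. -/
def matDeriv (f : M → Matrix (Fin n) (Fin n) ℝ) (x : M) (v : TangentSpace (𝓡 d) x) :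
    Matrix (Fin n) (Fin n) ℝ :=
  Matrix.of fun a b => (mfderiv (𝓡 d) 𝓘(ℝ, ℝ) (fun y => f y a b) x v : ℝ)

theorem matDeriv_apply (f : M → Matrix (Fin n) (Fin n) ℝ) (x : M) (v : TangentSpace (𝓡 d) x)
    (a b : Fin n) :
    matDeriv f x v a b = (mfderiv (𝓡 d) 𝓘(ℝ, ℝ) (fun y => f y a b) x v : ℝ) := rfl

variable {f g : M → Matrix (Fin n) (Fin n) ℝ} {x : M}

theorem matDeriv_congr (h : g =ᶠ[nhds x] f) (v : TangentSpace (𝓡 d) x) :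
    matDeriv g x v = matDeriv f x v := by
  ext a b
  rw [matDeriv_apply, matDeriv_apply]
  have : (fun y => g y a b) =ᶠ[nhds x] fun y => f y a b := h.mono fun y hy => by simp only [hy]
  rw [this.mfderiv_eq]
  rfl

theorem matDiffAt_const (c : Matrix (Fin n) (Fin n) ℝ) : MatDiffAt d (fun _ : M => c) x :=
  fun _ _ => mdifferentiableAt_const

theorem matDeriv_const (c : Matrix (Fin n) (Fin n) ℝ) (v : TangentSpace (𝓡 d) x) :
    matDeriv (fun _ : M => c) x v = 0 := by
  ext a b
  rw [matDeriv_apply, mfderiv_const]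
  rfl

theorem MatDiffAt.transpose (hf : MatDiffAt d f x) : MatDiffAt d (fun y => (f y)ᵀ) x :=
  fun a b => hf b a

theorem matDeriv_transpose (f : M → Matrix (Fin n) (Fin n) ℝ) (v : TangentSpace (𝓡 d) x) :
    matDeriv (fun y => (f y)ᵀ) x v = (matDeriv f x v)ᵀ := rfl

theorem MatDiffAt.hasMFDerivAt_mul (hf : MatDiffAt d f x) (hg : MatDiffAt d g x) (a b : Fin n) :
    ∃ D : TangentSpace (𝓡 d) x →L[ℝ] ℝ,
      HasMFDerivAt (𝓡 d) 𝓘(ℝ, ℝ) (fun y => (f y * g y) a b) x D ∧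
      ∀ v, D v = ∑ k, (matDeriv f x v a k * g x k b + f x a k * matDeriv g x v k b) := by
  have h := HasMFDerivAt.sum (t := Finset.univ) (fun k _ =>
    (hf a k).hasMFDerivAt.mul (hg k b).hasMFDerivAt)
  have e : (∑ k, (fun y => f y a k) * fun y => g y k b) = fun y => (f y * g y) a b := by
    funext y
    simp [Matrix.mul_apply]
  rw [e] at h
  refine ⟨_, h, fun v => ?_⟩
  rw [_root_.sum_apply]
  exact Finset.sum_congr rfl fun k _ =>
    (add_comm _ _).trans (congrArg₂ (· + ·) (mul_comm _ _) rfl)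

theorem MatDiffAt.mul (hf : MatDiffAt d f x) (hg : MatDiffAt d g x) :
    MatDiffAt d (fun y => f y * g y) x := fun a b => by
  obtain ⟨D, hD, -⟩ := hf.hasMFDerivAt_mul hg a b
  exact hD.mdifferentiableAt

theorem matDeriv_mul (hf : MatDiffAt d f x) (hg : MatDiffAt d g x) (v : TangentSpace (𝓡 d) x) :
    matDeriv (fun y => f y * g y) x v = matDeriv f x v * g x + f x * matDeriv g x v := by
  ext a b
  obtain ⟨D, hD, hDv⟩ := hf.hasMFDerivAt_mul hg a b
  rw [matDeriv_apply, hD.mfderiv]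
  refine (hDv v).trans ?_
  rw [Finset.sum_add_distrib]
  rfl

/-- The matrix-valued curve `f` has derivative `f'` at `t` within `s`. -/
def HasMatDerivWithinAt (f : ℝ → Matrix (Fin n) (Fin n) ℝ) (f' : Matrix (Fin n) (Fin n) ℝ)
    (s : Set ℝ) (t : ℝ) : Prop :=
  ∀ a b, HasDerivWithinAt (fun τ => f τ a b) (f' a b) s t

theorem HasMatDerivWithinAt.mul {f g : ℝ → Matrix (Fin n) (Fin n) ℝ}
    {f' g' : Matrix (Fin n) (Fin n) ℝ} {s : Set ℝ} {t : ℝ} (hf : HasMatDerivWithinAt f f' s t)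
    (hg : HasMatDerivWithinAt g g' s t) :
    HasMatDerivWithinAt (fun τ => f τ * g τ) (f' * g t + f t * g') s t := by
  intro a b
  have h := HasDerivWithinAt.fun_sum (u := Finset.univ) (fun k _ => (hf a k).mul (hg k b))
  rw [Matrix.add_apply, Matrix.mul_apply, Matrix.mul_apply, ← Finset.sum_add_distrib]
  exact h

theorem HasMatDerivWithinAt.transpose {f : ℝ → Matrix (Fin n) (Fin n) ℝ}
    {f' : Matrix (Fin n) (Fin n) ℝ} {s : Set ℝ} {t : ℝ} (hf : HasMatDerivWithinAt f f' s t) :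
    HasMatDerivWithinAt (fun τ => (f τ)ᵀ) f'ᵀ s t :=
  fun a b => hf b a

theorem hasMatDerivWithinAt_const (c : Matrix (Fin n) (Fin n) ℝ) (s : Set ℝ) (t : ℝ) :
    HasMatDerivWithinAt (fun _ => c) 0 s t :=
  fun a b => hasDerivWithinAt_const t s (c a b)

theorem HasMatDerivWithinAt.congr {f g : ℝ → Matrix (Fin n) (Fin n) ℝ}
    {f' : Matrix (Fin n) (Fin n) ℝ} {s : Set ℝ} {t : ℝ} (hf : HasMatDerivWithinAt f f' s t)
    (h : g =ᶠ[nhdsWithin t s] f) (ht : t ∈ s) : HasMatDerivWithinAt g f' s t := fun a b =>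
  (hf a b).congr_of_eventuallyEq_of_mem (h.mono fun y hy => by simp only [hy]) ht

theorem HasMatDerivWithinAt.continuousWithinAt {f : ℝ → Matrix (Fin n) (Fin n) ℝ}
    {f' : Matrix (Fin n) (Fin n) ℝ} {s : Set ℝ} {t : ℝ} (hf : HasMatDerivWithinAt f f' s t) :
    ContinuousWithinAt f s t :=
  continuousWithinAt_pi.mpr fun a => continuousWithinAt_pi.mpr fun b => (hf a b).continuousWithinAt

theorem eq_of_hasMatDerivWithinAt_zero {f : ℝ → Matrix (Fin n) (Fin n) ℝ}
    (hf : ∀ t ∈ Set.Icc (0 : ℝ) 1, HasMatDerivWithinAt f 0 (Set.Icc 0 1) t) {t : ℝ}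
    (ht : t ∈ Set.Icc (0 : ℝ) 1) : f t = f 0 := by
  ext a b
  exact constant_of_derivWithin_zero (fun τ hτ => (hf τ hτ a b).differentiableWithinAt)
    (fun τ hτ => (hf τ (Set.Ico_subset_Icc_self hτ) a b).derivWithin
      (uniqueDiffOn_Icc zero_lt_one τ (Set.Ico_subset_Icc_self hτ))) t ht

theorem MatDiffAt.comp_curve {γ : ℝ → M} {s : Set ℝ} {t : ℝ} (hf : MatDiffAt d f (γ t))
    (hγ : MDifferentiableWithinAt 𝓘(ℝ, ℝ) (𝓡 d) γ s t) :
    HasMatDerivWithinAt (fun τ => f (γ τ))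
      (matDeriv f (γ t) (mfderivWithin 𝓘(ℝ, ℝ) (𝓡 d) γ s t (1 : ℝ))) s t := by
  intro a b
  have h := (hf a b).hasMFDerivAt.comp_hasMFDerivWithinAt t hγ.hasMFDerivWithinAt
  let D : ℝ →L[ℝ] ℝ := (mfderiv (𝓡 d) 𝓘(ℝ, ℝ) (fun y => f y a b) (γ t)).comp
    (mfderivWithin 𝓘(ℝ, ℝ) (𝓡 d) γ s t)
  have h' : HasFDerivWithinAt (fun τ => f (γ τ) a b) D s t :=
    hasMFDerivWithinAt_iff_hasFDerivWithinAt.mp h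
  exact h'.hasDerivWithinAt

end MatrixCalculus

/-! ### Translations between points of a fibre, and smooth sections -/

namespace PrincipalSOBundle

variable {n d : ℕ} {M : Type*} [TopologicalSpace M] [ChartedSpace (EuclideanSpace ℝ (Fin d)) M]
  {P : Type*} (B : PrincipalSOBundle n d M P)

/-- The element of the structure group which carries `u` to `v`, for `u` and `v` in the same
fibre. -/
def translation (u v : P) : SOGrp n :=
  open Classical in if h : B.proj u = B.proj v then (B.act_transitive u v h).choose else 1

theorem act_translation {u v : P} (h : B.proj u = B.proj v) : B.act u (B.translation u v) = v := by
  rw [translation, dif_pos h]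
  exact (B.act_transitive u v h).choose_spec

theorem act_injective {u : P} {g h : SOGrp n} (e : B.act u g = B.act u h) : g = h := by
  have h1 : B.act u (g * h⁻¹) = u := by
    rw [B.act_mul, e, ← B.act_mul, mul_inv_cancel, B.act_one]
  exact mul_inv_eq_one.mp (B.act_free u _ h1)

theorem translation_act (u : P) (g : SOGrp n) : B.translation u (B.act u g) = g :=
  B.act_injective (B.act_translation (B.proj_act u g).symm)

theorem translation_self (u : P) : B.translation u u = 1 := by
  conv_lhs => rw [← B.act_one u, B.act_one u]
  have := B.translation_act u 1
  rwa [B.act_one] at this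

theorem translation_mul {u v w : P} (h : B.proj u = B.proj v) (h' : B.proj v = B.proj w) :
    B.translation u v * B.translation v w = B.translation u w := by
  apply B.act_injective (u := u)
  rw [B.act_mul, B.act_translation h, B.act_translation h', B.act_translation (h.trans h')]

theorem translation_act_right {u v : P} (h : B.proj u = B.proj v) (g : SOGrp n) :
    B.translation u (B.act v g) = B.translation u v * g := by
  rw [← B.translation_mul h (B.proj_act v g).symm, B.translation_act]

theorem translation_inv {u v : P} (h : B.proj u = B.proj v) :
    (B.translation u v)⁻¹ = B.translation v u := by
  rw [inv_eq_iff_mul_eq_one, B.translation_mul h h.symm, B.translation_self]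

theorem translation_transpose {u v : P} (h : B.proj u = B.proj v) :
    (B.translation u v).1ᵀ = (B.translation v u).1 := by
  rw [← B.translation_inv h]
  rfl

theorem translation_coe_mul {u v w : P} (h : B.proj u = B.proj v) (h' : B.proj v = B.proj w) :
    (B.translation u v).1 * (B.translation v w).1 = (B.translation u w).1 := by
  rw [← B.translation_mul h h']
  rfl

variable {B}

theorem IsSmoothSection.smooth_translation_sec {U : Set M} {s : M → P} (hs : B.IsSmoothSection U s)
    (i : B.ι) : SmoothIntoSO (d := d) (fun x => B.translation (B.sec i x) (s x)) (B.dom i ∩ U) := by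
  obtain ⟨g, hg, hsm⟩ := hs.2.2 i
  intro a b
  refine (hsm a b).congr fun x hx => ?_
  simp only [← hg x hx, B.translation_act]

theorem isSmoothSection_sec (i : B.ι) : B.IsSmoothSection (B.dom i) (B.sec i) :=
  ⟨B.isOpen_dom i, B.proj_sec i, fun j => ⟨B.transition j i, B.sec_transition j i,
    B.smooth_transition j i⟩⟩

theorem IsSmoothSection.smooth_translation {U U' : Set M} {s s' : M → P}
    (hs : B.IsSmoothSection U s) (hs' : B.IsSmoothSection U' s') :
    SmoothIntoSO (d := d) (fun x => B.translation (s x) (s' x)) (U ∩ U') := by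
  intro a b x hx
  obtain ⟨i, hi⟩ := B.cover x
  have hopen : IsOpen (B.dom i ∩ (U ∩ U')) := (B.isOpen_dom i).inter (hs.1.inter hs'.1)
  have hmem : x ∈ B.dom i ∩ (U ∩ U') := ⟨hi, hx⟩
  have h1 : ContMDiffOn (𝓡 d) 𝓘(ℝ, ℝ) ∞ (fun x => ∑ k, (B.translation (B.sec i x) (s x)).1 k a *
      (B.translation (B.sec i x) (s' x)).1 k b) (B.dom i ∩ (U ∩ U')) := by
    refine contMDiffOn_finsetSum fun k _ => ?_
    exact ((hs.smooth_translation_sec i k a).mono fun y hy => ⟨hy.1, hy.2.1⟩).mul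
      ((hs'.smooth_translation_sec i k b).mono fun y hy => ⟨hy.1, hy.2.2⟩)
  have h2 : ContMDiffAt (𝓡 d) 𝓘(ℝ, ℝ) ∞ (fun x => (B.translation (s x) (s' x)).1 a b) x := by
    refine (h1.contMDiffAt (hopen.mem_nhds hmem)).congr_of_eventuallyEq ?_
    filter_upwards [hopen.mem_nhds hmem] with y hy
    have e1 : B.proj (B.sec i y) = B.proj (s y) := by
      rw [B.proj_sec i y hy.1, hs.2.1 y hy.2.1]
    have e2 : B.proj (B.sec i y) = B.proj (s' y) := by
      rw [B.proj_sec i y hy.1, hs'.2.1 y hy.2.2]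
    rw [← B.translation_coe_mul e1.symm e2, ← B.translation_transpose e1, Matrix.mul_apply]
    rfl
  exact h2.contMDiffWithinAt

theorem IsSmoothSection.matDiffAt_translation {U U' : Set M} {s s' : M → P}
    (hs : B.IsSmoothSection U s) (hs' : B.IsSmoothSection U' s') {x : M} (hx : x ∈ U ∩ U') :
    MatDiffAt d (fun x => (B.translation (s x) (s' x)).1) x := fun a b =>
  ((hs.smooth_translation hs' a b).contMDiffAt ((hs.1.inter hs'.1).mem_nhds hx)).mdifferentiableAt
    (by simp)

theorem IsSmoothSection.mul_right {U : Set M} {s : M → P} (hs : B.IsSmoothSection U s)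
    (h : SOGrp n) : B.IsSmoothSection U fun x => B.act (s x) h := by
  refine ⟨hs.1, fun x hx => by rw [B.proj_act, hs.2.1 x hx], fun i => ?_⟩
  obtain ⟨g, hg, hsm⟩ := hs.2.2 i
  refine ⟨fun x => g x * h, fun x hx => by rw [B.act_mul, hg x hx], fun a b => ?_⟩
  have : ContMDiffOn (𝓡 d) 𝓘(ℝ, ℝ) ∞ (fun x => ∑ k, (g x).1 a k * h.1 k b) (B.dom i ∩ U) :=
    contMDiffOn_finsetSum fun k _ => (hsm a k).mul contMDiffOn_const
  refine this.congr fun x _ => ?_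
  rw [SOGrp.coe_mul, Matrix.mul_apply]

theorem IsSmoothSection.mono {U U' : Set M} {s : M → P} (hs : B.IsSmoothSection U s)
    (hU' : IsOpen U') (h : U' ⊆ U) : B.IsSmoothSection U' s :=
  ⟨hU', fun x hx => hs.2.1 x (h hx), fun i => by
    obtain ⟨g, hg, hsm⟩ := hs.2.2 i
    exact ⟨g, fun x hx => hg x ⟨hx.1, h hx.2⟩, fun a b =>
      (hsm a b).mono fun x hx => ⟨hx.1, h hx.2⟩⟩⟩

end PrincipalSOBundle

/-! ### Connections compatible with a Howe subbundle, and horizontal curves -/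

theorem conj_eq_of_mem {n : ℕ} {H : Subgroup (SOGrp n)} (hH : IsHowe H) {g : SOGrp n} (hg : g ∈ H) {c : OGrp n}
    (hc : c ∈ orthCentralizer H) : g.1ᵀ * c.1 * g.1 = c.1 := by
  have := mem_commutant.mp (hH.mem_iff.mp hg) c hc
  rw [mul_assoc, this, ← mul_assoc, SOGrp.transpose_mul, one_mul]

/-- Together with `conj_eq_of_mem` this describes $H$ as the stabilizer, under conjugation, of the
elements of its centralizer in $\mathrm O(n)$. Lying in $Q$ thus means that certain matrix functions
have the prescribed values $c$, and this can be checked by differentiation. -/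
theorem mem_of_conj_eq {n : ℕ} {H : Subgroup (SOGrp n)} (hH : IsHowe H) {g : SOGrp n}
    (hg : ∀ c ∈ orthCentralizer H, g.1ᵀ * c.1 * g.1 = c.1) : g ∈ H := by
  rw [hH.mem_iff, mem_commutant]
  intro c hc
  conv_rhs => rw [← hg c hc]
  rw [mul_assoc, ← mul_assoc g.1, SOGrp.mul_transpose, one_mul]

namespace PrincipalSOBundle

variable {n d : ℕ} {M : Type*} [TopologicalSpace M] [ChartedSpace (EuclideanSpace ℝ (Fin d)) M]
  {P : Type*} {B : PrincipalSOBundle n d M P} {H : Subgroup (SOGrp n)} {Q : Set P}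

theorem IsReduction.translation_mem (hQ : B.IsReduction H Q) {u v : P} (hu : u ∈ Q) (hv : v ∈ Q)
    (h : B.proj u = B.proj v) : B.translation u v ∈ H := by
  obtain ⟨g, hg, rfl⟩ := hQ.2.1 u hu v hv h
  rwa [B.translation_act]

theorem IsReduction.mem_of_translation_mem (hQ : B.IsReduction H Q) {u v : P} (hu : u ∈ Q)
    (h : B.proj u = B.proj v) (hg : B.translation u v ∈ H) : v ∈ Q := by
  rw [← B.act_translation h]
  exact hQ.1 u hu _ hg

/-- A smooth section over `U` with values in `Q`. -/
def IsSectionIn (B : PrincipalSOBundle n d M P) (Q : Set P) (U : Set M) (s : M → P) : Prop :=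
  B.IsSmoothSection U s ∧ ∀ x ∈ U, s x ∈ Q

variable [IsManifold (𝓡 d) ∞ M]

/-- The connection is compatible with the reduction `Q` to the centralizer of `G`: the sections
of the bundle of matrices which are given by the elements of `G` in the points of `Q` are
covariantly constant. -/
def Connection.IsCompatible (A : B.Connection) (G : Subgroup (OGrp n)) (Q : Set P) : Prop :=
  ∀ c ∈ G, ∀ U s, B.IsSectionIn Q U s → ∀ i, ∀ x ∈ U ∩ B.dom i, ∀ v : TangentSpace (𝓡 d) x,
    matDeriv (fun y => (B.translation (s y) (B.sec i y)).1ᵀ * c.1 *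
        (B.translation (s y) (B.sec i y)).1) x v =
      (B.translation (s x) (B.sec i x)).1ᵀ * c.1 * (B.translation (s x) (B.sec i x)).1 *
          A.form i x v -
        A.form i x v * ((B.translation (s x) (B.sec i x)).1ᵀ * c.1 *
          (B.translation (s x) (B.sec i x)).1)

theorem Connection.IsHorizontal.eventually_mem {A : B.Connection} {u : ℝ → P}
    (hu : A.IsHorizontal u) {t : ℝ} (ht : t ∈ Set.Icc (0 : ℝ) 1) {U : Set M} (hU : IsOpen U)
    (hx : B.proj (u t) ∈ U) : ∀ᶠ τ in nhdsWithin t (Set.Icc 0 1), B.proj (u τ) ∈ U :=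
  (hu.1 t ht).continuousWithinAt.preimage_mem_nhdsWithin (hU.mem_nhds hx)

/-- Horizontal curves which start in `Q` stay in `Q`, if the connection is compatible with the
Howe subbundle `Q`. -/
theorem Connection.IsCompatible.mem_of_horizontal {A : B.Connection} (hQ : B.IsHoweSubbundle H Q)
    (hA : A.IsCompatible (orthCentralizer H) Q) {u : ℝ → P} (hu : A.IsHorizontal u)
    (h0 : u 0 ∈ Q) {t : ℝ} (ht : t ∈ Set.Icc (0 : ℝ) 1) : u t ∈ Q := by
  choose U s hxU hs hsQ using hQ.2.2.2
  -- The section is chosen anew at each base point, so $T$ need not be continuous. Only $T^{\mathsf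
  -- T}cT$ is used, and it does not change when $T$ is multiplied by an element of $H$ on the left.
  set T : ℝ → SOGrp n := fun τ => B.translation (s (B.proj (u τ)) (B.proj (u τ))) (u τ) with hT
  have hproj : ∀ p : P, B.proj (s (B.proj p) (B.proj p)) = B.proj p := fun p =>
    (hs _).2.1 _ (hxU _)
  have hconst : ∀ c ∈ orthCentralizer H, (T t).1ᵀ * c.1 * (T t).1 = c.1 := by
    intro c hc
    have hder : ∀ t ∈ Set.Icc (0 : ℝ) 1,
        HasMatDerivWithinAt (fun τ => (T τ).1ᵀ * c.1 * (T τ).1) 0 (Set.Icc 0 1) t := by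
      intro t ht
      obtain ⟨i, hi⟩ := B.cover (B.proj (u t))
      obtain ⟨a, ha, hda⟩ := hu.2 t ht i hi
      set x := B.proj (u t) with hx
      set g : M → SOGrp n := fun y => B.translation (s x y) (B.sec i y) with hg
      have hgd : MatDiffAt d (fun y => (g y).1) x :=
        (hs x).matDiffAt_translation (isSmoothSection_sec i) ⟨hxU x, hi⟩
      have hΨ : MatDiffAt d (fun y => (g y).1ᵀ * c.1 * (g y).1) x :=
        (hgd.transpose.mul (matDiffAt_const c.1)).mul hgd
      have hγ := (hu.1 t ht).mdifferentiableWithinAt one_ne_zero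
      have h1 := hΨ.comp_curve hγ
      rw [hA c hc (U x) (s x) ⟨hs x, hsQ x⟩ i x ⟨hxU x, hi⟩] at h1
      have h2 : HasMatDerivWithinAt (fun τ => (a τ).1) _ (Set.Icc 0 1) t := hda
      have hsk := A.skew i x hi
        (mfderivWithin 𝓘(ℝ, ℝ) (𝓡 d) (fun τ => B.proj (u τ)) (Set.Icc 0 1) t (1 : ℝ))
      set θ := A.form i x
        (mfderivWithin 𝓘(ℝ, ℝ) (𝓡 d) (fun τ => B.proj (u τ)) (Set.Icc 0 1) t (1 : ℝ)) with hθ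
      have h3 := (h2.transpose.mul h1).mul h2
      have h4 : (fun τ => (T τ).1ᵀ * c.1 * (T τ).1) =ᶠ[nhdsWithin t (Set.Icc 0 1)]
          fun τ => (a τ).1ᵀ * ((g (B.proj (u τ))).1ᵀ * c.1 * (g (B.proj (u τ))).1) * (a τ).1 := by
        filter_upwards [hu.eventually_mem ht ((hs x).1.inter (B.isOpen_dom i)) ⟨hxU x, hi⟩,
          self_mem_nhdsWithin] with τ hτ hτI
        set y := B.proj (u τ) with hy
        have e1 : B.proj (s x y) = y := (hs x).2.1 y hτ.1
        have e2 : B.proj (B.sec i y) = y := B.proj_sec i y hτ.2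
        have e0 : B.proj (s y y) = y := hproj (u τ)
        have e3 : T τ = B.translation (s y y) (s x y) * (g y * a τ) := by
          have e4 : a τ = B.translation (B.sec i y) (u τ) := by
            rw [← ha τ hτI hτ.2, B.translation_act]
          rw [e4, hg, B.translation_mul (e1.trans e2.symm) e2, B.translation_mul (e0.trans e1.symm) e1]
        have e5 := conj_eq_of_mem hQ.1 (hQ.2.translation_mem (hsQ y y (hxU y)) (hsQ x y hτ.1)
          (e0.trans e1.symm)) hc
        rw [e3]
        simp only [SOGrp.coe_mul, Matrix.transpose_mul]
        conv_rhs => rw [← e5]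
        simp only [mul_assoc]
      have h5 := h3.congr h4 ht
      -- With $a'=-\theta a$ and $\Psi=g^{\mathsf T}cg$, the three terms $a^{\mathsf T}\theta\Psi
      -- a$, $a^{\mathsf T}(\Psi\theta-\theta\Psi)a$ and $-a^{\mathsf T}\Psi\theta a$ cancel.
      convert h5 using 1
      simp only [Matrix.transpose_neg, Matrix.transpose_mul, hsk]
      noncomm_ring
    have h1 := eq_of_hasMatDerivWithinAt_zero hder ht
    rw [h1]
    exact conj_eq_of_mem hQ.1 (hQ.2.translation_mem (hsQ _ _ (hxU _)) h0 (hproj _)) hc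
  exact hQ.2.mem_of_translation_mem (hsQ _ _ (hxU _)) (hproj _) (mem_of_conj_eq hQ.1 hconst)

theorem Connection.IsCompatible.holonomyBundle_subset {A : B.Connection}
    (hQ : B.IsHoweSubbundle H Q) (hA : A.IsCompatible (orthCentralizer H) Q) {u₀ : P}
    (h0 : u₀ ∈ Q) : A.holonomyBundle u₀ ⊆ Q := by
  intro v hv
  induction hv with
  | refl => exact h0
  | tail _ hstep ih =>
    obtain ⟨u, hu, rfl, rfl⟩ := hstep
    exact hA.mem_of_horizontal hQ hu ih (Set.right_mem_Icc.mpr zero_le_one)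

theorem Connection.isHorizontal_of_proj_eq {A : B.Connection} {u : ℝ → P} {γ : ℝ → M}
    (hγ : (fun t => B.proj (u t)) = γ) (h1 : ContMDiffOn 𝓘(ℝ, ℝ) (𝓡 d) 1 γ (Set.Icc 0 1))
    (h2 : ∀ t ∈ Set.Icc (0 : ℝ) 1, ∀ i, γ t ∈ B.dom i →
      ∃ a : ℝ → SOGrp n,
        (∀ τ ∈ Set.Icc (0 : ℝ) 1, γ τ ∈ B.dom i → B.act (B.sec i (γ τ)) (a τ) = u τ) ∧
        HasMatDerivWithinAt (fun τ => (a τ).1)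
          (-(A.form i (γ t) (mfderivWithin 𝓘(ℝ, ℝ) (𝓡 d) γ (Set.Icc 0 1) t (1 : ℝ)) * (a t).1))
          (Set.Icc 0 1) t) : A.IsHorizontal u := by
  subst hγ
  exact ⟨h1, h2⟩

/-- Horizontal lifts in terms of a local connection form with respect to the section `s`. -/
theorem Connection.isHorizontal_of_local {A : B.Connection} {U : Set M} {s : M → P}
    (hs : B.IsSmoothSection U s)
    (θ : (x : M) → TangentSpace (𝓡 d) x → Matrix (Fin n) (Fin n) ℝ)
    (hθ : ∀ i, ∀ x ∈ U ∩ B.dom i, ∀ v : TangentSpace (𝓡 d) x, A.form i x v =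
      (B.translation (s x) (B.sec i x)).1ᵀ * θ x v * (B.translation (s x) (B.sec i x)).1 +
        (B.translation (s x) (B.sec i x)).1ᵀ *
          matDeriv (fun y => (B.translation (s y) (B.sec i y)).1) x v)
    {γ : ℝ → M} (hγ : ContMDiff 𝓘(ℝ, ℝ) (𝓡 d) 1 γ) (hγU : ∀ t, γ t ∈ U) {b : ℝ → SOGrp n}
    (hb : ∀ t ∈ Set.Icc (0 : ℝ) 1, HasMatDerivWithinAt (fun τ => (b τ).1)
      (-(θ (γ t) (mfderiv 𝓘(ℝ, ℝ) (𝓡 d) γ t (1 : ℝ)) * (b t).1)) (Set.Icc 0 1) t) :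
    A.IsHorizontal fun t => B.act (s (γ t)) (b t) := by
  have hpr : (fun t => B.proj (B.act (s (γ t)) (b t))) = γ := by
    funext t
    rw [B.proj_act, hs.2.1 _ (hγU t)]
  refine isHorizontal_of_proj_eq hpr hγ.contMDiffOn fun t ht i hi => ?_
  set g : M → SOGrp n := fun y => B.translation (s y) (B.sec i y) with hg
  refine ⟨fun τ => (g (γ τ))⁻¹ * b τ, fun τ _ hτ => ?_, ?_⟩
  · have e : B.proj (s (γ τ)) = B.proj (B.sec i (γ τ)) := by
      rw [hs.2.1 _ (hγU τ), B.proj_sec i _ hτ]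
    rw [B.act_mul, hg, B.translation_inv e, B.act_translation e.symm]
  · have hgd : MatDiffAt d (fun y => (g y).1) (γ t) :=
      hs.matDiffAt_translation (isSmoothSection_sec i) ⟨hγU t, hi⟩
    have hγd : MDifferentiableAt 𝓘(ℝ, ℝ) (𝓡 d) γ t := (hγ t).mdifferentiableAt one_ne_zero
    have hD : mfderivWithin 𝓘(ℝ, ℝ) (𝓡 d) γ (Set.Icc 0 1) t = mfderiv 𝓘(ℝ, ℝ) (𝓡 d) γ t :=
      mfderivWithin_eq_mfderiv (uniqueDiffOn_Icc zero_lt_one t ht).uniqueMDiffWithinAt hγd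
    have h1 := hgd.comp_curve (hγd.mdifferentiableWithinAt (s := Set.Icc 0 1))
    rw [hD] at h1 ⊢
    rw [hθ i (γ t) ⟨hγU t, hi⟩]
    have h2 := h1.transpose.mul (hb t ht)
    -- Differentiate $gg^{\mathsf T}=1$ in order to express the derivative of $g^{\mathsf T}$ by
    -- that of $g$.
    have hgg : matDeriv (fun y => (g y).1) (γ t) (mfderiv 𝓘(ℝ, ℝ) (𝓡 d) γ t (1 : ℝ)) *
        (g (γ t)).1ᵀ + (g (γ t)).1 *
        (matDeriv (fun y => (g y).1) (γ t) (mfderiv 𝓘(ℝ, ℝ) (𝓡 d) γ t (1 : ℝ)))ᵀ = 0 := by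
      rw [← matDeriv_transpose, ← matDeriv_mul hgd hgd.transpose]
      simp only [SOGrp.mul_transpose]
      exact matDeriv_const 1 _
    set D := matDeriv (fun y => (g y).1) (γ t) (mfderiv 𝓘(ℝ, ℝ) (𝓡 d) γ t (1 : ℝ)) with hDdef
    set W := θ (γ t) (mfderiv 𝓘(ℝ, ℝ) (𝓡 d) γ t (1 : ℝ))
    have e1 : (g (γ t)).1 * (g (γ t)).1ᵀ = 1 := SOGrp.mul_transpose _
    have e2 : Dᵀ = -((g (γ t)).1ᵀ * D * (g (γ t)).1ᵀ) := by
      have := congrArg (fun y => (g (γ t)).1ᵀ * y) hgg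
      simp only [mul_add, ← mul_assoc, SOGrp.transpose_mul, one_mul, mul_zero] at this
      rw [eq_neg_iff_add_eq_zero, add_comm]
      exact this
    have e3 : ∀ y : Matrix (Fin n) (Fin n) ℝ, (g (γ t)).1 * ((g (γ t)).1ᵀ * y) = y := fun y => by
      rw [← mul_assoc, e1, one_mul]
    have e4 : -(((g (γ t)).1ᵀ * W * (g (γ t)).1 + (g (γ t)).1ᵀ * D) *
        ((g (γ t)).1ᵀ * (b t).1)) = Dᵀ * (b t).1 + (g (γ t)).1ᵀ * -(W * (b t).1) := by
      rw [e2]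
      simp only [add_mul, neg_mul, mul_neg, mul_assoc, neg_add]
      rw [e3]
      abel
    rw [← e4] at h2
    exact h2

/-- The beginning of a horizontal curve, parametrized again by the unit interval. -/
theorem Connection.IsHorizontal.comp_mul {A : B.Connection} {u : ℝ → P} (hu : A.IsHorizontal u)
    {r : ℝ} (hr : r ∈ Set.Icc (0 : ℝ) 1) : A.IsHorizontal fun t => u (r * t) := by
  have hmaps : Set.MapsTo (fun t => r * t) (Set.Icc (0 : ℝ) 1) (Set.Icc 0 1) := fun t ht =>
    ⟨mul_nonneg hr.1 ht.1, mul_le_one₀ hr.2 ht.1 ht.2⟩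
  refine ⟨hu.1.comp (contMDiff_iff_contDiff.mpr (contDiff_const.mul contDiff_id)).contMDiffOn hmaps,
    fun t ht i hi => ?_⟩
  obtain ⟨a, ha, hda⟩ := hu.2 (r * t) (hmaps ht) i hi
  refine ⟨fun τ => a (r * τ), fun τ hτ hτi => ha _ (hmaps hτ) hτi, fun p q => ?_⟩
  have hmul : HasDerivWithinAt (fun t : ℝ => r * t) r (Set.Icc 0 1) t := by
    simpa using ((hasDerivAt_id t).const_mul r).hasDerivWithinAt
  have h1 := HasDerivWithinAt.comp t (hda p q) hmul hmaps
  have hγ := (hu.1 (r * t) (hmaps ht)).mdifferentiableWithinAt one_ne_zero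
  have hm : HasMFDerivWithinAt 𝓘(ℝ, ℝ) 𝓘(ℝ, ℝ) (fun t : ℝ => r * t) (Set.Icc 0 1) t
      (ContinuousLinearMap.toSpanSingleton ℝ r) :=
    hasMFDerivWithinAt_iff_hasFDerivWithinAt.mpr hmul.hasFDerivWithinAt
  have h2 := hγ.hasMFDerivWithinAt.comp t hm hmaps
  have h3 := h2.mfderivWithin (uniqueDiffOn_Icc zero_lt_one t ht).uniqueMDiffWithinAt
  have h4 : mfderivWithin 𝓘(ℝ, ℝ) (𝓡 d) (fun τ => B.proj (u (r * τ))) (Set.Icc 0 1) t (1 : ℝ) =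
      r • mfderivWithin 𝓘(ℝ, ℝ) (𝓡 d) (fun τ => B.proj (u τ)) (Set.Icc 0 1) (r * t) (1 : ℝ) := by
    have h5 := congrArg (fun L => L (1 : ℝ)) h3
    refine h5.trans ?_
    let L : ℝ →L[ℝ] EuclideanSpace ℝ (Fin d) :=
      mfderivWithin 𝓘(ℝ, ℝ) (𝓡 d) (fun τ => B.proj (u τ)) (Set.Icc 0 1) (r * t)
    show L ((1 : ℝ) • r) = r • L 1
    rw [← L.map_smul, smul_eq_mul, smul_eq_mul, mul_comm]
  rw [h4, map_smul, Matrix.smul_mul, ← smul_neg, Matrix.smul_apply, smul_eq_mul, mul_comm]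
  exact h1

end PrincipalSOBundle

/-! ### The discrete coset space -/

section LieQuotient

variable {n : ℕ}

/-- If a map into a Howe subgroup is continuous at `x₀`, then it takes values in one coset of the
subgroup generated by the identity component near `x₀`. -/
theorem eventually_inv_mul_mem_lieHull {H : Subgroup (SOGrp n)} (hH : IsHowe H) {X : Type*}
    [TopologicalSpace X] {f : X → SOGrp n} {s : Set X} {x₀ : X}
    (hf : ContinuousWithinAt (fun x => (f x).1) s x₀) (h0 : f x₀ ∈ H)
    (hmem : ∀ᶠ x in nhdsWithin x₀ s, f x ∈ H) :
    ∀ᶠ x in nhdsWithin x₀ s, (f x₀)⁻¹ * f x ∈ lieHull H := by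
  -- At $x_0$ this determinant is $2^n$, so it stays nonzero nearby.
  have hc : ContinuousWithinAt (fun x => (1 + (f x₀).1ᵀ * (f x).1).det) s x₀ := by
    have h1 : Continuous fun y : Matrix (Fin n) (Fin n) ℝ => (1 + (f x₀).1ᵀ * y).det :=
      Continuous.matrix_det (by fun_prop)
    exact h1.continuousAt.comp_continuousWithinAt hf
  have hne : (1 + (f x₀).1ᵀ * (f x₀).1).det ≠ 0 := by
    rw [SOGrp.transpose_mul, ← two_smul ℝ, Matrix.det_smul, Matrix.det_one, mul_one]
    exact pow_ne_zero _ two_ne_zero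
  filter_upwards [hc.eventually_ne hne, hmem] with x hx hxH
  exact mem_lieHull_of_det_ne_zero hH (H.mul_mem (H.inv_mem h0) hxH) hx

/-- The discrete space of cosets of the subgroup generated by the identity component. -/
def LieQuotient (H : Subgroup (SOGrp n)) : Type := H ⧸ (lieHull H).subgroupOf H

instance (H : Subgroup (SOGrp n)) : TopologicalSpace (LieQuotient H) := ⊥

instance (H : Subgroup (SOGrp n)) : DiscreteTopology (LieQuotient H) := ⟨rfl⟩

/-- The coset of an element of `H`. -/
def LieQuotient.mk {H : Subgroup (SOGrp n)} (g : H) : LieQuotient H :=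
  (QuotientGroup.mk g : H ⧸ (lieHull H).subgroupOf H)

open Classical in
/-- The coset of an element of `H`, and the trivial coset for all other elements. -/
def lieCoset (H : Subgroup (SOGrp n)) (g : SOGrp n) : LieQuotient H :=
  if h : g ∈ H then LieQuotient.mk ⟨g, h⟩ else LieQuotient.mk 1

theorem lieCoset_of_mem {H : Subgroup (SOGrp n)} {g : SOGrp n} (hg : g ∈ H) :
    lieCoset H g = LieQuotient.mk ⟨g, hg⟩ :=
  dif_pos hg

theorem lieCoset_eq_iff {H : Subgroup (SOGrp n)} {g h : SOGrp n} (hg : g ∈ H) (hh : h ∈ H) :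
    lieCoset H g = lieCoset H h ↔ g⁻¹ * h ∈ lieHull H := by
  rw [lieCoset_of_mem hg, lieCoset_of_mem hh]
  exact QuotientGroup.eq.trans Subgroup.mem_subgroupOf

theorem exists_lieCoset_eq {H : Subgroup (SOGrp n)} (v : LieQuotient H) :
    ∃ g ∈ H, lieCoset H g = v := by
  obtain ⟨g, hg⟩ := QuotientGroup.mk_surjective v
  exact ⟨g.1, g.2, (lieCoset_of_mem g.2).trans hg⟩

/-- The action of the elements of `H` on the cosets; all other elements act trivially. -/
def lieCosetMul (H : Subgroup (SOGrp n)) (g : SOGrp n) (v : LieQuotient H) : LieQuotient H :=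
  lieCoset H (g * (exists_lieCoset_eq v).choose)

theorem lieCosetMul_lieCoset {H : Subgroup (SOGrp n)} {g h : SOGrp n} (hg : g ∈ H) (hh : h ∈ H) :
    lieCosetMul H g (lieCoset H h) = lieCoset H (g * h) := by
  have h1 := (exists_lieCoset_eq (lieCoset H h)).choose_spec
  rw [lieCosetMul, lieCoset_eq_iff (H.mul_mem hg h1.1) (H.mul_mem hg hh)]
  have h2 := (lieCoset_eq_iff h1.1 hh).mp h1.2
  rwa [_root_.mul_inv_rev, mul_assoc, inv_mul_cancel_left]

end LieQuotient

/-! ### Necessity: the covering of cosets over a simply connected base -/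

namespace PrincipalSOBundle

variable {n d : ℕ} {M : Type*} [TopologicalSpace M] [ChartedSpace (EuclideanSpace ℝ (Fin d)) M]
  {P : Type*} {B : PrincipalSOBundle n d M P} {H : Subgroup (SOGrp n)} {Q : Set P}

theorem IsSmoothSection.continuousOn_translation {U U' : Set M} {s s' : M → P}
    (hs : B.IsSmoothSection U s) (hs' : B.IsSmoothSection U' s') :
    ContinuousOn (fun x => (B.translation (s x) (s' x)).1) (U ∩ U') :=
  continuousOn_pi.mpr fun a => continuousOn_pi.mpr fun b =>
    (hs.smooth_translation hs' a b).continuousOn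

variable {U : M → Set M} {s : M → M → P}

/-- The bundle of the cosets of the group generated by the identity component of the structure
group of a Howe subbundle. -/
def lieQuotientCore (hQ : B.IsHoweSubbundle H Q) (hxU : ∀ x, x ∈ U x)
    (hs : ∀ x, B.IsSectionIn Q (U x) (s x)) : FiberBundleCore M M (LieQuotient H) where
  baseSet := U
  isOpen_baseSet x := (hs x).1.1
  indexAt x := x
  mem_baseSet_at := hxU
  coordChange i j x v := lieCosetMul H (B.translation (s j x) (s i x)) v
  coordChange_self i x hx v := by
    obtain ⟨g, hg, rfl⟩ := exists_lieCoset_eq v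
    rw [B.translation_self, lieCosetMul_lieCoset H.one_mem hg, one_mul]
  continuousOn_coordChange i j := by
    rintro ⟨x, v⟩ ⟨hx, -⟩
    obtain ⟨g, hg, hgv⟩ := exists_lieCoset_eq v
    have hmem : ∀ y ∈ U i ∩ U j, B.translation (s j y) (s i y) ∈ H := fun y hy =>
      hQ.2.translation_mem ((hs j).2 y hy.2) ((hs i).2 y hy.1)
        (((hs j).1.2.1 y hy.2).trans ((hs i).1.2.1 y hy.1).symm)
    -- The representative $g$ is multiplied in before the cosets are compared, so that normality of
    -- `lieHull H` in $H$ is not needed.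
    have hc : ContinuousWithinAt (fun y => (B.translation (s j y) (s i y) * g).1) (U i ∩ U j) x := by
      have h1 := (hs j).1.continuousOn_translation (hs i).1 x hx.symm
      rw [Set.inter_comm] at h1
      have h2 : Continuous fun y : Matrix (Fin n) (Fin n) ℝ => y * g.1 := by fun_prop
      exact h2.continuousAt.comp_continuousWithinAt h1
    have hev := eventually_inv_mul_mem_lieHull hQ.1 hc (H.mul_mem (hmem x hx) hg)
      (Filter.eventually_of_mem self_mem_nhdsWithin fun y hy => H.mul_mem (hmem y hy) hg)
    have hv : ∀ᶠ w in nhdsWithin v Set.univ, w = v := by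
      rw [nhdsWithin_univ, nhds_discrete]
      exact Filter.eventually_pure.mpr rfl
    have hev2 := hev.and (Filter.eventually_of_mem self_mem_nhdsWithin fun y hy => hmem y hy)
    have := hev2.prod_mk hv
    rw [← nhdsWithin_prod_eq] at this
    refine (continuousWithinAt_const (b := lieCosetMul H (B.translation (s j x) (s i x)) v)).congr_of_eventuallyEq
      ?_ rfl
    filter_upwards [this] with p hp
    obtain ⟨⟨hp1, hp2⟩, hp3⟩ := hp
    rw [hp3, ← hgv, lieCosetMul_lieCoset hp2 hg, lieCosetMul_lieCoset (hmem x hx) hg]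
    exact ((lieCoset_eq_iff (H.mul_mem (hmem x hx) hg) (H.mul_mem hp2 hg)).mpr hp1).symm
  coordChange_comp i j k x hx v := by
    obtain ⟨g, hg, rfl⟩ := exists_lieCoset_eq v
    have hp : ∀ l, x ∈ U l → B.proj (s l x) = x := fun l hl => (hs l).1.2.1 x hl
    have hi := hx.1.1
    have hj := hx.1.2
    have hk := hx.2
    have hmem : ∀ l m, x ∈ U l → x ∈ U m → B.translation (s l x) (s m x) ∈ H := fun l m hl hm =>
      hQ.2.translation_mem ((hs l).2 x hl) ((hs m).2 x hm) ((hp l hl).trans (hp m hm).symm)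
    rw [lieCosetMul_lieCoset (hmem j i hj hi) hg,
      lieCosetMul_lieCoset (hmem k j hk hj) (H.mul_mem (hmem j i hj hi) hg),
      lieCosetMul_lieCoset (hmem k i hk hi) hg, ← mul_assoc,
      B.translation_mul ((hp k hk).trans (hp j hj).symm) ((hp j hj).trans (hp i hi).symm)]

variable [IsManifold (𝓡 d) ∞ M]

theorem Connection.IsHorizontal.mem_holonomyBundle {A : B.Connection} {u : ℝ → P}
    (hu : A.IsHorizontal u) {u₀ : P} (h0 : u 0 ∈ A.holonomyBundle u₀) {t : ℝ}
    (ht : t ∈ Set.Icc (0 : ℝ) 1) : u t ∈ A.holonomyBundle u₀ :=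
  Relation.ReflTransGen.tail h0 ⟨_, hu.comp_mul ht, by simp, by simp⟩

/-- The coordinates of a horizontal curve with respect to a local section are continuous. -/
theorem Connection.IsHorizontal.continuousWithinAt_translation {A : B.Connection} {u : ℝ → P}
    (hu : A.IsHorizontal u) {t : ℝ} (ht : t ∈ Set.Icc (0 : ℝ) 1) {V : Set M} {σ : M → P}
    (hσ : B.IsSmoothSection V σ) (hV : B.proj (u t) ∈ V) :
    ContinuousWithinAt (fun τ => (B.translation (σ (B.proj (u τ))) (u τ)).1) (Set.Icc 0 1) t := by
  obtain ⟨i, hi⟩ := B.cover (B.proj (u t))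
  obtain ⟨a, ha, hda⟩ := hu.2 t ht i hi
  have hac : ContinuousWithinAt (fun τ => (a τ).1) (Set.Icc 0 1) t :=
    HasMatDerivWithinAt.continuousWithinAt (f := fun τ => (a τ).1) hda
  have h1 : ContinuousAt (fun y => (B.translation (σ y) (B.sec i y)).1) (B.proj (u t)) :=
    (hσ.continuousOn_translation (isSmoothSection_sec i)).continuousAt
      ((hσ.1.inter (B.isOpen_dom i)).mem_nhds ⟨hV, hi⟩)
  have h2 := (ContinuousAt.comp_continuousWithinAt (f := fun τ => B.proj (u τ)) (x := t) h1
    (hu.1 t ht).continuousWithinAt).mul hac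
  have hev : (fun τ => (B.translation (σ (B.proj (u τ))) (u τ)).1) =ᶠ[nhdsWithin t (Set.Icc 0 1)]
      fun τ => (B.translation (σ (B.proj (u τ))) (B.sec i (B.proj (u τ)))).1 * (a τ).1 := by
    filter_upwards [hu.eventually_mem ht (hσ.1.inter (B.isOpen_dom i)) ⟨hV, hi⟩,
      self_mem_nhdsWithin] with τ hτ hτI
    have e1 := hσ.2.1 _ hτ.1
    have e2 := B.proj_sec i _ hτ.2
    conv_lhs => rw [← ha τ hτI hτ.2]
    rw [B.proj_act, e2, B.translation_act_right (e1.trans e2.symm)]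
    rfl
  exact h2.congr_of_eventuallyEq_of_mem hev ht

/-- If the Howe subbundle `Q` over a simply connected manifold is holonomy-induced, then its
structure group is generated by its identity component. -/
theorem IsHolonomyInduced.le_lieHull [SimplyConnectedSpace M] (hQ : B.IsHoweSubbundle H Q)
    (hind : B.IsHolonomyInduced Q) : H ≤ lieHull H := by
  obtain ⟨A, u₀, ⟨-, hsub⟩, hleast⟩ := hind
  have hu₀ : u₀ ∈ Q := hsub Relation.ReflTransGen.refl
  choose U s hxU hsm hsQ using hQ.2.2.2
  have hs : ∀ x, B.IsSectionIn Q (U x) (s x) := fun x => ⟨hsm x, hsQ x⟩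
  have hproj : ∀ x y, y ∈ U x → B.proj (s x y) = y := fun x y hy => (hsm x).2.1 y hy
  let C := lieQuotientCore hQ hxU hs
  let coord : M → P → LieQuotient H := fun i u => lieCoset H (B.translation (s i (B.proj u)) u)
  have hmemT : ∀ i, ∀ u ∈ Q, B.proj u ∈ U i → B.translation (s i (B.proj u)) u ∈ H :=
    fun i u hu hi => hQ.2.translation_mem (hsQ i _ hi) hu (hproj i _ hi)
  have hcoord : ∀ i j, ∀ u ∈ Q, B.proj u ∈ U i → B.proj u ∈ U j →
      C.coordChange i j (B.proj u) (coord i u) = coord j u := by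
    intro i j u hu hi hj
    have e1 : B.proj (s j (B.proj u)) = B.proj (s i (B.proj u)) :=
      (hproj j _ hj).trans (hproj i _ hi).symm
    show lieCosetMul H _ (lieCoset H _) = lieCoset H _
    rw [lieCosetMul_lieCoset (hQ.2.translation_mem (hsQ j _ hj) (hsQ i _ hi) e1) (hmemT i u hu hi),
      B.translation_mul e1 (hproj i _ hi)]
  let cls : P → C.TotalSpace := fun u => ⟨B.proj u, coord (B.proj u) u⟩
  have hcov : IsCoveringMap (Bundle.TotalSpace.proj : C.TotalSpace → M) :=
    FiberBundle.isCoveringMap (F := LieQuotient H) (E := C.Fiber)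
  have : LocallyPathConnectedSpace M :=
    ChartedSpace.locallyPathConnectedSpace (EuclideanSpace ℝ (Fin d)) M
  -- Simple connectedness enters here: the identity of $M$ lifts to a global section of the covering
  -- through the class of $u_0$.
  obtain ⟨σ, ⟨hσ0, hσ⟩, -⟩ := hcov.existsUnique_continuousMap_lifts (ContinuousMap.id M)
    (B.proj u₀) (cls u₀) rfl
  have hσp : ∀ x, (σ x).proj = x := fun x => congrFun hσ x
  let σv : M → LieQuotient H := fun x => (σ x).snd
  have hσe : ∀ x, σ x = (⟨x, σv x⟩ : C.TotalSpace) := by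
    intro x
    have h1 := hσp x
    show σ x = ⟨x, (σ x).snd⟩
    generalize σ x = p at h1 ⊢
    obtain ⟨y, v⟩ := p
    have h1' : y = x := h1
    subst h1'
    rfl
  have hcls : ∀ u, cls u = σ (B.proj u) ↔ coord (B.proj u) u = σv (B.proj u) := by
    intro u
    rw [hσe]
    constructor
    · intro h
      exact eq_of_heq (Bundle.TotalSpace.mk.inj h).2
    · intro h
      show (⟨B.proj u, coord (B.proj u) u⟩ : C.TotalSpace) = _
      rw [h]
  -- The part of $Q$ lying over the section is the candidate for a smaller Howe subbundle, with
  -- group `lieHull H`.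
  set Q' : Set P := {u | u ∈ Q ∧ cls u = σ (B.proj u)} with hQ'
  have hself : ∀ x, x ∈ U x := hxU
  have hK : lieHull H ≤ H := lieHull_le hQ.1
  have hcoord_act : ∀ i, ∀ u ∈ Q, B.proj u ∈ U i → ∀ h ∈ H, coord i (B.act u h) =
      lieCoset H (B.translation (s i (B.proj u)) u * h) := by
    intro i u hu hi h hh
    show lieCoset H (B.translation (s i (B.proj (B.act u h))) (B.act u h)) = _
    rw [B.proj_act, B.translation_act_right (hproj i _ hi)]
  have htrans : ∀ u ∈ Q', ∀ v ∈ Q', B.proj u = B.proj v → ∃ h ∈ lieHull H, B.act u h = v := by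
    rintro u ⟨hu, hu'⟩ v ⟨hv, hv'⟩ huv
    obtain ⟨h, hh, rfl⟩ := hQ.2.2.1 u hu v hv huv
    refine ⟨h, ?_, rfl⟩
    rw [hcls] at hu' hv'
    rw [B.proj_act, hcoord_act _ u hu (hself _) h hh, ← hu'] at hv'
    have hT := hmemT _ u hu (hself _)
    have := (lieCoset_eq_iff hT (H.mul_mem hT hh)).mp hv'.symm
    rwa [inv_mul_cancel_left] at this
  have hred : B.IsReduction (lieHull H) Q' := by
    refine ⟨?_, htrans, ?_⟩
    · rintro u ⟨hu, hu'⟩ k hk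
      refine ⟨hQ.2.1 u hu k (hK hk), ?_⟩
      rw [hcls] at hu' ⊢
      rw [B.proj_act, hcoord_act _ u hu (hself _) k (hK hk), ← hu']
      have hT := hmemT _ u hu (hself _)
      refine (lieCoset_eq_iff (H.mul_mem hT (hK hk)) hT).mpr ?_
      simpa [mul_assoc] using (lieHull H).inv_mem hk
    · intro x
      have hcont : ContinuousAt (fun y => (C.localTriv x (σ y)).2) x := by
        have h1 : ContinuousAt (C.localTriv x) (σ x) :=
          (C.localTriv x).continuousAt (by
            rw [C.mem_localTriv_source, hσp]; exact hself x)
        exact continuous_snd.continuousAt.comp (ContinuousAt.comp h1 σ.continuous.continuousAt)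
      -- The fibre is discrete, so in a trivialization $\sigma$ is locally the coset of one fixed
      -- $h$. Hence $s_x\cdot h$ is a local section of $Q'$.
      have hloc : ∀ᶠ y in nhds x, (C.localTriv x (σ y)).2 = (C.localTriv x (σ x)).2 := by
        exact hcont.preimage_mem_nhds ((isOpen_discrete {(C.localTriv x (σ x)).2}).mem_nhds rfl)
      obtain ⟨h, hh, hhv⟩ := exists_lieCoset_eq (C.localTriv x (σ x)).2
      obtain ⟨V, hV1, hV2, hxV⟩ := eventually_nhds_iff.mp (hloc.and ((hsm x).1.mem_nhds (hself x)))
      refine ⟨V, fun y => B.act (s x y) h, hxV,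
        ((hsm x).mono hV2 fun y hy => (hV1 y hy).2).mul_right h, fun y hy => ?_⟩
      have hyU := (hV1 y hy).2
      have hsy := hsQ x y hyU
      have hp := hproj x y hyU
      have hactQ := hQ.2.1 _ hsy h hh
      refine ⟨hactQ, ?_⟩
      rw [hcls]
      have h1 : C.coordChange y x y (σv y) = lieCoset H h := by
        rw [hhv, ← (hV1 y hy).1, C.localTriv_apply, hσe]
        rfl
      have hpa : B.proj (B.act (s x y) h) = y := by rw [B.proj_act, hp]
      have h2 : coord x (B.act (s x y) h) = lieCoset H h := by
        rw [hcoord_act x _ hsy (by rw [hp]; exact hyU) h hh, hp, B.translation_self, one_mul]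
      have h3 := hcoord x y _ hactQ (by rw [hpa]; exact hyU) (by rw [hpa]; exact hself y)
      rw [hpa] at h3 ⊢
      rw [← h3, h2, ← h1]
      have h4 := C.coordChange_comp y x y y ⟨⟨hself y, hyU⟩, hself y⟩ (σv y)
      rw [h4]
      exact C.coordChange_self y y (hself y) _
  have hhol : A.holonomyBundle u₀ ⊆ Q' := by
    intro v hv
    induction hv with
    | refl => exact ⟨hu₀, hσ0.symm⟩
    | tail hab hstep ih =>
      obtain ⟨u, hu, rfl, rfl⟩ := hstep
      have huQ : ∀ t ∈ Set.Icc (0 : ℝ) 1, u t ∈ Q := fun t ht => hsub (hu.mem_holonomyBundle hab ht)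
      refine ⟨huQ 1 (Set.right_mem_Icc.mpr zero_le_one), ?_⟩
      have hc1 : ContinuousOn (fun t => cls (u t)) (Set.Icc 0 1) := by
        intro t ht
        refine (FiberBundle.continuousWithinAt_totalSpace (F := LieQuotient H) (E := C.Fiber)
          (fun t => cls (u t))).mpr ⟨(hu.1 t ht).continuousWithinAt, ?_⟩
        have hT := hu.continuousWithinAt_translation ht (hsm (B.proj (u t))) (hself _)
        have hevU := hu.eventually_mem ht (hsm (B.proj (u t))).1 (hself _)
        have hev := eventually_inv_mul_mem_lieHull hQ.1 hT (hmemT _ _ (huQ t ht) (hself _)) (by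
          filter_upwards [hevU, self_mem_nhdsWithin] with τ hτ hτI
          exact hmemT _ _ (huQ τ hτI) hτ)
        refine (continuousWithinAt_const (b := coord (B.proj (u t)) (u t))).congr_of_eventuallyEq_of_mem
          ?_ ht
        filter_upwards [hev, hevU, self_mem_nhdsWithin] with τ hτ hτU hτI
        refine Eq.trans (b := coord (B.proj (u t)) (u τ)) ?_ ?_
        · exact hcoord _ _ _ (huQ τ hτI) (hself _) hτU
        · exact ((lieCoset_eq_iff (hmemT _ _ (huQ t ht) (hself _)) (hmemT _ _ (huQ τ hτI) hτU)).mpr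
            hτ).symm
      have hc2 : ContinuousOn (fun t => σ (B.proj (u t))) (Set.Icc 0 1) :=
        σ.continuous.comp_continuousOn hu.1.continuousOn
      -- The classes of the points of the curve and the values of $\sigma$ along it are two lifts of
      -- the same path that agree at the start.
      exact hcov.eqOn_of_comp_eqOn isPreconnected_Icc hc1 hc2
        (fun t _ => (hσp (B.proj (u t))).symm) (Set.left_mem_Icc.mpr zero_le_one) ih.2
        (Set.right_mem_Icc.mpr zero_le_one)
  have hle : Q ⊆ Q' := hleast ⟨⟨lieHull H, isHowe_lieHull H, hred⟩, hhol⟩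
  intro h hh
  obtain ⟨k, hk, hkh⟩ := htrans u₀ (hle hu₀) (B.act u₀ h) (hle (hQ.2.1 u₀ hu₀ h hh))
    (B.proj_act u₀ h).symm
  rwa [← B.act_injective hkh]

end PrincipalSOBundle

/-! ### Matrix-valued 1-forms and gauge transformations -/

section MatrixForms

variable {n d : ℕ} {M : Type*} [TopologicalSpace M] [ChartedSpace (EuclideanSpace ℝ (Fin d)) M]

variable (n d M) in
/-- A matrix-valued 1-form on `M`, not necessarily smooth. -/
abbrev MatrixForm : Type _ :=
  (x : M) → TangentSpace (𝓡 d) x →ₗ[ℝ] Matrix (Fin n) (Fin n) ℝ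

/-- The differential of a matrix-valued function. -/
def matDifferential (f : M → Matrix (Fin n) (Fin n) ℝ) : MatrixForm n d M := fun x =>
  { toFun := matDeriv f x
    map_add' := fun v w => by
      ext a b
      exact map_add (mfderiv (𝓡 d) 𝓘(ℝ, ℝ) (fun y => f y a b) x) v w
    map_smul' := fun c v => by
      ext a b
      exact map_smul (mfderiv (𝓡 d) 𝓘(ℝ, ℝ) (fun y => f y a b) x) c v }

/-- The transformation of the local connection form `θ` by `g`. -/
def gaugeForm (θ : MatrixForm n d M) (g : M → SOGrp n) : MatrixForm n d M := fun x =>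
  (LinearMap.mulRight ℝ (g x).1).comp ((LinearMap.mulLeft ℝ (g x).1ᵀ).comp (θ x)) +
    (LinearMap.mulLeft ℝ (g x).1ᵀ).comp (matDifferential (fun y => (g y).1) x)

theorem gaugeForm_apply (θ : MatrixForm n d M) (g : M → SOGrp n) (x : M)
    (v : TangentSpace (𝓡 d) x) :
    gaugeForm θ g x v = (g x).1ᵀ * θ x v * (g x).1 +
      (g x).1ᵀ * matDeriv (fun y => (g y).1) x v := rfl

theorem transpose_matDeriv_add {g : M → SOGrp n} {x : M} (hg : MatDiffAt d (fun y => (g y).1) x)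
    (v : TangentSpace (𝓡 d) x) :
    (matDeriv (fun y => (g y).1) x v)ᵀ * (g x).1 + (g x).1ᵀ * matDeriv (fun y => (g y).1) x v = 0 := by
  rw [← matDeriv_transpose, ← matDeriv_mul hg.transpose hg]
  simp only [SOGrp.transpose_mul]
  exact matDeriv_const 1 _

theorem gaugeForm_transpose {θ : MatrixForm n d M} {g : M → SOGrp n} {x : M}
    (hg : MatDiffAt d (fun y => (g y).1) x) {v : TangentSpace (𝓡 d) x}
    (hθ : (θ x v)ᵀ = -θ x v) : (gaugeForm θ g x v)ᵀ = -gaugeForm θ g x v := by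
  have h := transpose_matDeriv_add hg v
  rw [gaugeForm_apply, Matrix.transpose_add, Matrix.transpose_mul, Matrix.transpose_mul,
    Matrix.transpose_mul, Matrix.transpose_transpose, hθ, eq_neg_of_add_eq_zero_left h]
  noncomm_ring

/-- This cocycle rule is what makes forms defined through a section $s_j$ obey the transformation
law between the sections `sec i`. -/
theorem gaugeForm_mul (θ : MatrixForm n d M) {g h : M → SOGrp n} {x : M}
    (hg : MatDiffAt d (fun y => (g y).1) x) (hh : MatDiffAt d (fun y => (h y).1) x)
    (v : TangentSpace (𝓡 d) x) :
    gaugeForm θ (fun y => g y * h y) x v = (h x).1ᵀ * gaugeForm θ g x v * (h x).1 +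
      (h x).1ᵀ * matDeriv (fun y => (h y).1) x v := by
  simp only [gaugeForm_apply, SOGrp.coe_mul, Matrix.transpose_mul]
  rw [matDeriv_mul hg hh]
  have e : ∀ y : Matrix (Fin n) (Fin n) ℝ, (g x).1ᵀ * ((g x).1 * y) = y := fun y => by
    rw [← mul_assoc, SOGrp.transpose_mul, one_mul]
  simp only [mul_add, add_mul, mul_assoc, e, add_assoc]

theorem gaugeForm_congr (θ : MatrixForm n d M) {g h : M → SOGrp n} {x : M}
    (e : g =ᶠ[nhds x] h) (v : TangentSpace (𝓡 d) x) : gaugeForm θ g x v = gaugeForm θ h x v := by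
  have h1 : (fun y => (g y).1) =ᶠ[nhds x] fun y => (h y).1 := e.mono fun y hy => by simp only [hy]
  rw [gaugeForm_apply, gaugeForm_apply, e.eq_of_nhds, matDeriv_congr h1]

/-- In the gauge with form $\theta$, a constant matrix commuting with $\theta$ is covariantly
constant; the formula expresses this after transformation by $g$. -/
theorem matDeriv_conj {θ : MatrixForm n d M} {g : M → SOGrp n} {x : M}
    (hg : MatDiffAt d (fun y => (g y).1) x) {v : TangentSpace (𝓡 d) x}
    {c : Matrix (Fin n) (Fin n) ℝ} (hc : c * θ x v = θ x v * c) :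
    matDeriv (fun y => (g y).1ᵀ * c * (g y).1) x v =
      (g x).1ᵀ * c * (g x).1 * gaugeForm θ g x v - gaugeForm θ g x v * ((g x).1ᵀ * c * (g x).1) := by
  have h1 : matDeriv (fun y => (g y).1ᵀ * c) x v = (matDeriv (fun y => (g y).1) x v)ᵀ * c := by
    rw [matDeriv_mul hg.transpose (matDiffAt_const c), matDeriv_const, mul_zero, add_zero,
      matDeriv_transpose]
  rw [matDeriv_mul (hg.transpose.mul (matDiffAt_const c)) hg, h1, gaugeForm_apply]
  have e0 := eq_neg_of_add_eq_zero_right (transpose_matDeriv_add hg v)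
  rw [e0]
  have e : ∀ y : Matrix (Fin n) (Fin n) ℝ, (g x).1 * ((g x).1ᵀ * y) = y := fun y => by
    rw [← mul_assoc, SOGrp.mul_transpose, one_mul]
  have e1 : (g x).1ᵀ * c * matDeriv (fun y => (g y).1) x v =
      -((g x).1ᵀ * c * (g x).1 * ((matDeriv (fun y => (g y).1) x v)ᵀ * (g x).1)) := by
    rw [← mul_neg, ← e0, mul_assoc _ (g x).1, e]
  rw [e1]
  simp only [mul_add, add_mul, mul_assoc, e, neg_mul, mul_neg]
  have e2 : c * (θ x v * (g x).1) = θ x v * (c * (g x).1) := by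
    rw [← mul_assoc, hc, mul_assoc]
  rw [e2]
  abel

variable [IsManifold (𝓡 d) ∞ M]

/-- The 1-form `θ` is smooth on the set `U`. -/
def IsSmoothFormOn (θ : MatrixForm n d M) (U : Set M) : Prop :=
  ∀ a b, ContMDiffOn (𝓡 d).tangent 𝓘(ℝ, ℝ) ∞
    (fun p : TangentBundle (𝓡 d) M => θ p.proj p.snd a b) {p | p.proj ∈ U}

theorem ContMDiffOn.comp_tangentBundle_proj {f : M → ℝ} {U : Set M}
    (hf : ContMDiffOn (𝓡 d) 𝓘(ℝ, ℝ) ∞ f U) :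
    ContMDiffOn (𝓡 d).tangent 𝓘(ℝ, ℝ) ∞ (fun p : TangentBundle (𝓡 d) M => f p.proj)
      {p | p.proj ∈ U} :=
  hf.comp (Bundle.contMDiff_proj (TangentSpace (𝓡 d) : M → Type _)).contMDiffOn fun _ h => h

theorem ContMDiffOn.contMDiffOn_mfderiv_apply {f : M → ℝ} {U : Set M} (hU : IsOpen U)
    (hf : ContMDiffOn (𝓡 d) 𝓘(ℝ, ℝ) ∞ f U) :
    ContMDiffOn (𝓡 d).tangent 𝓘(ℝ, ℝ) ∞
      (fun p : TangentBundle (𝓡 d) M => (mfderiv (𝓡 d) 𝓘(ℝ, ℝ) f p.proj p.snd : ℝ))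
      {p | p.proj ∈ U} := by
  have h := hf.contMDiffOn_tangentMapWithin (m := ∞) (by simp) hU.uniqueMDiffOn
  have h2 := (contMDiff_snd_tangentBundle_modelSpace ℝ 𝓘(ℝ, ℝ) (n := ∞)).comp_contMDiffOn h
  refine h2.congr fun p hp => ?_
  show _ = mfderivWithin (𝓡 d) 𝓘(ℝ, ℝ) f U p.proj p.snd
  rw [mfderivWithin_of_isOpen hU hp]

theorem IsSmoothFormOn.gaugeForm {θ : MatrixForm n d M} {g : M → SOGrp n} {U : Set M}
    (hU : IsOpen U) (hθ : IsSmoothFormOn θ U) (hg : SmoothIntoSO (d := d) g U) :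
    IsSmoothFormOn (gaugeForm θ g) U := by
  intro a b
  have h1 : ContMDiffOn (𝓡 d).tangent 𝓘(ℝ, ℝ) ∞ (fun p : TangentBundle (𝓡 d) M =>
      (∑ k, (∑ l, (g p.proj).1 l a * θ p.proj p.snd l k) * (g p.proj).1 k b) +
        ∑ k, (g p.proj).1 k a * matDeriv (fun y => (g y).1) p.proj p.snd k b) {p | p.proj ∈ U} := by
    refine ContMDiffOn.add (contMDiffOn_finsetSum fun k _ => ContMDiffOn.mul
      (contMDiffOn_finsetSum fun l _ => ContMDiffOn.mul ?_ (hθ l k)) ?_)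
      (contMDiffOn_finsetSum fun k _ => ContMDiffOn.mul ?_ ?_)
    · exact (hg l a).comp_tangentBundle_proj
    · exact (hg k b).comp_tangentBundle_proj
    · exact (hg k a).comp_tangentBundle_proj
    · exact (hg k b).contMDiffOn_mfderiv_apply hU
  exact h1

theorem isSmoothFormOn_of_eventuallyEq_sum {J : Type*} {θ : MatrixForm n d M} {U : Set M}
    (h : ∀ x ∈ U, ∃ (S : Finset J) (ρ : J → M → ℝ) (η : J → MatrixForm n d M) (V : Set M),
      IsOpen V ∧ x ∈ V ∧ (∀ j ∈ S, ContMDiffOn (𝓡 d) 𝓘(ℝ, ℝ) ∞ (ρ j) V ∧ IsSmoothFormOn (η j) V) ∧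
      ∀ y ∈ V, θ y = ∑ j ∈ S, ρ j y • η j y) : IsSmoothFormOn θ U := by
  intro a b p hp
  obtain ⟨S, ρ, η, V, hV, hxV, hsm, hsum⟩ := h p.proj hp
  have hVo : IsOpen {q : TangentBundle (𝓡 d) M | q.proj ∈ V} :=
    hV.preimage (FiberBundle.continuous_proj (EuclideanSpace ℝ (Fin d)) (TangentSpace (𝓡 d) : M → Type _))
  have h1 : ContMDiffOn (𝓡 d).tangent 𝓘(ℝ, ℝ) ∞ (fun q : TangentBundle (𝓡 d) M =>
      ∑ j ∈ S, ρ j q.proj * η j q.proj q.snd a b) {q | q.proj ∈ V} :=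
    contMDiffOn_finsetSum fun j hj =>
      ((hsm j hj).1.comp_tangentBundle_proj).mul ((hsm j hj).2 a b)
  have h2 := h1.congr (f₁ := fun q : TangentBundle (𝓡 d) M => θ q.proj q.snd a b) fun q hq => by
    simp only [hsum q.proj hq, LinearMap.sum_apply, LinearMap.smul_apply, Matrix.sum_apply,
      Matrix.smul_apply, smul_eq_mul]
  exact (h2.contMDiffAt (hVo.mem_nhds hxV)).contMDiffWithinAt

end MatrixForms

/-! ### Gluing compatible connections -/

namespace PrincipalSOBundle

variable {n d : ℕ} {M : Type*} [TopologicalSpace M] [ChartedSpace (EuclideanSpace ℝ (Fin d)) M]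
  {P : Type*} {B : PrincipalSOBundle n d M P} {H : Subgroup (SOGrp n)} {Q : Set P}

section Glue

variable {J : Type*} {U : J → Set M} {s : J → M → P} (ρ : SmoothPartitionOfUnity J (𝓡 d) M Set.univ)
  (θ : MatrixForm n d M)

variable (B s) in
/-- The local connection forms which are glued from the forms given by `θ` with respect to the
sections `s j`. -/
def gluedForm (i : B.ι) : MatrixForm n d M := fun x =>
  ∑ j ∈ ρ.finsupport x, ρ j x • gaugeForm θ (fun y => B.translation (s j y) (B.sec i y)) x

variable {ρ θ}

theorem gluedForm_apply (i : B.ι) (x : M) (v : TangentSpace (𝓡 d) x) :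
    B.gluedForm s ρ θ i x v = ∑ j ∈ ρ.finsupport x,
      ρ j x • gaugeForm θ (fun y => B.translation (s j y) (B.sec i y)) x v := by
  rw [gluedForm, LinearMap.sum_apply]
  rfl

theorem mem_of_mem_finsupport (hρ : ρ.IsSubordinate U) {x : M} {j : J}
    (hj : j ∈ ρ.finsupport x) : x ∈ U j := by
  rw [SmoothPartitionOfUnity.mem_finsupport] at hj
  exact hρ j (subset_tsupport _ hj)

variable [IsManifold (𝓡 d) ∞ M]

/-- The connection glued from the forms given by `θ` with respect to the sections `s j`. -/
def gluedConnection (hs : ∀ j, B.IsSmoothSection (U j) (s j)) (hρ : ρ.IsSubordinate U)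
    (hθ : IsSmoothFormOn θ Set.univ) (hsk : ∀ x v, (θ x v)ᵀ = -θ x v) : B.Connection where
  form := B.gluedForm s ρ θ
  skew i x hx v := by
    rw [gluedForm_apply, ← Finset.sum_neg_distrib, Matrix.transpose_sum]
    refine Finset.sum_congr rfl fun j hj => ?_
    rw [Matrix.transpose_smul, gaugeForm_transpose ((hs j).matDiffAt_translation
      (isSmoothSection_sec i) ⟨mem_of_mem_finsupport hρ hj, hx⟩) (hsk x v), smul_neg]
  smooth i := by
    refine isSmoothFormOn_of_eventuallyEq_sum (J := J) fun x hx => ?_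
    -- Near $x$ only the indices of the finite set `ρ.fintsupport x` contribute, and all of their
    -- sections are defined there.
    have h1 := (Filter.eventually_all_finset (ρ.fintsupport x)).mpr fun j hj =>
      (hs j).1.mem_nhds (hρ j ((ρ.mem_fintsupport_iff x j).mp hj))
    obtain ⟨V, hV, hVo, hxV⟩ := eventually_nhds_iff.mp ((h1.and
      (ρ.eventually_finsupport_subset x)).and ((B.isOpen_dom i).mem_nhds hx))
    refine ⟨ρ.fintsupport x, fun j => ρ j,
      fun j => gaugeForm θ (fun y => B.translation (s j y) (B.sec i y)), V, hVo, hxV,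
      fun j hj => ⟨(ρ j).contMDiff.contMDiffOn, ?_⟩, fun y hy => ?_⟩
    · refine IsSmoothFormOn.gaugeForm hVo (fun a b => (hθ a b).mono fun p _ => Set.mem_univ _)
        fun a b => ((hs j).smooth_translation (isSmoothSection_sec i) a b).mono fun y hy => ?_
      exact ⟨(hV y hy).1.1 j hj, (hV y hy).2⟩
    · refine Finset.sum_subset (hV y hy).1.2 fun j _ hj => ?_
      rw [SmoothPartitionOfUnity.mem_finsupport, Function.notMem_support] at hj
      rw [hj, zero_smul]
  transform i k x hx v := by
    have e : ∀ j ∈ ρ.finsupport x,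
        gaugeForm θ (fun y => B.translation (s j y) (B.sec k y)) x v =
          (B.transition i k x).1ᵀ *
            gaugeForm θ (fun y => B.translation (s j y) (B.sec i y)) x v *
              (B.transition i k x).1 +
            (B.transition i k x).1ᵀ * matDeriv (fun y => (B.transition i k y).1) x v := by
      intro j hj
      have hxj := mem_of_mem_finsupport hρ hj
      rw [← gaugeForm_mul θ ((hs j).matDiffAt_translation (isSmoothSection_sec i) ⟨hxj, hx.1⟩)
        (fun a b => ((B.smooth_transition i k a b).contMDiffAt
          (((B.isOpen_dom i).inter (B.isOpen_dom k)).mem_nhds hx)).mdifferentiableAt (by simp))]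
      refine gaugeForm_congr θ ?_ v
      filter_upwards [(hs j).1.mem_nhds hxj, (B.isOpen_dom i).mem_nhds hx.1,
        (B.isOpen_dom k).mem_nhds hx.2] with y h1 h2 h3
      rw [← B.sec_transition i k y ⟨h2, h3⟩, B.translation_act_right]
      rw [(hs j).2.1 y h1, B.proj_sec i y h2]
    rw [gluedForm_apply, gluedForm_apply, Finset.mul_sum, Finset.sum_mul]
    rw [Finset.sum_congr rfl fun j hj => by rw [e j hj]]
    simp only [smul_add, Finset.sum_add_distrib, Matrix.mul_smul, Matrix.smul_mul]
    -- The inhomogeneous term is the same for all $j$, and the weights add up to one.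
    rw [← Finset.sum_smul, ρ.sum_finsupport x (Set.mem_univ x), one_smul]
    rfl

/-- The compatibility equation is affine in the connection form, so it suffices to check each
summand. There the given section of $Q$ may be exchanged for $s_j$, since they differ by values in
$H$, and `matDeriv_conj` applies. -/
theorem gluedConnection_isCompatible (hQ : B.IsHoweSubbundle H Q)
    (hs : ∀ j, B.IsSectionIn Q (U j) (s j)) (hρ : ρ.IsSubordinate U)
    (hθ : IsSmoothFormOn θ Set.univ)
    (hmem : ∀ x v, θ x v ∈ skewCommutant (orthCentralizer H)) :
    (gluedConnection (fun j => (hs j).1) hρ hθ fun x v => (hmem x v).2).IsCompatible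
      (orthCentralizer H) Q := by
  intro c hc V σ hσ i x hx v
  have e : ∀ j ∈ ρ.finsupport x,
      matDeriv (fun y => (B.translation (σ y) (B.sec i y)).1ᵀ * c.1 *
        (B.translation (σ y) (B.sec i y)).1) x v =
      (B.translation (σ x) (B.sec i x)).1ᵀ * c.1 * (B.translation (σ x) (B.sec i x)).1 *
          gaugeForm θ (fun y => B.translation (s j y) (B.sec i y)) x v -
        gaugeForm θ (fun y => B.translation (s j y) (B.sec i y)) x v *
          ((B.translation (σ x) (B.sec i x)).1ᵀ * c.1 * (B.translation (σ x) (B.sec i x)).1) := by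
    intro j hj
    have hxj := mem_of_mem_finsupport hρ hj
    have key : ∀ y ∈ V ∩ U j ∩ B.dom i,
        (B.translation (σ y) (B.sec i y)).1ᵀ * c.1 * (B.translation (σ y) (B.sec i y)).1 =
        (B.translation (s j y) (B.sec i y)).1ᵀ * c.1 * (B.translation (s j y) (B.sec i y)).1 := by
      intro y hy
      have e1 := hσ.1.2.1 y hy.1.1
      have e2 := (hs j).1.2.1 y hy.1.2
      have e3 := conj_eq_of_mem hQ.1 (hQ.2.translation_mem ((hs j).2 y hy.1.2) (hσ.2 y hy.1.1)
        (e2.trans e1.symm)) hc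
      rw [← B.translation_coe_mul (e2.trans e1.symm) (e1.trans (B.proj_sec i y hy.2).symm),
        Matrix.transpose_mul]
      conv_lhs => rw [← e3]
      simp only [mul_assoc]
    have hev : (fun y => (B.translation (σ y) (B.sec i y)).1ᵀ * c.1 *
        (B.translation (σ y) (B.sec i y)).1) =ᶠ[nhds x]
        fun y => (B.translation (s j y) (B.sec i y)).1ᵀ * c.1 *
          (B.translation (s j y) (B.sec i y)).1 := by
      filter_upwards [((hσ.1.1.inter (hs j).1.1).inter (B.isOpen_dom i)).mem_nhds
        ⟨⟨hx.1, hxj⟩, hx.2⟩] with y hy using key y hy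
    rw [matDeriv_congr hev, key x ⟨⟨hx.1, hxj⟩, hx.2⟩]
    exact matDeriv_conj ((hs j).1.matDiffAt_translation (isSmoothSection_sec i) ⟨hxj, hx.2⟩)
      (mem_commutant.mp (hmem x v).1 c hc)
  show _ = _ * B.gluedForm s ρ θ i x v - B.gluedForm s ρ θ i x v * _
  have h1 := ρ.sum_finsupport x (Set.mem_univ x)
  rw [gluedForm_apply, Finset.mul_sum, Finset.sum_mul, ← Finset.sum_sub_distrib]
  conv_lhs => rw [← one_smul ℝ (matDeriv _ x v), ← h1, Finset.sum_smul]
  refine Finset.sum_congr rfl fun j hj => ?_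
  rw [e j hj, smul_sub, Matrix.mul_smul, Matrix.smul_mul]

end Glue

/-- There is a connection which is compatible with the Howe subbundle `Q` and which is given by
the form `θ` with respect to the section `s₀` of `Q` on a prescribed closed subset of its domain. -/
theorem exists_isCompatible [IsManifold (𝓡 d) ∞ M] [T2Space M] [SigmaCompactSpace M] (hQ : B.IsHoweSubbundle H Q)
    {θ : MatrixForm n d M} (hθ : IsSmoothFormOn θ Set.univ)
    (hmem : ∀ x v, θ x v ∈ skewCommutant (orthCentralizer H)) {U₀ K : Set M} {s₀ : M → P}
    (hs₀ : B.IsSectionIn Q U₀ s₀) (hK : IsClosed K) (hKU : K ⊆ U₀) :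
    ∃ A : B.Connection, A.IsCompatible (orthCentralizer H) Q ∧ ∀ i, ∀ x ∈ K ∩ B.dom i, ∀ v,
      A.form i x v = gaugeForm θ (fun y => B.translation (s₀ y) (B.sec i y)) x v := by
  classical
  choose U s hxU hs hsQ using hQ.2.2.2
  -- Every member of this cover either carries the section $s_0$ or misses $K$. So on $K$ all active
  -- summands are the form prescribed by $s_0$.
  let U' : M → Set M := fun j => if j ∈ U₀ then U₀ else U j \ K
  let s' : M → M → P := fun j => if j ∈ U₀ then s₀ else s j
  have hs' : ∀ j, B.IsSectionIn Q (U' j) (s' j) := by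
    intro j
    by_cases hj : j ∈ U₀
    · simp only [U', s', if_pos hj]
      exact hs₀
    · simp only [U', s', if_neg hj]
      exact ⟨(hs j).mono ((hs j).1.sdiff hK) Set.sdiff_subset, fun y hy => hsQ j y hy.1⟩
  have hcov : (Set.univ : Set M) ⊆ ⋃ j, U' j := by
    intro x _
    refine Set.mem_iUnion.mpr ⟨x, ?_⟩
    by_cases hj : x ∈ U₀
    · simp only [U', if_pos hj]
      exact hj
    · simp only [U', if_neg hj]
      exact ⟨hxU x, fun h => hj (hKU h)⟩
  obtain ⟨ρ, hρ⟩ := SmoothPartitionOfUnity.exists_isSubordinate (𝓡 d) isClosed_univ U'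
    (fun j => (hs' j).1.1) hcov
  refine ⟨_, gluedConnection_isCompatible hQ hs' hρ hθ hmem, fun i x hx v => ?_⟩
  show B.gluedForm s' ρ θ i x v = _
  rw [gluedForm_apply]
  conv_rhs => rw [← one_smul ℝ (gaugeForm _ _ x v), ← ρ.sum_finsupport x (Set.mem_univ x),
    Finset.sum_smul]
  refine Finset.sum_congr rfl fun j hj => ?_
  have hxj : x ∈ U' j := mem_of_mem_finsupport hρ hj
  by_cases hj : j ∈ U₀
  · simp only [s', if_pos hj]
  · simp only [U', if_neg hj] at hxj
    exact absurd hx.1 hxj.2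

end PrincipalSOBundle

/-! ### One-parameter groups and polynomial curves of skew matrices -/

section SkewExp

variable {n : ℕ}

open scoped Matrix.Norms.Operator in
theorem hasDerivAt_exp_smul_apply (Y : Matrix (Fin n) (Fin n) ℝ) (t : ℝ) (a b : Fin n) :
    HasDerivAt (fun q : ℝ => (NormedSpace.exp (q • Y)) a b) ((Y * NormedSpace.exp (t • Y)) a b) t :=
  (LinearMap.toContinuousLinearMap (Matrix.entryLinearMap ℝ ℝ a b)).hasFDerivAt.comp_hasDerivAt t
    (hasDerivAt_exp_smul_const' Y t)

theorem exp_mul_exp_transpose {Y : Matrix (Fin n) (Fin n) ℝ} (hY : Yᵀ = -Y) :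
    NormedSpace.exp Y * (NormedSpace.exp Y)ᵀ = 1 := by
  rw [← Matrix.exp_transpose, hY, Matrix.exp_neg]
  exact Matrix.mul_nonsing_inv _ ((Matrix.isUnit_iff_isUnit_det _).mp (Matrix.isUnit_exp Y))

/-- It is the square of the determinant of the orthogonal matrix $\exp(Y/2)$. -/
theorem det_exp_of_skew {Y : Matrix (Fin n) (Fin n) ℝ} (hY : Yᵀ = -Y) :
    (NormedSpace.exp Y).det = 1 := by
  have h1 : NormedSpace.exp Y = NormedSpace.exp ((2⁻¹ : ℝ) • Y) ^ 2 := by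
    rw [← Matrix.exp_nsmul, ← Nat.cast_smul_eq_nsmul ℝ, smul_smul]
    norm_num
  have h2 := congrArg Matrix.det (exp_mul_exp_transpose (Y := (2⁻¹ : ℝ) • Y)
    (by rw [Matrix.transpose_smul, hY, smul_neg]))
  rw [Matrix.det_mul, Matrix.det_transpose, Matrix.det_one] at h2
  rw [h1, Matrix.det_pow, pow_two, h2]

/-- The one-parameter subgroup of `SO(n)` generated by a skew-symmetric matrix. -/
def skewExp {Y : Matrix (Fin n) (Fin n) ℝ} (hY : Yᵀ = -Y) (q : ℝ) : SOGrp n :=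
  ⟨NormedSpace.exp (q • Y), by
    have h : (q • Y)ᵀ = -(q • Y) := by rw [Matrix.transpose_smul, hY, smul_neg]
    exact Matrix.mem_specialOrthogonalGroup_iff.mpr
      ⟨(Matrix.mem_orthogonalGroup_iff (Fin n) ℝ).mpr (exp_mul_exp_transpose h), det_exp_of_skew h⟩⟩

theorem skewExp_zero {Y : Matrix (Fin n) (Fin n) ℝ} (hY : Yᵀ = -Y) : skewExp hY 0 = 1 := by
  apply Subtype.ext
  show NormedSpace.exp ((0 : ℝ) • Y) = 1
  rw [zero_smul, NormedSpace.exp_zero]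

/-- The derivative of $z\exp(qY)-\exp(qY)z$ at $q=0$ is $zY-Yz$. -/
theorem commute_of_eventually_commute_skewExp {Y : Matrix (Fin n) (Fin n) ℝ} (hY : Yᵀ = -Y)
    {z : Matrix (Fin n) (Fin n) ℝ} (h : ∀ᶠ q in nhds (0 : ℝ), Commute z (skewExp hY q).1) :
    Commute z Y := by
  have h1 : ∀ a b, HasDerivAt (fun q : ℝ => (z * (skewExp hY q).1 - (skewExp hY q).1 * z) a b)
      ((z * Y - Y * z) a b) 0 := by
    intro a b
    have h2 : ∀ a b, HasDerivAt (fun q : ℝ => (skewExp hY q).1 a b) (Y a b) 0 := fun a b => by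
      have := hasDerivAt_exp_smul_apply Y 0 a b
      rwa [zero_smul, NormedSpace.exp_zero, mul_one] at this
    simp only [Matrix.sub_apply, Matrix.mul_apply]
    exact (HasDerivAt.fun_sum fun k _ => (h2 k b).const_mul (z a k)).sub
      (HasDerivAt.fun_sum fun k _ => (h2 a k).mul_const (z k b))
  ext a b
  have h3 : (fun q : ℝ => (z * (skewExp hY q).1 - (skewExp hY q).1 * z) a b) =ᶠ[nhds 0]
      fun _ => 0 := by
    filter_upwards [h] with q hq
    rw [hq.eq, sub_self]
    rfl
  exact sub_eq_zero.mp ((h1 a b).unique ((hasDerivAt_const (0 : ℝ) (0 : ℝ)).congr_of_eventuallyEq h3))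

/-- The polynomial curve with coefficients `X k` which vanishes at `0`. -/
def polyCurve {m : ℕ} (X : Fin m → Matrix (Fin n) (Fin n) ℝ) (η : ℝ) : Matrix (Fin n) (Fin n) ℝ :=
  ∑ k, η ^ (k.1 + 1) • X k

theorem polyCurve_zero {m : ℕ} (X : Fin m → Matrix (Fin n) (Fin n) ℝ) : polyCurve X 0 = 0 :=
  Finset.sum_eq_zero fun k _ => by rw [zero_pow (Nat.succ_ne_zero _), zero_smul]

/-- The entries of the commutator are polynomials in $\eta$ that vanish near $0$, so every
coefficient vanishes. In this way a single curve detects a whole basis. -/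
theorem commute_of_eventually_commute_polyCurve {m : ℕ} {X : Fin m → Matrix (Fin n) (Fin n) ℝ}
    {z : Matrix (Fin n) (Fin n) ℝ} (h : ∀ᶠ η in nhds (0 : ℝ), Commute z (polyCurve X η)) (k : Fin m) :
    Commute z (X k) := by
  ext a b
  let p : Polynomial ℝ := ∑ k : Fin m,
    Polynomial.C ((z * X k - X k * z) a b) * Polynomial.X ^ (k.1 + 1)
  have hp : ∀ η, p.eval η = (z * polyCurve X η - polyCurve X η * z) a b := by
    intro η
    simp only [p, Polynomial.eval_finsetSum, Polynomial.eval_mul, Polynomial.eval_C,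
      Polynomial.eval_pow, Polynomial.eval_X]
    rw [polyCurve, Finset.mul_sum, Finset.sum_mul, ← Finset.sum_sub_distrib, Matrix.sum_apply]
    refine Finset.sum_congr rfl fun k _ => ?_
    rw [Matrix.mul_smul, Matrix.smul_mul, ← smul_sub, Matrix.smul_apply, smul_eq_mul, mul_comm]
  have h0 : p = 0 := by
    refine Polynomial.eq_zero_of_infinite_isRoot p
      (Set.Infinite.mono ?_ (infinite_of_mem_nhds (0 : ℝ) h))
    intro η hη
    have hη' : Commute z (polyCurve X η) := hη
    show p.eval η = 0
    rw [hp, hη'.eq, sub_self]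
    rfl
  have h1 : p.coeff (k.1 + 1) = (z * X k - X k * z) a b := by
    simp only [p, Polynomial.finsetSum_coeff, Polynomial.coeff_C_mul, Polynomial.coeff_X_pow]
    rw [Finset.sum_eq_single k]
    · simp
    · intro j _ hj
      rw [if_neg, mul_zero]
      intro e
      exact hj (Fin.ext (Nat.succ_injective e).symm)
    · simp
  rw [h0, Polynomial.coeff_zero] at h1
  exact sub_eq_zero.mp h1.symm

end SkewExp

/-! ### The model 1-form -/

section CoordForm

variable {n d : ℕ} {M : Type*} [TopologicalSpace M] [ChartedSpace (EuclideanSpace ℝ (Fin d)) M]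

/-- The 1-form `(∑ k, η ^ (k + 1) X k) dξ`. -/
def coordForm {m : ℕ} (X : Fin m → Matrix (Fin n) (Fin n) ℝ) (ξ η : M → ℝ) : MatrixForm n d M :=
  fun x =>
    let D : TangentSpace (𝓡 d) x →L[ℝ] ℝ := mfderiv (𝓡 d) 𝓘(ℝ, ℝ) ξ x
    D.toLinearMap.smulRight (polyCurve X (η x))

theorem coordForm_apply {m : ℕ} (X : Fin m → Matrix (Fin n) (Fin n) ℝ) (ξ η : M → ℝ) (x : M)
    (v : TangentSpace (𝓡 d) x) :
    coordForm X ξ η x v = (id (mfderiv (𝓡 d) 𝓘(ℝ, ℝ) ξ x v) : ℝ) • polyCurve X (η x) := rfl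

theorem coordForm_curve {m : ℕ} (X : Fin m → Matrix (Fin n) (Fin n) ℝ) {ξ η : M → ℝ} {γ : ℝ → M}
    {t c : ℝ} (hξ : MDifferentiableAt (𝓡 d) 𝓘(ℝ, ℝ) ξ (γ t))
    (hγ : MDifferentiableAt 𝓘(ℝ, ℝ) (𝓡 d) γ t) (hc : HasDerivAt (fun τ => ξ (γ τ)) c t) :
    coordForm X ξ η (γ t) (mfderiv 𝓘(ℝ, ℝ) (𝓡 d) γ t (1 : ℝ)) = c • polyCurve X (η (γ t)) := by
  have h := hξ.hasMFDerivAt.comp t hγ.hasMFDerivAt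
  let D : ℝ →L[ℝ] ℝ := (mfderiv (𝓡 d) 𝓘(ℝ, ℝ) ξ (γ t)).comp (mfderiv 𝓘(ℝ, ℝ) (𝓡 d) γ t)
  have h' : HasFDerivAt (fun τ => ξ (γ τ)) D t := hasMFDerivAt_iff_hasFDerivAt.mp h
  rw [← h'.hasDerivAt.unique hc]
  rfl

theorem isSmoothFormOn_coordForm [IsManifold (𝓡 d) ∞ M] {m : ℕ}
    (X : Fin m → Matrix (Fin n) (Fin n) ℝ) {ξ η : M → ℝ} (hξ : ContMDiff (𝓡 d) 𝓘(ℝ, ℝ) ∞ ξ)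
    (hη : ContMDiff (𝓡 d) 𝓘(ℝ, ℝ) ∞ η) : IsSmoothFormOn (coordForm (d := d) X ξ η) Set.univ := by
  intro a b
  have h1 : ContMDiffOn (𝓡 d).tangent 𝓘(ℝ, ℝ) ∞ (fun p : TangentBundle (𝓡 d) M =>
      (mfderiv (𝓡 d) 𝓘(ℝ, ℝ) ξ p.proj p.snd : ℝ)) {p | p.proj ∈ Set.univ} :=
    ContMDiffOn.contMDiffOn_mfderiv_apply isOpen_univ hξ.contMDiffOn
  have h2 : ContMDiffOn (𝓡 d).tangent 𝓘(ℝ, ℝ) ∞ (fun p : TangentBundle (𝓡 d) M =>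
      η p.proj) {p | p.proj ∈ Set.univ} :=
    ContMDiffOn.comp_tangentBundle_proj hη.contMDiffOn
  have h3 : ContMDiffOn (𝓡 d).tangent 𝓘(ℝ, ℝ) ∞ (fun p : TangentBundle (𝓡 d) M =>
      ∑ k : Fin m, η p.proj ^ (k.1 + 1) * X k a b) {p | p.proj ∈ Set.univ} :=
    contMDiffOn_finsetSum fun k _ => (h2.pow _).mul contMDiffOn_const
  refine (h1.mul h3).congr fun p _ => ?_
  rw [coordForm_apply, Matrix.smul_apply, polyCurve, Matrix.sum_apply]
  rfl

end CoordForm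

/-! ### Curves and coordinates in a chart -/

section ChartCurves

variable {d : ℕ} {M : Type*} [TopologicalSpace M] [ChartedSpace (EuclideanSpace ℝ (Fin d)) M]
  [IsManifold (𝓡 d) ∞ M]

theorem contMDiff_extChartAt_symm_comp {x : M} {p : ℝ → EuclideanSpace ℝ (Fin d)}
    (hp : ContDiff ℝ ∞ p) (hmem : ∀ t, p t ∈ (extChartAt (𝓡 d) x).target) :
    ContMDiff 𝓘(ℝ, ℝ) (𝓡 d) 1 fun t => (extChartAt (𝓡 d) x).symm (p t) :=
  ((contMDiffOn_extChartAt_symm x).comp_contMDiff hp.contMDiff hmem).of_le (by simp)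

/-- Near every point there are local coordinates which are centered at the point and whose
components extend to smooth functions on the whole manifold. -/
theorem exists_smooth_coordinates [T2Space M] (x : M) {W : Set M} (hW : W ∈ nhds x) :
    ∃ ξ : Fin d → M → ℝ, (∀ k, ContMDiff (𝓡 d) 𝓘(ℝ, ℝ) ∞ (ξ k)) ∧ ∃ ε > 0,
      ∀ w : EuclideanSpace ℝ (Fin d), ‖w‖ < ε →
        extChartAt (𝓡 d) x x + w ∈ (extChartAt (𝓡 d) x).target ∧
        (extChartAt (𝓡 d) x).symm (extChartAt (𝓡 d) x x + w) ∈ W ∧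
        ∀ k, ξ k ((extChartAt (𝓡 d) x).symm (extChartAt (𝓡 d) x x + w)) = w k := by
  let f : SmoothBumpFunction (𝓡 d) x := Classical.arbitrary _
  let φ := extChartAt (𝓡 d) x
  refine ⟨fun k y => f y • (φ y k - φ x k), fun k => ?_, ?_⟩
  · refine f.contMDiff_smul ?_
    have h1 : ContMDiffOn (𝓡 d) 𝓘(ℝ, EuclideanSpace ℝ (Fin d)) ∞ φ (chartAt _ x).source :=
      contMDiffOn_extChartAt
    have h2 : ContDiff ℝ ∞ fun w : EuclideanSpace ℝ (Fin d) => w k - φ x k := by fun_prop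
    exact h2.contMDiff.comp_contMDiffOn h1
  · have hsymm : Filter.Tendsto (fun w => φ.symm (φ x + w)) (nhds 0) (nhds x) := by
      have h1 := continuousAt_extChartAt_symm (I := 𝓡 d) x
      have h2 : Filter.Tendsto (fun w : EuclideanSpace ℝ (Fin d) => φ x + w) (nhds 0)
          (nhds (φ x)) := by
        have : ContinuousAt (fun w : EuclideanSpace ℝ (Fin d) => φ x + w) 0 := by fun_prop
        simpa [ContinuousAt] using this
      have h3 := h1.tendsto.comp h2
      rwa [extChartAt_to_inv] at h3
    have htar : Filter.Tendsto (fun w : EuclideanSpace ℝ (Fin d) => φ x + w) (nhds 0)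
          (nhds (φ x)) := by
      have : ContinuousAt (fun w : EuclideanSpace ℝ (Fin d) => φ x + w) 0 := by fun_prop
      simpa [ContinuousAt] using this
    have h1 := (htar.eventually (extChartAt_target_mem_nhds (I := 𝓡 d) x)).and
      ((hsymm.eventually hW).and (hsymm.eventually f.eventuallyEq_one))
    obtain ⟨ε, hε, h⟩ := Metric.eventually_nhds_iff.mp h1
    refine ⟨ε, hε, fun w hw => ?_⟩
    obtain ⟨h2, h3, h4⟩ := h (y := w) (by simpa using hw)
    refine ⟨h2, h3, fun k => ?_⟩
    have h5 : φ (φ.symm (φ x + w)) = φ x + w := φ.right_inv h2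
    show f (φ.symm (φ x + w)) • (φ (φ.symm (φ x + w)) k - φ x k) = w k
    rw [h5, h4]
    simp

end ChartCurves

/-! ### Sufficiency: holonomy along coordinate rectangles -/

namespace PrincipalSOBundle

variable {n d : ℕ} {M : Type*} [TopologicalSpace M] [ChartedSpace (EuclideanSpace ℝ (Fin d)) M]
  [IsManifold (𝓡 d) ∞ M]
  {P : Type*} {B : PrincipalSOBundle n d M P} {H : Subgroup (SOGrp n)} {Q : Set P}

/-- `θ` is the local connection form of `A` with respect to the section `s` over `U`. -/
def Connection.HasLocalForm (A : B.Connection) (U : Set M) (s : M → P) (θ : MatrixForm n d M) :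
    Prop :=
  ∀ i, ∀ x ∈ U ∩ B.dom i, ∀ v : TangentSpace (𝓡 d) x,
    A.form i x v = gaugeForm θ (fun y => B.translation (s y) (B.sec i y)) x v

/-- Along $\gamma$ the form is $q'(t)Y$ with one fixed $Y$, so the parallel transport equation is
solved by $\exp(-qY)$. -/
theorem Connection.HasLocalForm.isHorizontal_skewExp {A : B.Connection} {U : Set M} {s : M → P}
    (hs : B.IsSmoothSection U s) {θ : MatrixForm n d M} (hθ : A.HasLocalForm U s θ) {γ : ℝ → M}
    (hγ : ContMDiff 𝓘(ℝ, ℝ) (𝓡 d) 1 γ) (hγU : ∀ t, γ t ∈ U) {Y : Matrix (Fin n) (Fin n) ℝ}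
    (hY : Yᵀ = -Y) {q q' : ℝ → ℝ} (hq : ∀ t, HasDerivAt q (q' t) t)
    (hθγ : ∀ t, θ (γ t) (mfderiv 𝓘(ℝ, ℝ) (𝓡 d) γ t (1 : ℝ)) = q' t • Y) (g : SOGrp n) :
    A.IsHorizontal fun t => B.act (s (γ t)) (skewExp hY (-q t) * g) := by
  refine A.isHorizontal_of_local hs (fun x v => θ x v) hθ hγ hγU fun t _ => ?_
  have h1 : HasMatDerivWithinAt (fun τ => (skewExp hY (-q τ)).1)
      (-(q' t • Y) * (skewExp hY (-q t)).1) (Set.Icc 0 1) t := by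
    intro a b
    have h := ((hasDerivAt_exp_smul_apply Y (-q t) a b).comp t (hq t).neg).hasDerivWithinAt
      (s := Set.Icc 0 1)
    refine h.congr_deriv ?_
    rw [neg_mul, Matrix.smul_mul, Matrix.neg_apply, Matrix.smul_apply, smul_eq_mul]
    show _ * -q' t = -(q' t * (Y * NormedSpace.exp (-q t • Y)) a b)
    ring
  have h2 := h1.mul (hasMatDerivWithinAt_const g.1 (Set.Icc 0 1) t)
  refine Eq.subst (motive := fun D => HasMatDerivWithinAt _ D _ _) ?_ h2
  rw [hθγ, mul_zero, add_zero, neg_mul, neg_mul, mul_assoc]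
  rfl

variable {x₀ : M} {ξ : Fin d → M → ℝ} {ε : ℝ}

/-- The point with coordinates `a` and `b` in the directions `i` and `j` of the chart at `x₀`. -/
def chartPoint (x₀ : M) (i j : Fin d) (a b : ℝ) : M :=
  (extChartAt (𝓡 d) x₀).symm (extChartAt (𝓡 d) x₀ x₀ +
    (EuclideanSpace.single i a + EuclideanSpace.single j b))

/-- Along a coordinate segment the form is a scalar times one matrix: for $a=a'$ it vanishes, and
for $b=b'$ the value of the polynomial curve is constant; `hXY` covers both cases. The smooth
transition function keeps the curve in the chart for all real times. -/
theorem Connection.HasLocalForm.exists_horizontal_segment {A : B.Connection} {U : Set M} {s : M → P}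
    (hs : B.IsSmoothSection U s) {m : ℕ} {X : Fin m → Matrix (Fin n) (Fin n) ℝ} {i j : Fin d}
    (hij : i ≠ j) (hξ : ∀ k, ContMDiff (𝓡 d) 𝓘(ℝ, ℝ) ∞ (ξ k))
    (hε : ∀ w : EuclideanSpace ℝ (Fin d), ‖w‖ < ε →
        extChartAt (𝓡 d) x₀ x₀ + w ∈ (extChartAt (𝓡 d) x₀).target ∧
        (extChartAt (𝓡 d) x₀).symm (extChartAt (𝓡 d) x₀ x₀ + w) ∈ U ∧
        ∀ k, ξ k ((extChartAt (𝓡 d) x₀).symm (extChartAt (𝓡 d) x₀ x₀ + w)) = w k)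
    (hθ : A.HasLocalForm U s (coordForm X (ξ i) (ξ j)))
    {a a' b b' : ℝ} (ha : |a| < ε / 2) (ha' : |a'| < ε / 2) (hb : |b| < ε / 2) (hb' : |b'| < ε / 2)
    {Y : Matrix (Fin n) (Fin n) ℝ} (hY : Yᵀ = -Y)
    (hXY : ∀ r : ℝ, (a' - a) • polyCurve X (b + r * (b' - b)) = (a' - a) • Y) (g : SOGrp n) :
    ∃ u, A.IsHorizontal u ∧ u 0 = B.act (s (chartPoint x₀ i j a b)) g ∧
      u 1 = B.act (s (chartPoint x₀ i j a' b')) (skewExp hY (-(a' - a)) * g) := by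
  let l := Real.smoothTransition
  let w : ℝ → EuclideanSpace ℝ (Fin d) := fun t =>
    EuclideanSpace.single i (a + l t * (a' - a)) + EuclideanSpace.single j (b + l t * (b' - b))
  have hl : ContDiff ℝ ∞ l := Real.smoothTransition.contDiff
  have hconv : ∀ {c c' : ℝ}, |c| < ε / 2 → |c'| < ε / 2 → ∀ t, |c + l t * (c' - c)| < ε / 2 := by
    intro c c' hc hc' t
    have h0 := Real.smoothTransition.nonneg t
    have h1 := Real.smoothTransition.le_one t
    have h2 : c + l t * (c' - c) = (1 - l t) * c + l t * c' := by ring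
    have h4 := (convex_ball (0 : ℝ) (ε / 2)) (by simpa using hc : c ∈ Metric.ball (0 : ℝ) (ε / 2))
      (by simpa using hc' : c' ∈ Metric.ball (0 : ℝ) (ε / 2)) (sub_nonneg.mpr h1) h0
      (sub_add_cancel _ _)
    rw [h2]
    simpa using h4
  have hw : ∀ t, ‖w t‖ < ε := by
    intro t
    refine (norm_add_le _ _).trans_lt ?_
    rw [PiLp.norm_single, PiLp.norm_single, Real.norm_eq_abs, Real.norm_eq_abs]
    linarith [hconv ha ha' t, hconv hb hb' t]
  have hwi : ∀ t, w t i = a + l t * (a' - a) := fun t => by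
    simp [w, hij]
  have hwj : ∀ t, w t j = b + l t * (b' - b) := fun t => by
    simp [w, hij.symm]
  let γ : ℝ → M := fun t => (extChartAt (𝓡 d) x₀).symm (extChartAt (𝓡 d) x₀ x₀ + w t)
  have hwc : ContDiff ℝ ∞ fun t => extChartAt (𝓡 d) x₀ x₀ + w t := by
    have hs1 : ∀ k : Fin d, ContDiff ℝ ∞ fun c : ℝ => EuclideanSpace.single k c := fun k => by
      rw [contDiff_euclidean]
      intro m
      by_cases hm : m = k
      · subst hm
        simpa using (contDiff_fun_id : ContDiff ℝ ∞ fun x : ℝ => x)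
      · simpa [hm] using contDiff_const
    exact contDiff_const.add (((hs1 i).comp (contDiff_const.add (hl.mul contDiff_const))).add
      ((hs1 j).comp (contDiff_const.add (hl.mul contDiff_const))))
  have hγ : ContMDiff 𝓘(ℝ, ℝ) (𝓡 d) 1 γ :=
    contMDiff_extChartAt_symm_comp hwc fun t => (hε _ (hw t)).1
  have hq : ∀ t, HasDerivAt (fun t => l t * (a' - a)) (deriv l t * (a' - a)) t := fun t =>
    ((hl.differentiable (by simp)) t).hasDerivAt.mul_const _
  have hform : ∀ t, coordForm X (ξ i) (ξ j) (γ t) (mfderiv 𝓘(ℝ, ℝ) (𝓡 d) γ t (1 : ℝ)) =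
      (deriv l t * (a' - a)) • Y := by
    intro t
    have e1 : (fun τ => ξ i (γ τ)) = fun τ => a + l τ * (a' - a) := by
      funext τ
      rw [← hwi]
      exact (hε _ (hw τ)).2.2 i
    have e2 : ξ j (γ t) = b + l t * (b' - b) := by
      rw [← hwj]
      exact (hε _ (hw t)).2.2 j
    rw [coordForm_curve X ((hξ i).mdifferentiable (by simp) _) ((hγ t).mdifferentiableAt one_ne_zero)
      (by rw [e1]; exact (hq t).const_add a), e2, mul_smul, hXY, ← mul_smul]
  refine ⟨_, hθ.isHorizontal_skewExp hs hγ (fun t => (hε _ (hw t)).2.1) hY hq hform g, ?_, ?_⟩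
  · have h0 : l 0 = 0 := Real.smoothTransition.zero
    simp only [h0, zero_mul, neg_zero, skewExp_zero, one_mul, γ, w, add_zero]
    rfl
  · have h1 : l 1 = 1 := Real.smoothTransition.one
    simp only [h1, one_mul, γ, w, add_sub_cancel]
    rfl

theorem skewExp_zero_matrix (h : (0 : Matrix (Fin n) (Fin n) ℝ)ᵀ = -0) (q : ℝ) :
    skewExp h q = 1 := by
  apply Subtype.ext
  show NormedSpace.exp (q • (0 : Matrix (Fin n) (Fin n) ℝ)) = 1
  rw [smul_zero, NormedSpace.exp_zero]

theorem polyCurve_transpose {m : ℕ} {X : Fin m → Matrix (Fin n) (Fin n) ℝ}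
    (hX : ∀ k, (X k)ᵀ = -X k) (η : ℝ) : (polyCurve X η)ᵀ = -polyCurve X η := by
  rw [polyCurve, Matrix.transpose_sum, ← Finset.sum_neg_distrib]
  exact Finset.sum_congr rfl fun k _ => by rw [Matrix.transpose_smul, hX, smul_neg]

/-- Parallel transport along coordinate rectangles. -/
theorem Connection.HasLocalForm.act_skewExp_mem_holonomyBundle {A : B.Connection} {U : Set M}
    {s : M → P} (hs : B.IsSmoothSection U s) {m : ℕ} {X : Fin m → Matrix (Fin n) (Fin n) ℝ}
    (hX : ∀ k, (X k)ᵀ = -X k) {i j : Fin d} (hij : i ≠ j)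
    (hξ : ∀ k, ContMDiff (𝓡 d) 𝓘(ℝ, ℝ) ∞ (ξ k))
    (hε : ∀ w : EuclideanSpace ℝ (Fin d), ‖w‖ < ε →
        extChartAt (𝓡 d) x₀ x₀ + w ∈ (extChartAt (𝓡 d) x₀).target ∧
        (extChartAt (𝓡 d) x₀).symm (extChartAt (𝓡 d) x₀ x₀ + w) ∈ U ∧
        ∀ k, ξ k ((extChartAt (𝓡 d) x₀).symm (extChartAt (𝓡 d) x₀ x₀ + w)) = w k)
    (hθ : A.HasLocalForm U s (coordForm X (ξ i) (ξ j))) {τ η : ℝ} (hτ : |τ| < ε / 2)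
    (hη : |η| < ε / 2) :
    B.act (s x₀) (skewExp (polyCurve_transpose hX η) τ) ∈ A.holonomyBundle (s x₀) := by
  have h0 : |(0 : ℝ)| < ε / 2 := by
    rw [abs_zero]
    exact (abs_nonneg τ).trans_lt hτ
  have hτ' : |-τ| < ε / 2 := by rwa [abs_neg]
  have hz : (0 : Matrix (Fin n) (Fin n) ℝ)ᵀ = -0 := by simp
  have hx : chartPoint x₀ i j 0 0 = x₀ := by
    have e : (EuclideanSpace.single i 0 + EuclideanSpace.single j 0 : EuclideanSpace ℝ (Fin d)) = 0 := by
      ext k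
      simp
    rw [chartPoint, e, add_zero, extChartAt_to_inv]
  -- Of the four sides only the one at height $\eta$ contributes. On the vertical sides $d\xi=0$,
  -- and on the last side the polynomial curve is evaluated at $0$, where it vanishes. The far
  -- corner is at $-\tau$ so that the transport is $\exp(+\tau\,\cdot)$.
  have h1 := hθ.exists_horizontal_segment hs hij hξ hε h0 h0 h0 hη hz (by simp) 1
  have h2 := hθ.exists_horizontal_segment hs hij hξ hε h0 hτ' hη hη (polyCurve_transpose hX η)
    (by simp) 1
  have h3 := hθ.exists_horizontal_segment hs hij hξ hε hτ' hτ' hη h0 hz (by simp)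
    (skewExp (polyCurve_transpose hX η) τ)
  have h4 := hθ.exists_horizontal_segment hs hij hξ hε hτ' h0 h0 h0 hz
    (by simp [polyCurve_zero]) (skewExp (polyCurve_transpose hX η) τ)
  simp only [skewExp_zero_matrix, one_mul, hx, B.act_one, mul_one, sub_zero, neg_neg] at h1 h2 h3 h4
  exact (((Relation.ReflTransGen.refl.tail h1).tail h2).tail h3).tail h4

/-- Over a manifold of dimension at least two, a Howe subbundle contains the holonomy subbundle of
a connection whose holonomy group has the same centralizer as the identity component of the
structure group. -/
theorem exists_connection_holonomy [T2Space M] [SigmaCompactSpace M] (hd : 2 ≤ d)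
    (hQ : B.IsHoweSubbundle H Q) (x₀ : M) :
    ∃ (A : B.Connection) (u₀ : P), A.holonomyBundle u₀ ⊆ Q ∧
      ∀ z : SOGrp n, (∀ g, B.act u₀ g ∈ A.holonomyBundle u₀ → Commute z.1 g.1) →
        z ∈ lieCentralizer H := by
  obtain ⟨U₀, s, hx₀, hs, hsQ⟩ := hQ.2.2.2 x₀
  have : LocallyCompactSpace M := Manifold.locallyCompact_of_finiteDimensional (𝓡 d)
  obtain ⟨K, hK, hKc, hKU⟩ := exists_mem_nhds_isClosed_subset (hs.1.mem_nhds hx₀)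
  let L := skewCommutant (orthCentralizer H)
  let bL := Module.finBasis ℝ L
  let X : Fin (Module.finrank ℝ L) → Matrix (Fin n) (Fin n) ℝ := fun k => (bL k).1
  let i : Fin d := ⟨0, by omega⟩
  let j : Fin d := ⟨1, by omega⟩
  have hij : i ≠ j := by
    simp [i, j]
  obtain ⟨ξ, hξ, ε, hεpos, hε⟩ := exists_smooth_coordinates (d := d) x₀ (interior_mem_nhds.mpr hK)
  have hmem : ∀ x v, coordForm (d := d) X (ξ i) (ξ j) x v ∈ L := fun x v =>
    L.smul_mem _ (L.sum_mem fun k _ => L.smul_mem _ (bL k).2)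
  obtain ⟨A, hA, hAθ⟩ := exists_isCompatible hQ (isSmoothFormOn_coordForm (d := d) X (hξ i) (hξ j)) hmem
    ⟨hs, hsQ⟩ hKc hKU
  refine ⟨A, s x₀, hA.holonomyBundle_subset hQ (hsQ x₀ hx₀), fun z hz Y hY => ?_⟩
  have hX : ∀ k, (X k)ᵀ = -X k := fun k => (bL k).2.2
  have hθ : A.HasLocalForm (interior K) s (coordForm X (ξ i) (ξ j)) := fun l x hx v =>
    hAθ l x ⟨interior_subset hx.1, hx.2⟩ v
  have hs' := hs.mono isOpen_interior (interior_subset.trans hKU)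
  have hball : ∀ᶠ r in nhds (0 : ℝ), |r| < ε / 2 := by
    have := Metric.ball_mem_nhds (0 : ℝ) (half_pos hεpos)
    filter_upwards [this] with r hr
    simpa using hr
  have hcomm : ∀ k, Commute z.1 (X k) := by
    -- The widths $\tau$ of the rectangles give commutation with the polynomial curve at each small
    -- $\eta$, and the heights $\eta$ then separate its coefficients.
    refine commute_of_eventually_commute_polyCurve ?_
    filter_upwards [hball] with η hη
    refine commute_of_eventually_commute_skewExp (polyCurve_transpose hX η) ?_
    filter_upwards [hball] with τ hτ
    exact hz _ (hθ.act_skewExp_mem_holonomyBundle hs' hX hij hξ hε hτ hη)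
  have hYsum : Y = ∑ k, bL.repr ⟨Y, hY⟩ k • X k := by
    have := congrArg Subtype.val (bL.sum_repr ⟨Y, hY⟩)
    rw [Submodule.coe_sum] at this
    exact this.symm
  rw [hYsum]
  exact Commute.sum_right _ _ _ fun k _ => (hcomm k).smul_right _

end PrincipalSOBundle

/-! ### Linear differential equations with skew coefficients -/

section SkewODE

variable {n : ℕ}

/-- For skew $C$ the derivative of $b^{\mathsf T}b$ vanishes. The determinant is then $\pm1$, and by
continuity it keeps its initial value. -/
theorem exists_orthogonal_of_hasMatDerivWithinAt {C b : ℝ → Matrix (Fin n) (Fin n) ℝ}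
    (hsk : ∀ t ∈ Set.Icc (0 : ℝ) 1, (C t)ᵀ = -C t) (h0 : b 0 = 1)
    (hb : ∀ t ∈ Set.Icc (0 : ℝ) 1, HasMatDerivWithinAt b (-(C t * b t)) (Set.Icc 0 1) t) :
    ∃ g : ℝ → SOGrp n, ∀ t ∈ Set.Icc (0 : ℝ) 1, (g t).1 = b t := by
  classical
  have horth : ∀ t ∈ Set.Icc (0 : ℝ) 1, (b t)ᵀ * b t = 1 := by
    intro t ht
    have h1 : ∀ t ∈ Set.Icc (0 : ℝ) 1,
        HasMatDerivWithinAt (fun τ => (b τ)ᵀ * b τ) 0 (Set.Icc 0 1) t := by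
      intro t ht
      have h2 := (hb t ht).transpose.mul (hb t ht)
      convert h2 using 1
      rw [Matrix.transpose_neg, Matrix.transpose_mul, hsk t ht]
      noncomm_ring
    have h2 := eq_of_hasMatDerivWithinAt_zero h1 ht
    rw [h2, h0, Matrix.transpose_one, one_mul]
  have hsq : ∀ t ∈ Set.Icc (0 : ℝ) 1, (b t).det = 1 ∨ (b t).det = -1 := by
    intro t ht
    have h1 := congrArg Matrix.det (horth t ht)
    rw [Matrix.det_mul, Matrix.det_transpose, Matrix.det_one] at h1
    exact mul_self_eq_one_iff.mp h1
  have hdet : ∀ t ∈ Set.Icc (0 : ℝ) 1, (b t).det = 1 := by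
    intro t ht
    have hc : ContinuousOn (fun τ => (b τ).det) (Set.Icc 0 1) := fun τ hτ =>
      (Continuous.matrix_det continuous_id).continuousAt.comp_continuousWithinAt
        (hb τ hτ).continuousWithinAt
    refine (hsq t ht).resolve_right fun h => ?_
    have h1 : (0 : ℝ) ∈ Set.Icc (b t).det (b 0).det := by
      rw [h, h0, Matrix.det_one]
      constructor <;> norm_num
    obtain ⟨τ, hτ, hτ0⟩ := isPreconnected_Icc.intermediate_value ht
      (Set.left_mem_Icc.mpr zero_le_one) hc h1
    simp only at hτ0
    rcases hsq τ hτ with h2 | h2 <;> rw [hτ0] at h2 <;> norm_num at h2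
  refine ⟨fun t => if h : t ∈ Set.Icc (0 : ℝ) 1 then ⟨b t, Matrix.mem_specialOrthogonalGroup_iff.mpr
    ⟨(Matrix.mem_orthogonalGroup_iff' (Fin n) ℝ).mpr (horth t h), hdet t h⟩⟩ else 1, fun t ht => ?_⟩
  simp only [dif_pos ht]

open scoped Matrix.Norms.Operator in
/-- The linear equation `b' = -C b` with a small skew-symmetric coefficient `C` has a solution in
`SO(n)` on the unit interval. -/
theorem exists_solution_of_small_skew {δ : ℝ} (hδ : n * δ ≤ 1 / 4)
    {C : ℝ → Matrix (Fin n) (Fin n) ℝ}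
    (hC : ∀ a b, ContinuousOn (fun t => C t a b) (Set.Icc 0 1))
    (hsk : ∀ t ∈ Set.Icc (0 : ℝ) 1, (C t)ᵀ = -C t)
    (hsmall : ∀ t ∈ Set.Icc (0 : ℝ) 1, ∀ a b, |C t a b| ≤ δ) :
    ∃ b : ℝ → SOGrp n, b 0 = 1 ∧ ∀ t ∈ Set.Icc (0 : ℝ) 1,
      HasMatDerivWithinAt (fun τ => (b τ).1) (-(C t * (b t).1)) (Set.Icc 0 1) t := by
  have hnorm : ∀ t ∈ Set.Icc (0 : ℝ) 1, ‖C t‖ ≤ 1 / 4 := by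
    intro t ht
    rw [Matrix.linfty_opNorm_def]
    have h1 : (Finset.univ.sup fun i => ∑ j, ‖C t i j‖₊) ≤ (⟨1 / 4, by norm_num⟩ : NNReal) := by
      refine Finset.sup_le fun a _ => ?_
      refine NNReal.coe_le_coe.mp ?_
      rw [NNReal.coe_sum]
      refine le_trans ?_ hδ
      refine (Finset.sum_le_sum fun b _ => ((hsmall t ht a b :) : ‖C t a b‖ ≤ δ)).trans ?_
      simp
    exact_mod_cast h1
  have hone : ‖(1 : Matrix (Fin n) (Fin n) ℝ)‖ ≤ 1 := by
    rcases isEmpty_or_nonempty (Fin n) with h | h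
    · rw [Subsingleton.elim (1 : Matrix (Fin n) (Fin n) ℝ) 0, norm_zero]
      exact zero_le_one
    · rw [norm_one]
  -- On the unit ball around $1$ one has $\|x\|\le2$ and $\|C\|\le1/4$, so the speed is at most
  -- $1/2$ and the solution cannot leave the ball within unit time.
  have hPL : IsPicardLindelof (fun t (x : Matrix (Fin n) (Fin n) ℝ) => -(C t * x))
      (tmin := 0) (tmax := 1) ⟨0, Set.left_mem_Icc.mpr zero_le_one⟩ 1 1 0 1 1 := by
    refine ⟨fun t ht => ?_, fun x _ => ?_, fun t ht x hx => ?_, ?_⟩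
    · refine LipschitzOnWith.of_dist_le_mul fun x _ y _ => ?_
      rw [dist_eq_norm, dist_eq_norm, ← neg_sub', norm_neg, ← mul_sub]
      refine (norm_mul_le _ _).trans ?_
      exact mul_le_mul_of_nonneg_right ((hnorm t ht).trans (by norm_num)) (norm_nonneg _)
    · refine ContinuousOn.neg ?_
      have h1 : ContinuousOn C (Set.Icc 0 1) :=
        continuousOn_pi.mpr fun a => continuousOn_pi.mpr fun b => hC a b
      exact h1.mul continuousOn_const
    · rw [norm_neg]
      refine (norm_mul_le _ _).trans ?_
      have h1 : ‖x‖ ≤ 2 := by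
        have h2 := norm_le_of_mem_closedBall hx
        have h3 : ((1 : NNReal) : ℝ) = 1 := rfl
        rw [h3] at h2
        linarith
      have h2 := mul_le_mul (hnorm t ht) h1 (norm_nonneg _) (by norm_num)
      exact h2.trans (by norm_num)
    · simp
  obtain ⟨b, hb0, hb⟩ := hPL.exists_eq_forall_mem_Icc_hasDerivWithinAt₀
  have hb' : ∀ t ∈ Set.Icc (0 : ℝ) 1, HasMatDerivWithinAt b (-(C t * b t)) (Set.Icc 0 1) t :=
    fun t ht p q => (LinearMap.toContinuousLinearMap
      (Matrix.entryLinearMap ℝ ℝ p q)).hasFDerivAt.comp_hasDerivWithinAt t (hb t ht)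
  obtain ⟨g, hg⟩ := exists_orthogonal_of_hasMatDerivWithinAt hsk hb0 hb'
  have h0 : (0 : ℝ) ∈ Set.Icc (0 : ℝ) 1 := Set.left_mem_Icc.mpr zero_le_one
  refine ⟨g, Subtype.ext ((hg 0 h0).trans hb0), fun t ht => ?_⟩
  rw [hg t ht]
  refine (hb' t ht).congr ?_ ht
  filter_upwards [self_mem_nhdsWithin] with τ hτ using hg τ hτ

end SkewODE

/-! ### The holonomy bundle meets every fibre; conclusion -/

namespace PrincipalSOBundle

variable {n d : ℕ} {M : Type*} [TopologicalSpace M] [ChartedSpace (EuclideanSpace ℝ (Fin d)) M]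
  [IsManifold (𝓡 d) ∞ M]
  {P : Type*} {B : PrincipalSOBundle n d M P} {H : Subgroup (SOGrp n)} {Q : Set P}

theorem Connection.hasLocalForm_sec (A : B.Connection) (i : B.ι) :
    A.HasLocalForm (B.dom i) (B.sec i) (A.form i) := by
  intro k x hx v
  have e : ∀ y ∈ B.dom i ∩ B.dom k, B.translation (B.sec i y) (B.sec k y) = B.transition i k y :=
    fun y hy => by rw [← B.sec_transition i k y hy, B.translation_act]
  have hev : (fun y => B.translation (B.sec i y) (B.sec k y)) =ᶠ[nhds x] B.transition i k := by
    filter_upwards [((B.isOpen_dom i).inter (B.isOpen_dom k)).mem_nhds hx] with y hy using e y hy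
  rw [gaugeForm_congr _ hev]
  exact A.transform i k x hx v

/-- The local connection form in the chart at `y`. -/
def Connection.chartForm (A : B.Connection) (i : B.ι) (y : M)
    (q : EuclideanSpace ℝ (Fin d) × EuclideanSpace ℝ (Fin d)) : Matrix (Fin n) (Fin n) ℝ :=
  A.form i ((extChartAt (𝓡 d) y).symm q.1)
    (mfderivWithin 𝓘(ℝ, EuclideanSpace ℝ (Fin d)) (𝓡 d) (extChartAt (𝓡 d) y).symm
      (extChartAt (𝓡 d) y).target q.1 q.2)

theorem Connection.continuousOn_chartForm (A : B.Connection) (i : B.ι) (y : M) (a b : Fin n) :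
    ContinuousOn (fun q => A.chartForm i y q a b)
      {q | q.1 ∈ (extChartAt (𝓡 d) y).target ∧ (extChartAt (𝓡 d) y).symm q.1 ∈ B.dom i} := by
  have h1 := (contMDiffOn_extChartAt_symm (I := 𝓡 d) (n := ∞) y).continuousOn_tangentMapWithin
    (by simp) (isOpen_extChartAt_target y).uniqueMDiffOn
  have h2 : Continuous fun q : EuclideanSpace ℝ (Fin d) × EuclideanSpace ℝ (Fin d) =>
      (⟨q.1, q.2⟩ : TangentBundle 𝓘(ℝ, EuclideanSpace ℝ (Fin d)) (EuclideanSpace ℝ (Fin d))) :=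
    (tangentBundleModelSpaceHomeomorph 𝓘(ℝ, EuclideanSpace ℝ (Fin d))).symm.continuous
  have h3 := h1.comp h2.continuousOn (s := {q | q.1 ∈ (extChartAt (𝓡 d) y).target ∧
    (extChartAt (𝓡 d) y).symm q.1 ∈ B.dom i}) fun q hq => hq.1
  exact (A.smooth i a b).continuousOn.comp h3 fun q hq => hq.2

theorem mfderiv_extChartAt_symm_comp {y : M} {p : ℝ → EuclideanSpace ℝ (Fin d)} {t : ℝ}
    {p' : EuclideanSpace ℝ (Fin d)} (hp : HasDerivAt p p' t)
    (hmem : p t ∈ (extChartAt (𝓡 d) y).target) :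
    mfderiv 𝓘(ℝ, ℝ) (𝓡 d) (fun τ => (extChartAt (𝓡 d) y).symm (p τ)) t (1 : ℝ) =
      mfderivWithin 𝓘(ℝ, EuclideanSpace ℝ (Fin d)) (𝓡 d) (extChartAt (𝓡 d) y).symm
        (extChartAt (𝓡 d) y).target (p t) p' := by
  have hopen := isOpen_extChartAt_target (I := 𝓡 d) y
  have h1 : MDifferentiableAt 𝓘(ℝ, EuclideanSpace ℝ (Fin d)) (𝓡 d) (extChartAt (𝓡 d) y).symm (p t) :=
    ((contMDiffOn_extChartAt_symm (I := 𝓡 d) (n := ∞) y).contMDiffAt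
      (hopen.mem_nhds hmem)).mdifferentiableAt (by simp)
  have h2 := h1.hasMFDerivAt.comp t (hasMFDerivAt_iff_hasFDerivAt.mpr hp.hasFDerivAt)
  rw [mfderivWithin_of_isOpen hopen hmem]
  have h3 := congrArg (fun L => L (1 : ℝ)) h2.mfderiv
  refine h3.trans ?_
  show mfderiv _ _ _ (p t) ((1 : ℝ) • p') = _
  rw [one_smul]

/-- Nearby points can be joined by horizontal curves. -/
theorem Connection.exists_nhds_forall_exists_isHorizontal (A : B.Connection) (y : M) :
    ∃ N ∈ nhds y, ∀ u, B.proj u ∈ N → ∀ x ∈ N, ∃ c, A.IsHorizontal c ∧ c 0 = u ∧ B.proj (c 1) = x := by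
  obtain ⟨i, hi⟩ := B.cover y
  let φ := extChartAt (𝓡 d) y
  let l := Real.smoothTransition
  have hl : ContDiff ℝ ∞ l := Real.smoothTransition.contDiff
  have hl' : Continuous (deriv l) := hl.continuous_deriv (by simp)
  obtain ⟨Λ, hΛ⟩ := (isCompact_Icc (a := (0 : ℝ)) (b := 1)).exists_bound_of_continuousOn
    hl'.continuousOn
  let δ : ℝ := 1 / (4 * (n + 1))
  have hδ0 : 0 < δ := by positivity
  have hδ : n * δ ≤ 1 / 4 := by
    have hn : (0 : ℝ) ≤ n := Nat.cast_nonneg n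
    rw [mul_one_div, div_le_div_iff₀ (by positivity) (by norm_num)]
    linarith
  have hsymm : ContinuousAt φ.symm (φ y) := continuousAt_extChartAt_symm y
  have hdom : ∀ᶠ z in nhds (φ y), z ∈ φ.target ∧ φ.symm z ∈ B.dom i := by
    refine Filter.inter_mem (extChartAt_target_mem_nhds y) (hsymm.preimage_mem_nhds ?_)
    rw [extChartAt_to_inv]
    exact (B.isOpen_dom i).mem_nhds hi
  have hdom2 : ∀ᶠ q in nhds (φ y, (0 : EuclideanSpace ℝ (Fin d))),
      q.1 ∈ φ.target ∧ φ.symm q.1 ∈ B.dom i :=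
    (continuous_fst.tendsto (φ y, (0 : EuclideanSpace ℝ (Fin d)))).eventually hdom
  -- The form vanishes on zero velocity and is jointly continuous in point and velocity.
  have hsmall : ∀ᶠ q in nhds (φ y, (0 : EuclideanSpace ℝ (Fin d))), ∀ a b,
      |A.chartForm i y q a b| < δ := by
    refine Filter.eventually_all.mpr fun a => Filter.eventually_all.mpr fun b => ?_
    have h1 := (A.continuousOn_chartForm i y a b).continuousAt hdom2
    have h2 : A.chartForm i y (φ y, 0) a b = 0 := by
      have h3 : A.chartForm i y (φ y, 0) = 0 :=
        (congrArg (A.form i _) (ContinuousLinearMap.map_zero _)).trans (LinearMap.map_zero _)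
      rw [h3]
      rfl
    have h3 : ContinuousAt (fun q => |A.chartForm i y q a b|) (φ y, 0) := h1.abs
    refine h3.eventually (gt_mem_nhds ?_)
    exact (congrArg abs h2).trans_lt (abs_zero.trans_lt hδ0)
  obtain ⟨r, hr, hball⟩ := Metric.eventually_nhds_iff.mp (hsmall.and hdom2)
  -- Two points of the ball of radius $r'$ have distance less than $2r'$. Since $\Lambda$ bounds the
  -- derivative of the transition function, the curve joining them has speed less than $r$.
  let r' := r / (2 * (|Λ| + 1))
  have hr' : 0 < r' := by positivity
  have hrr : r' ≤ r := by
    refine div_le_self hr.le ?_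
    linarith [abs_nonneg Λ]
  have hin : ∀ z ∈ Metric.ball (φ y) r, ∀ w, ‖w‖ < r → (∀ a b, |A.chartForm i y (z, w) a b| < δ) ∧
      z ∈ φ.target ∧ φ.symm z ∈ B.dom i := by
    intro z hz w hw
    refine hball (y := (z, w)) ?_
    rw [Prod.dist_eq, max_lt_iff, dist_zero_right]
    exact ⟨hz, hw⟩
  refine ⟨φ.source ∩ φ ⁻¹' Metric.ball (φ y) r', Filter.inter_mem (extChartAt_source_mem_nhds y)
    ((continuousAt_extChartAt y).preimage_mem_nhds (Metric.ball_mem_nhds _ hr')), ?_⟩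
  rintro u ⟨hu1, hu2⟩ x ⟨hx1, hx2⟩
  set z := φ (B.proj u) with hz
  set z' := φ x with hz'
  let p : ℝ → EuclideanSpace ℝ (Fin d) := fun t => z + l t • (z' - z)
  have hp : ContDiff ℝ ∞ p := contDiff_const.add (hl.smul contDiff_const)
  have hpd : ∀ t, HasDerivAt p (deriv l t • (z' - z)) t := fun t =>
    ((((hl.differentiable (by simp)) t).hasDerivAt.smul_const (z' - z)).const_add z)
  have hpball : ∀ t, p t ∈ Metric.ball (φ y) r := by
    intro t
    refine Metric.ball_subset_ball hrr ?_
    exact (convex_ball (φ y) r').add_smul_sub_mem hu2 hx2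
      ⟨Real.smoothTransition.nonneg t, Real.smoothTransition.le_one t⟩
  have hzero : ‖(0 : EuclideanSpace ℝ (Fin d))‖ < r := by rwa [norm_zero]
  have hptar : ∀ t, p t ∈ φ.target := fun t => (hin _ (hpball t) 0 hzero).2.1
  have hpdom : ∀ t, φ.symm (p t) ∈ B.dom i := fun t => (hin _ (hpball t) 0 hzero).2.2
  have hzz : ‖z' - z‖ < 2 * r' := by
    rw [← dist_eq_norm]
    refine (dist_triangle_right z' z (φ y)).trans_lt ?_
    have h1 : dist z' (φ y) < r' := hx2
    have h2 : dist z (φ y) < r' := hu2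
    linarith
  have hspeed : ∀ t ∈ Set.Icc (0 : ℝ) 1, ‖deriv l t • (z' - z)‖ < r := by
    intro t ht
    rw [norm_smul]
    have h1 : ‖deriv l t‖ ≤ |Λ| := (hΛ t ht).trans (le_abs_self Λ)
    have h2 : (|Λ| + 1) * (2 * r') = r := by
      simp only [r']
      field_simp
    calc ‖deriv l t‖ * ‖z' - z‖ ≤ |Λ| * ‖z' - z‖ := mul_le_mul_of_nonneg_right h1 (norm_nonneg _)
      _ ≤ |Λ| * (2 * r') := mul_le_mul_of_nonneg_left hzz.le (abs_nonneg _)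
      _ < (|Λ| + 1) * (2 * r') := by
        have : 0 < 2 * r' := by positivity
        nlinarith
      _ = r := h2
  let γ : ℝ → M := fun t => φ.symm (p t)
  have hγ : ContMDiff 𝓘(ℝ, ℝ) (𝓡 d) 1 γ := contMDiff_extChartAt_symm_comp hp hptar
  let C : ℝ → Matrix (Fin n) (Fin n) ℝ := fun t => A.chartForm i y (p t, deriv l t • (z' - z))
  have hCform : ∀ t, A.form i (γ t) (mfderiv 𝓘(ℝ, ℝ) (𝓡 d) γ t (1 : ℝ)) = C t := fun t => by
    rw [mfderiv_extChartAt_symm_comp (hpd t) (hptar t)]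
    rfl
  obtain ⟨b, hb0, hb⟩ := exists_solution_of_small_skew (C := C) hδ
    (fun a b => (A.continuousOn_chartForm i y a b).comp
      (hp.continuous.prodMk (hl'.smul continuous_const)).continuousOn
      fun t _ => ⟨hptar t, hpdom t⟩)
    (fun t _ => by
      rw [← hCform]
      exact A.skew i _ (hpdom t) _)
    fun t ht a b => ((hin _ (hpball t) _ (hspeed t ht)).1 a b).le
  set g := B.translation (B.sec i (B.proj u)) u with hg
  have h0 : γ 0 = B.proj u := by
    have h0 : l 0 = 0 := Real.smoothTransition.zero
    simp only [γ, p, h0, zero_smul, add_zero]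
    exact φ.left_inv hu1
  have h1 : γ 1 = x := by
    have h1 : l 1 = 1 := Real.smoothTransition.one
    simp only [γ, p, h1, one_smul, add_sub_cancel]
    exact φ.left_inv hx1
  refine ⟨fun t => B.act (B.sec i (γ t)) (b t * g), ?_, ?_, ?_⟩
  · refine A.isHorizontal_of_local (isSmoothSection_sec i) (fun x v => A.form i x v)
      (A.hasLocalForm_sec i) hγ hpdom fun t ht => ?_
    have h2 := (hb t ht).mul (hasMatDerivWithinAt_const g.1 (Set.Icc 0 1) t)
    refine Eq.subst (motive := fun D => HasMatDerivWithinAt _ D _ _) ?_ h2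
    rw [hCform, mul_zero, add_zero, neg_mul, mul_assoc]
    rfl
  · have hdi : B.proj u ∈ B.dom i := h0 ▸ hpdom 0
    simp only [h0, hb0, one_mul]
    exact B.act_translation (B.proj_sec i _ hdi)
  · simp only [B.proj_act]
    exact (B.proj_sec i _ (hpdom 1)).trans h1

/-- The holonomy subbundle meets all fibres. -/
theorem Connection.exists_mem_holonomyBundle [PreconnectedSpace M] (A : B.Connection) (u₀ : P)
    (x : M) : ∃ v ∈ A.holonomyBundle u₀, B.proj v = x := by
  choose N hN hreach using A.exists_nhds_forall_exists_isHorizontal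
  let S : Set M := B.proj '' A.holonomyBundle u₀
  -- Each neighbourhood $N_y$ lies in $S$ or misses it, so $S$ is open and closed.
  have key : ∀ y, ∀ x ∈ N y, ∀ x' ∈ N y, x ∈ S → x' ∈ S := by
    rintro y _ hx x' hx' ⟨v, hv, rfl⟩
    obtain ⟨c, hc, hc0, hc1⟩ := hreach y v hx x' hx'
    exact ⟨c 1, hv.tail ⟨c, hc, hc0, rfl⟩, hc1⟩
  have hclopen : IsClopen S := by
    constructor
    · rw [← isOpen_compl_iff, isOpen_iff_mem_nhds]
      intro y hy
      exact Filter.mem_of_superset (hN y) fun x hx hxS =>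
        hy (key y x hx y (mem_of_mem_nhds (hN y)) hxS)
    · rw [isOpen_iff_mem_nhds]
      intro y hy
      exact Filter.mem_of_superset (hN y) fun x hx =>
        key y y (mem_of_mem_nhds (hN y)) x hx hy
  have hne : S.Nonempty := ⟨_, u₀, Relation.ReflTransGen.refl, rfl⟩
  have huniv : x ∈ S := hclopen.eq_univ hne ▸ Set.mem_univ x
  exact huniv

/-- If a Howe subbundle with group $K$ contains the holonomy bundle, then $C(K)$ commutes with the
holonomy at $u_0$, so it lies in `lieCentralizer H`. Taking centralizers again gives $H\le$ `lieHull
H` $\le K$. Each point of $Q$ is the translate, by an element of $H$, of a holonomy point in its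
fibre. -/
theorem Connection.generates_holonomyBundle [PreconnectedSpace M] {A : B.Connection} {u₀ : P}
    (hQ : B.IsHoweSubbundle H Q) (hH : H ≤ lieHull H)
    (hsub : A.holonomyBundle u₀ ⊆ Q)
    (hhol : ∀ z : SOGrp n, (∀ g, B.act u₀ g ∈ A.holonomyBundle u₀ → Commute z.1 g.1) →
      z ∈ lieCentralizer H) : B.Generates (A.holonomyBundle u₀) Q := by
  refine ⟨⟨⟨H, hQ⟩, hsub⟩, ?_⟩
  rintro R ⟨⟨K, hR⟩, hRsub⟩ v hv
  have hu₀R : u₀ ∈ R := hRsub Relation.ReflTransGen.refl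
  have hle : Subgroup.centralizer (K : Set (SOGrp n)) ≤ lieCentralizer H := by
    intro z hz
    rw [SOGrp.mem_centralizer_iff] at hz
    refine hhol z fun g hg => hz g ?_
    have := hR.2.translation_mem hu₀R (hRsub hg) (B.proj_act u₀ g).symm
    rwa [B.translation_act] at this
  have hHK : H ≤ K := (hH.trans (Subgroup.centralizer_le hle)).trans hR.1.le
  obtain ⟨w, hw, hwv⟩ := A.exists_mem_holonomyBundle u₀ (B.proj v)
  obtain ⟨h, hh, rfl⟩ := hQ.2.2.1 w (hsub hw) v hv hwv
  exact hR.2.1 w (hRsub hw) h (hHK hh)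

end PrincipalSOBundle

end

theorem theorem6p6 {n d : ℕ} (hd : 2 ≤ d) {M : Type*} [TopologicalSpace M]
    [ChartedSpace (EuclideanSpace ℝ (Fin d)) M] [IsManifold (𝓡 d) ∞ M]
    [T2Space M] [SigmaCompactSpace M] [SimplyConnectedSpace M]
    {P : Type*} (B : PrincipalSOBundle n d M P)
    (H : Subgroup (SOGrp n)) (Q : Set P) (hQ : B.IsHoweSubbundle H Q) :
    B.IsHolonomyInduced Q ↔
      ¬ HasOFactor (howeHull (H.map (inclSO n))) 2 ∧
      ¬ HasDoubleOFactor (howeHull (H.map (inclSO n))) 1 := by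
  rw [← le_lieHull_iff hQ.1]
  refine ⟨PrincipalSOBundle.IsHolonomyInduced.le_lieHull hQ, fun hH => ?_⟩
  obtain ⟨x₀⟩ : Nonempty M := inferInstance
  obtain ⟨A, u₀, hsub, hhol⟩ := PrincipalSOBundle.exists_connection_holonomy hd hQ x₀
  exact ⟨A, u₀, A.generates_holonomyBundle hQ hH hsub hhol⟩
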